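/- Let $f\in C^\infty(\mathbb R/2\pi\mathbb Z)$, and let $M(X,Y,u)$, $V(X,u)$ be smooth real functions of $X,Y\ge 0$ and $u\in\mathbb R/2\pi\mathbb Z$, with $M(0,0,0)=0$, $V(0,0)=0$, $f'(0)=1$. Let $0<\tau<2\pi$ and assume: $f(0)=f(\tau)=0$; $f>0$ on $(0,\tau)$ and $f<0$ on $(\tau,2\pi)$; $f$, $M$, $V$ are invariant under $u\mapsto\tau-u$; $1+M>0$. Put $$H(u,v,x^2,y^2)=v+\tfrac12y^2\bigl(1+M(x^2,y^2,u)\bigr)-\tfrac12 f(u)x^2+\tfrac12x^4\bigl(1+V(x^2,u)\bigr),$$ and assume that there is a smooth $\kappa:(0,\tau)\to(0,\infty)$ with $\kappa(u)\to0$ as $u\to0^+$, $\partial_{x^2}H(u,v,\kappa(u)^2,0)=0$ and $\partial_{x^2}^2H(u,v,\kappa(u)^2,0)>0$ for all $u\in(0,\tau)$, where $H$ is differentiated as a function of the variables $x^2,y^2$. For $\epsilon>0$ consider $$\dot x=2y\,\partial_{y^2}H,\qquad \dot y=-2x\,\partial_{x^2}H,\qquad \dot u=\epsilon .$$ Set $$\vartheta(u)=2\kappa(u)^2\,\partial_{x^2}^2H(u,v,\kappa(u)^2,0)\,\bigl(1+M(\kappa(u)^2,0,u)\bigr),\qquad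 e_1=\int_0^{\tau/2}\vartheta(u)^{1/2}\,du .$$ For $\delta>0$ let $\mu=\epsilon^{1/3}\delta^{-1/2}$, $u=\mu^2\hat u$, $\hat\Omega=(2\mu^{-2}\vartheta(u))^{1/2}$. Near the branch $(x,y)=\eta(\kappa(u),0)$, $\eta\in\{1,-1\}$, introduce action-angle variables $(\hat\varrho_0,\phi_0)$, $\hat\varrho_0>0$, by $$x=\eta\bigl(\kappa(u)+\mu\delta^{3/4}\hat\xi\bigr),\qquad y=\eta\,\mu^2\delta^{3/4}\hat\sigma,$$ $$\sqrt{2\hat\varrho_0}\cos\phi_0=\hat\Omega^{1/2}\bigl(1+M(\kappa(u)^2,0,u)\bigr)^{-1/2}\hat\xi,\qquad \sqrt{2\hat\varrho_0}\sin\phi_0=\hat\Omega^{-1/2}\bigl(1+M(\kappa(u)^2,0,u)\bigr)^{1/2}\hat\sigma .$$ The inner map $P_i:(\hat\varrho_0,\phi_0)(\hat u=\hat u_*)\mapsto(\hat\varrho_0,\phi_0)(u=\tau/2)$ follows the orbits of the system from $u=\mu^2\hat u_*$ to $u=\tau/2$, the angle being continued continuously along the orbit in $\mathbb R$. **Proposition.**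 There is a constant $e_2>0$, depending only on the system, such that for every fixed $\hat u_*>0$ and every compact interval $[a,b]\subset(0,\infty)$ there are $r>0$ and $C>0$ for which the following holds. If $0<\epsilon\le r$, $\delta>0$, $$\delta^{3/4}\ln\epsilon^{-1}\le r\qquad\text{and}\qquad \epsilon^{2/3}\delta^{-7/2}\ln^3\delta^{-1}\le r,$$ then $\mu^2\hat u_*<\tau/2$, and for both choices of $\eta$ the map $P_i$ is well defined at every $(\hat\varrho_0,\phi_0)\in[a,b]\times\mathbb R$ and $$P_i(\hat\varrho_0,\phi_0)=\begin{pmatrix}\hat\varrho_0\\ \phi_0-\sqrt2\,\epsilon^{-1}e_1+\bigl(2\ln(e_2\epsilon^{-1})-3\ln(\delta^{-1}\hat u_*)\bigr)\hat\varrho_0+\frac{2\sqrt2}{3}\delta^{-3/2}\hat u_*^{3/2}\end{pmatrix}+R,$$ where both components of $R$ are bounded in absolute value by $C\,\delta^{3/4}\ln\epsilon^{-1}$. -/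

import Mathlib

noncomputable section

/-- The Hamiltonian
`H(u, v, x², y²) = v + y²(1 + M(x², y², u))/2 - f(u) x²/2 + x⁴(1 + V(x², u))/2`,
as a function of `u`, `v`, `X = x²` and `Y = y²`. -/
def slowFastH (f : ℝ → ℝ) (M : ℝ → ℝ → ℝ → ℝ) (V : ℝ → ℝ → ℝ) (u v X Y : ℝ) : ℝ :=
  v + 1 / 2 * Y * (1 + M X Y u) - 1 / 2 * f u * X + 1 / 2 * X ^ 2 * (1 + V X u)

/-- The partial derivative of `H` with respect to `x²` (it does not depend on `v`). -/
def slowFastHX (f : ℝ → ℝ) (M : ℝ → ℝ → ℝ → ℝ) (V : ℝ → ℝ → ℝ) (u X Y : ℝ) : ℝ :=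
  deriv (fun X' => slowFastH f M V u 0 X' Y) X

/-- The second partial derivative of `H` with respect to `x²`. -/
def slowFastHXX (f : ℝ → ℝ) (M : ℝ → ℝ → ℝ → ℝ) (V : ℝ → ℝ → ℝ) (u X Y : ℝ) : ℝ :=
  deriv (fun X' => slowFastHX f M V u X' Y) X

/-- The partial derivative of `H` with respect to `y²` (it does not depend on `v`). -/
def slowFastHY (f : ℝ → ℝ) (M : ℝ → ℝ → ℝ → ℝ) (V : ℝ → ℝ → ℝ) (u X Y : ℝ) : ℝ :=
  deriv (fun Y' => slowFastH f M V u 0 X Y') Y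

/-- The assumptions on the data `f`, `M`, `V`, `τ` and on the branch `κ` of equilibria.
The phase `u` lies on the circle `ℝ / 2πℤ`, so `f`, `M`, `V` are `2π`-periodic in `u`.
The arguments `X = x²`, `Y = y²` are physically nonnegative; a smooth function on `X, Y ≥ 0`
is the restriction of a smooth function on the whole space, and all conditions other than
smoothness are only imposed for `X, Y ≥ 0`. -/
structure SlowFastAssumptions (f : ℝ → ℝ) (M : ℝ → ℝ → ℝ → ℝ) (V : ℝ → ℝ → ℝ)
    (τ : ℝ) (κ : ℝ → ℝ) : Prop where
  smooth_f : ContDiff ℝ ((⊤ : ℕ∞) : WithTop ℕ∞) f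
  smooth_M : ContDiff ℝ ((⊤ : ℕ∞) : WithTop ℕ∞) (fun p : ℝ × ℝ × ℝ => M p.1 p.2.1 p.2.2)
  smooth_V : ContDiff ℝ ((⊤ : ℕ∞) : WithTop ℕ∞) (fun p : ℝ × ℝ => V p.1 p.2)
  periodic_f : ∀ u, f (u + 2 * Real.pi) = f u
  periodic_M : ∀ X Y u, 0 ≤ X → 0 ≤ Y → M X Y (u + 2 * Real.pi) = M X Y u
  periodic_V : ∀ X u, 0 ≤ X → V X (u + 2 * Real.pi) = V X u
  M_zero : M 0 0 0 = 0
  V_zero : V 0 0 = 0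
  deriv_f_zero : deriv f 0 = 1
  tau_pos : 0 < τ
  tau_lt : τ < 2 * Real.pi
  f_zero : f 0 = 0
  f_tau : f τ = 0
  f_pos : ∀ u, 0 < u → u < τ → 0 < f u
  f_neg : ∀ u, τ < u → u < 2 * Real.pi → f u < 0
  symm_f : ∀ u, f (τ - u) = f u
  symm_M : ∀ X Y u, 0 ≤ X → 0 ≤ Y → M X Y (τ - u) = M X Y u
  symm_V : ∀ X u, 0 ≤ X → V X (τ - u) = V X u
  one_add_M_pos : ∀ X Y u, 0 ≤ X → 0 ≤ Y → 0 < 1 + M X Y u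
  /-- `κ` is the branch of equilibria `(x, y) = (±κ(u), 0)` that bifurcates from `0` at `u = 0`;
  it extends as a smooth, positive and nondegenerate branch to all of `(0, τ)`. -/
  kappa_smooth : ContDiffOn ℝ ((⊤ : ℕ∞) : WithTop ℕ∞) κ (Set.Ioo 0 τ)
  kappa_pos : ∀ u, 0 < u → u < τ → 0 < κ u
  kappa_eq : ∀ u, 0 < u → u < τ → slowFastHX f M V u (κ u ^ 2) 0 = 0
  kappa_nondeg : ∀ u, 0 < u → u < τ → 0 < slowFastHXX f M V u (κ u ^ 2) 0
  kappa_bifurcates : Filter.Tendsto κ (nhdsWithin 0 (Set.Ioi 0)) (nhds 0)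

/-- `ϑ(u) = 2 κ(u)² ∂²H/∂(x²)² (κ(u)², 0, u) (1 + M(κ(u)², 0, u))`;
`2 ϑ(u)` is the squared frequency of the fast subsystem at `(±κ(u), 0)`. -/
def vartheta (f : ℝ → ℝ) (M : ℝ → ℝ → ℝ → ℝ) (V : ℝ → ℝ → ℝ) (κ : ℝ → ℝ) (u : ℝ) : ℝ :=
  2 * κ u ^ 2 * slowFastHXX f M V u (κ u ^ 2) 0 * (1 + M (κ u ^ 2) 0 u)

/-- `e₁ = ∫₀^{τ/2} ϑ(u)^{1/2} du`. -/
def eOne (f : ℝ → ℝ) (M : ℝ → ℝ → ℝ → ℝ) (V : ℝ → ℝ → ℝ) (τ : ℝ) (κ : ℝ → ℝ) : ℝ :=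
  ∫ u in (0 : ℝ)..(τ / 2), Real.sqrt (vartheta f M V κ u)

/-- The scaling parameter `μ = ε^{1/3} δ^{-1/2}`; the scaled phase `û` is given by `u = μ² û`. -/
def muScale (ε δ : ℝ) : ℝ := ε ^ (1 / 3 : ℝ) * δ ^ (-(1 / 2) : ℝ)

/-- The scaled frequency `Ω̂ = (2 μ⁻² ϑ(u))^{1/2}`, as a function of `u = μ² û`. -/
def omegaHat (f : ℝ → ℝ) (M : ℝ → ℝ → ℝ → ℝ) (V : ℝ → ℝ → ℝ) (κ : ℝ → ℝ) (ε δ u : ℝ) : ℝ :=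
  Real.sqrt (2 * (muScale ε δ)⁻¹ ^ 2 * vartheta f M V κ u)

/-- The `x`-coordinate of the point with action-angle variables `(ϱ, φ)` at phase `u` on the
branch with sign `η = ±1`: `x = η (κ(u) + ξ)`, `ξ = μ δ^{3/4} ξ̂` and
`√(2ϱ) cos φ = Ω̂^{1/2} (1 + M(κ(u)², 0, u))^{-1/2} ξ̂`. -/
def innerX (f : ℝ → ℝ) (M : ℝ → ℝ → ℝ → ℝ) (V : ℝ → ℝ → ℝ) (κ : ℝ → ℝ) (ε δ η u ϱ φ : ℝ) : ℝ :=
  η * (κ u + muScale ε δ * δ ^ (3 / 4 : ℝ) *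
    (Real.sqrt (1 + M (κ u ^ 2) 0 u) / Real.sqrt (omegaHat f M V κ ε δ u) *
      (Real.sqrt (2 * ϱ) * Real.cos φ)))

/-- The `y`-coordinate of the same point: `y = η σ`, `σ = μ² δ^{3/4} σ̂` and
`√(2ϱ) sin φ = Ω̂^{-1/2} (1 + M(κ(u)², 0, u))^{1/2} σ̂`. -/
def innerY (f : ℝ → ℝ) (M : ℝ → ℝ → ℝ → ℝ) (V : ℝ → ℝ → ℝ) (κ : ℝ → ℝ) (ε δ η u ϱ φ : ℝ) : ℝ :=
  η * (muScale ε δ ^ 2 * δ ^ (3 / 4 : ℝ) *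
    (Real.sqrt (omegaHat f M V κ ε δ u) / Real.sqrt (1 + M (κ u ^ 2) 0 u) *
      (Real.sqrt (2 * ϱ) * Real.sin φ)))

/-- `(x(u), y(u))` is, on the phase interval `[a, b]`, an orbit of the system
`ẋ = 2y ∂H/∂(y²)`, `ẏ = -2x ∂H/∂(x²)`, `u̇ = ε`, parametrized by the phase `u`. -/
def IsOrbitOn (f : ℝ → ℝ) (M : ℝ → ℝ → ℝ → ℝ) (V : ℝ → ℝ → ℝ) (ε a b : ℝ) (x y : ℝ → ℝ) : Prop :=
  ∀ u ∈ Set.Icc a b,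
    HasDerivWithinAt x (ε⁻¹ * (2 * y u * slowFastHY f M V u (x u ^ 2) (y u ^ 2)))
      (Set.Icc a b) u ∧
    HasDerivWithinAt y (ε⁻¹ * (-(2 * x u * slowFastHX f M V u (x u ^ 2) (y u ^ 2))))
      (Set.Icc a b) u

/-- The graph of the inner map (in the branch `η = ±1`, on the universal cover of the
action-angle variables): `p = (ϱ, φ)` at `û = uStar` is sent to `q` at `u = τ/2`, when an orbit
of the system can be written in action-angle variables `(ϱ(u), φ(u))`, with `ϱ > 0` and both
continuous, for `u ∈ [μ² uStar, τ/2]`, and takes the values `p` and `q` at the two ends. -/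
def InnerMapsTo (f : ℝ → ℝ) (M : ℝ → ℝ → ℝ → ℝ) (V : ℝ → ℝ → ℝ) (τ : ℝ) (κ : ℝ → ℝ)
    (ε δ uStar η : ℝ) (p q : ℝ × ℝ) : Prop :=
  muScale ε δ ^ 2 * uStar < τ / 2 ∧
  ∃ ϱ φ : ℝ → ℝ,
    ContinuousOn ϱ (Set.Icc (muScale ε δ ^ 2 * uStar) (τ / 2)) ∧
    ContinuousOn φ (Set.Icc (muScale ε δ ^ 2 * uStar) (τ / 2)) ∧
    (∀ u ∈ Set.Icc (muScale ε δ ^ 2 * uStar) (τ / 2), 0 < ϱ u) ∧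
    IsOrbitOn f M V ε (muScale ε δ ^ 2 * uStar) (τ / 2)
      (fun u => innerX f M V κ ε δ η u (ϱ u) (φ u))
      (fun u => innerY f M V κ ε δ η u (ϱ u) (φ u)) ∧
    (ϱ (muScale ε δ ^ 2 * uStar), φ (muScale ε δ ^ 2 * uStar)) = p ∧
    (ϱ (τ / 2), φ (τ / 2)) = q

end

/-!
The system is an oscillator whose frequency vanishes at the bifurcation `u = 0`. The claim is that
the action of an oscillation around the branch `κ` is an adiabatic invariant and that its phase is
obtained by integrating the frequency, including the dependence of the frequency on the action.

The squared branch is `κ(u)² = u k₀(u)` with `k₀` smooth and positive up to `u = 0`, by the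
implicit function theorem (`SlowFastAssumptions.exists_branch`). With `E = √ε u^{-3/4}`, write
`x = κ (1 + p)`, `y = κ² q` and `z = (α p + i β q) / E`, where `α(u)`, `β(u)` turn the linear part
into a rotation. Then `z = √(2ϱ) e^{iφ}` in the action-angle variables of the statement
(`SlowFastAssumptions.innerX_eq`, `innerY_eq`), and `z` satisfies
`u z' = ω (-i E⁻² z + E⁻¹ (quadratic in z, z̄) + (cubic in z, z̄)) + O(E)`, with coefficients that
are smooth functions of `u` up to `u = 0` (`BranchData.Regular.exists_field_estimate`). Two steps
of normalization, `ζ = z + E h₁ + E² h₂`, remove all terms but the rotation and the resonant cubic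
one, `u ζ' = i (-ω E⁻² + γ |z|²) ζ + O(E)` (`OscCoeffs.Smooth.exists_normalForm`); that no linear
resonant term `z` is left, so that the action is conserved without a drift, is due to the
Hamiltonian structure (`deriv_β`, `m₁_eq`). Since `∫ E du/u` is bounded by a multiple of `E(u₀)`,
where `u₀` is the initial phase, `|z|²` changes by `O(E(u₀))`, and the angle deviates from that of
the rotation with the initial value of `|z|²` by `O(E(u₀) (1 + ln (τ / (2 u₀))))`
(`OscCoeffs.Smooth.exists_rotation_estimate`). The same estimate, as an a priori bound, shows that
the orbit exists up to `u = τ/2` (`BranchData.Regular.exists_orbit`). For `u₀ = μ² û_*` one has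
`E(u₀) = δ^{3/4} û_*^{-3/4}`, which gives the error of the proposition.

It remains to integrate the frequency (`BranchData.Regular.exists_phase_bound`). The linear part is
`ε⁻¹ ∫ √v ω(v) dv`, where `√v ω(v) = √(2 ϑ(v))` and `ω(0) = √2`; the part of the integral from `0`
to `u₀` gives the term `(2√2/3) δ^{-3/2} û_*^{3/2}`. The nonlinear part is `2 ϱ₀ ∫ γ(v) dv/v`, and
the logarithmic terms come from the value `γ(0) = 3/2` (`BranchData.Regular.γ_zero`), while
`∫ (γ(v) - 3/2) dv/v` converges at `0` and determines `e₂`.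
-/

open Set Filter Topology

noncomputable section

/-! ### Functions that are smooth up to the bifurcation -/

/-- The function `c` is smooth in a neighbourhood of every point of the closed interval `[0, U]`, in
particular at the bifurcation phase `u = 0`. -/
def SmoothIcc (U : ℝ) (c : ℝ → ℝ) : Prop :=
  ∀ u ∈ Icc 0 U, ContDiffAt ℝ ((⊤ : ℕ∞) : WithTop ℕ∞) c u

namespace SmoothIcc

variable {U : ℝ} {c d : ℝ → ℝ}

theorem const (x : ℝ) : SmoothIcc U (fun _ => x) := fun _ _ => contDiffAt_const

theorem id : SmoothIcc U (fun u => u) := fun _ _ => contDiffAt_id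

theorem add (hc : SmoothIcc U c) (hd : SmoothIcc U d) : SmoothIcc U (fun u => c u + d u) :=
  fun u hu => (hc u hu).add (hd u hu)

theorem sub (hc : SmoothIcc U c) (hd : SmoothIcc U d) : SmoothIcc U (fun u => c u - d u) :=
  fun u hu => (hc u hu).sub (hd u hu)

theorem neg (hc : SmoothIcc U c) : SmoothIcc U (fun u => -c u) :=
  fun u hu => (hc u hu).neg

theorem mul (hc : SmoothIcc U c) (hd : SmoothIcc U d) : SmoothIcc U (fun u => c u * d u) :=
  fun u hu => (hc u hu).mul (hd u hu)

theorem pow (hc : SmoothIcc U c) (n : ℕ) : SmoothIcc U (fun u => c u ^ n) :=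
  fun u hu => (hc u hu).pow n

theorem div (hc : SmoothIcc U c) (hd : SmoothIcc U d) (h0 : ∀ u ∈ Icc 0 U, d u ≠ 0) :
    SmoothIcc U (fun u => c u / d u) :=
  fun u hu => (hc u hu).div (hd u hu) (h0 u hu)

theorem sqrt (hc : SmoothIcc U c) (h0 : ∀ u ∈ Icc 0 U, 0 < c u) :
    SmoothIcc U (fun u => Real.sqrt (c u)) :=
  fun u hu => (hc u hu).sqrt (h0 u hu).ne'

theorem deriv (hc : SmoothIcc U c) : SmoothIcc U (deriv c) := fun u hu => by
  have h := (hc u hu).fderiv_right (m := ((⊤ : ℕ∞) : WithTop ℕ∞)) (by simp)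
  have h2 : ContDiffAt ℝ ((⊤ : ℕ∞) : WithTop ℕ∞) (fun x => fderiv ℝ c x 1) u :=
    h.clm_apply contDiffAt_const
  simpa only [fderiv_apply_one_eq_deriv] using h2

theorem comp_contDiff {E : Type*} [NormedAddCommGroup E] [NormedSpace ℝ E] {F : E → ℝ}
    (hF : ContDiff ℝ ((⊤ : ℕ∞) : WithTop ℕ∞) F) {g : ℝ → E}
    (hg : ∀ u ∈ Icc 0 U, ContDiffAt ℝ ((⊤ : ℕ∞) : WithTop ℕ∞) g u) :
    SmoothIcc U (fun u => F (g u)) :=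
  fun u hu => hF.contDiffAt.comp u (hg u hu)

theorem continuousOn (hc : SmoothIcc U c) : ContinuousOn c (Icc 0 U) :=
  fun u hu => (hc u hu).continuousAt.continuousWithinAt

theorem hasDerivAt (hc : SmoothIcc U c) {u : ℝ} (hu : u ∈ Icc 0 U) :
    HasDerivAt c (_root_.deriv c u) u :=
  ((hc u hu).differentiableAt (by simp)).hasDerivAt

theorem exists_bound (hc : SmoothIcc U c) : ∃ C, 0 < C ∧ ∀ u ∈ Icc 0 U, |c u| ≤ C := by
  obtain ⟨C, hC⟩ := isCompact_Icc.exists_bound_of_continuousOn hc.continuousOn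
  exact ⟨max C 1, by positivity, fun u hu => (hC u hu).trans (le_max_left _ _)⟩

theorem exists_lower_bound (hc : SmoothIcc U c) (h0 : ∀ u ∈ Icc 0 U, 0 < c u) :
    ∃ C, 0 < C ∧ ∀ u ∈ Icc 0 U, C ≤ c u := by
  rcases (Icc (0 : ℝ) U).eq_empty_or_nonempty with h | h
  · exact ⟨1, one_pos, by simp [h]⟩
  · obtain ⟨x, hx, hm⟩ := isCompact_Icc.exists_isMinOn h hc.continuousOn
    exact ⟨c x, h0 x hx, fun u hu => hm hu⟩

end SmoothIcc

/-! ### The normal form of the rescaled system -/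

/-- The small parameter `√ε u^{-3/4}` at phase `u`: the relative amplitude of an oscillation of
action of order `ε`; its square is the adiabaticity ratio `ε u^{-3/2}`. -/
def smallE (ε u : ℝ) : ℝ := Real.sqrt ε * u ^ (-(3 / 4) : ℝ)

theorem smallE_pos {ε u : ℝ} (hε : 0 < ε) (hu : 0 < u) : 0 < smallE ε u :=
  mul_pos (Real.sqrt_pos.2 hε) (Real.rpow_pos_of_pos hu _)

theorem hasDerivAt_smallE {ε u : ℝ} (hu : 0 < u) :
    HasDerivAt (smallE ε) (-(3 / 4) * smallE ε u / u) u := by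
  have h := (Real.hasDerivAt_rpow_const (x := u) (p := (-(3 / 4) : ℝ)) (Or.inl hu.ne')).const_mul
    (Real.sqrt ε)
  refine h.congr_deriv ?_
  rw [smallE, Real.rpow_sub_one hu.ne']
  ring

theorem smallE_anti {ε u v : ℝ} (hu : 0 < u) (huv : u ≤ v) : smallE ε v ≤ smallE ε u :=
  mul_le_mul_of_nonneg_left (Real.rpow_le_rpow_of_nonpos hu huv (by norm_num))
    (Real.sqrt_nonneg _)

/-- The coefficients of the rescaled system in the complex variable `z`, up to an error of order
`E = smallE ε u`:
`u z' = ω (-i E⁻² z + E⁻¹ (i (a z² + 2 a z z̄ + c z̄²) - B)`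
`  + i (c₃₀ z³ + c₂₁ z² z̄ + c₁₂ z z̄² + c₀₃ z̄³) + l z̄)`. -/
structure OscCoeffs where
  ω : ℝ → ℝ
  a : ℝ → ℝ
  c : ℝ → ℝ
  B : ℝ → ℝ
  c30 : ℝ → ℝ
  c21 : ℝ → ℝ
  c12 : ℝ → ℝ
  c03 : ℝ → ℝ
  l : ℝ → ℝ

namespace OscCoeffs

variable (N : OscCoeffs)

/-- All coefficients are smooth on `[0, U]`. -/
structure Smooth (U : ℝ) : Prop where
  ω : SmoothIcc U N.ω
  a : SmoothIcc U N.a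
  c : SmoothIcc U N.c
  B : SmoothIcc U N.B
  c30 : SmoothIcc U N.c30
  c21 : SmoothIcc U N.c21
  c12 : SmoothIcc U N.c12
  c03 : SmoothIcc U N.c03
  l : SmoothIcc U N.l

/-- The truncated vector field. -/
def field (E u : ℝ) (z : ℂ) : ℂ :=
  N.ω u * (-Complex.I * (E : ℂ)⁻¹ ^ 2 * z
    + (E : ℂ)⁻¹ * (Complex.I * (N.a u * z ^ 2 + 2 * N.a u * z * star z
      + N.c u * star z ^ 2) - N.B u)
    + (Complex.I * (N.c30 u * z ^ 3 + N.c21 u * z ^ 2 * star z + N.c12 u * z * star z ^ 2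
        + N.c03 u * star z ^ 3) + N.l u * star z))

/-- The coefficient of the resonant term `i |z|² z` in the normal form, that is, minus the
derivative of the frequency with respect to `|z|²`. -/
def γ (u : ℝ) : ℝ := N.ω u * (N.c21 u + 6 * N.a u ^ 2 + 2 / 3 * N.c u ^ 2)

/-- The coefficient of `z³` in the normalizing transformation. -/
def b1 (u : ℝ) : ℝ := 1 / 2 * (N.c30 u + 2 * N.a u ^ 2 + 2 * N.a u * N.c u)

/-- The coefficient of `z z̄²` in the normalizing transformation. -/
def b2 (u : ℝ) : ℝ := -(1 / 2) * (N.c12 u - 2 * N.a u ^ 2 + 10 / 3 * N.a u * N.c u)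

/-- The coefficient of `z̄³` in the normalizing transformation. -/
def b3 (u : ℝ) : ℝ := -(1 / 4) * (N.c03 u - 4 / 3 * N.a u * N.c u)

/-- The coefficient of `i z̄` in the normalizing transformation. -/
def b4 (u : ℝ) : ℝ := 1 / 2 * (N.l u + 2 * N.B u * N.a u + 2 / 3 * N.B u * N.c u)

end OscCoeffs

/-- The first order terms of the normalizing transformation, with `v` in place of `z̄`. -/
def nfH1 (a c B : ℝ) (z v : ℂ) : ℂ :=
  a * z ^ 2 - 2 * a * z * v - c / 3 * v ^ 2 - Complex.I * B

/-- The second order terms of the normalizing transformation, with `v` in place of `z̄`. -/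
def nfH2 (b1 b2 b3 b4 : ℝ) (z v : ℂ) : ℂ :=
  b1 * z ^ 3 + b2 * z * v ^ 2 + b3 * v ^ 3 + Complex.I * b4 * v

/-- The error of the normal form, divided by `E`. The vector `w` holds the coefficients
`ω, a, c, B, c₃₀, c₂₁, c₁₂, c₀₃, l, b₁, b₂, b₃, b₄`, and `d` the values of `u ∂/∂u` of
`a, c, B, b₁, b₂, b₃, b₄`; the error of the truncated vector field is `E ρ`. -/
def nfErr (q : (Fin 13 → ℝ) × (Fin 7 → ℝ) × ℂ × ℂ × ℝ) : ℂ :=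
  let w := q.1
  let d := q.2.1
  let z := q.2.2.1
  let v := star q.2.2.1
  let ρ := q.2.2.2.1
  let E : ℝ := q.2.2.2.2
  let n1 : ℂ := Complex.I * (w 1 * z ^ 2 + 2 * w 1 * z * v + w 2 * v ^ 2) - w 3
  let n1' : ℂ := -Complex.I * (w 1 * v ^ 2 + 2 * w 1 * v * z + w 2 * z ^ 2) - w 3
  let n0 : ℂ := Complex.I * (w 4 * z ^ 3 + w 5 * z ^ 2 * v + w 6 * z * v ^ 2 + w 7 * v ^ 3)
    + w 8 * v
  let n0' : ℂ := -Complex.I * (w 4 * v ^ 3 + w 5 * v ^ 2 * z + w 6 * v * z ^ 2 + w 7 * z ^ 3)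
    + w 8 * z
  ρ - 3 / 4 * nfH1 (w 1) (w 2) (w 3) z v + nfH1 (d 0) (d 1) (d 2) z v
    + (2 * w 1 * z - 2 * w 1 * v) * (w 0 * n0 + E * ρ)
    + (-2 * w 1 * z - 2 / 3 * w 2 * v) * (w 0 * n0' + E * star ρ)
    + E * (-(3 / 2) * nfH2 (w 9) (w 10) (w 11) (w 12) z v + nfH2 (d 3) (d 4) (d 5) (d 6) z v)
    + (3 * w 9 * z ^ 2 + w 10 * v ^ 2) * (w 0 * (n1 + E * n0) + E ^ 2 * ρ)
    + (2 * w 10 * z * v + 3 * w 11 * v ^ 2 + Complex.I * w 12)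
      * (w 0 * (n1' + E * n0') + E ^ 2 * star ρ)

theorem continuous_nfErr : Continuous nfErr := by
  unfold nfErr nfH1 nfH2
  fun_prop

namespace OscCoeffs

variable (N : OscCoeffs)

/-- The normalizing transformation `ζ = z + E h₁ + E² h₂`. -/
def zeta (ε : ℝ) (z : ℝ → ℂ) (u : ℝ) : ℂ :=
  z u + smallE ε u * nfH1 (N.a u) (N.c u) (N.B u) (z u) (star (z u))
    + smallE ε u ^ 2 * nfH2 (N.b1 u) (N.b2 u) (N.b3 u) (N.b4 u) (z u) (star (z u))

variable {N} {U : ℝ}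

namespace Smooth

theorem γ (hN : N.Smooth U) : SmoothIcc U N.γ :=
  hN.ω.mul ((hN.c21.add ((SmoothIcc.const 6).mul (hN.a.pow 2))).add
    ((SmoothIcc.const (2 / 3)).mul (hN.c.pow 2)))

theorem b1 (hN : N.Smooth U) : SmoothIcc U N.b1 :=
  (SmoothIcc.const _).mul ((hN.c30.add ((SmoothIcc.const _).mul (hN.a.pow 2))).add
    (((SmoothIcc.const _).mul hN.a).mul hN.c))

theorem b2 (hN : N.Smooth U) : SmoothIcc U N.b2 :=
  (SmoothIcc.const _).mul ((hN.c12.sub ((SmoothIcc.const _).mul (hN.a.pow 2))).add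
    (((SmoothIcc.const _).mul hN.a).mul hN.c))

theorem b3 (hN : N.Smooth U) : SmoothIcc U N.b3 :=
  (SmoothIcc.const _).mul (hN.c03.sub (((SmoothIcc.const _).mul hN.a).mul hN.c))

theorem b4 (hN : N.Smooth U) : SmoothIcc U N.b4 :=
  (SmoothIcc.const _).mul ((hN.l.add (((SmoothIcc.const _).mul hN.B).mul hN.a)).add
    (((SmoothIcc.const _).mul hN.B).mul hN.c))

end Smooth

end OscCoeffs

theorem exists_nfErr_bound (R : ℝ) : ∃ C, 0 < C ∧ ∀ q : (Fin 13 → ℝ) × (Fin 7 → ℝ) × ℂ × ℂ × ℝ,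
    ‖q‖ ≤ R → ‖nfErr q‖ ≤ C := by
  obtain ⟨C, hC⟩ := (isCompact_closedBall (0 : (Fin 13 → ℝ) × (Fin 7 → ℝ) × ℂ × ℂ × ℝ)
    R).exists_bound_of_continuousOn continuous_nfErr.continuousOn
  exact ⟨max C 1, by positivity, fun q hq => (hC q (by simpa using hq)).trans (le_max_left _ _)⟩

theorem exists_nfH_bound (R : ℝ) : ∃ C, 0 < C ∧ ∀ (w : Fin 7 → ℝ) (z : ℂ) (E : ℝ),
    ‖w‖ ≤ R → ‖z‖ ≤ R → |E| ≤ 1 →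
    ‖nfH1 (w 0) (w 1) (w 2) z (star z) + E * nfH2 (w 3) (w 4) (w 5) (w 6) z (star z)‖ ≤ C := by
  have hc : Continuous (fun q : (Fin 7 → ℝ) × ℂ × ℝ =>
      nfH1 (q.1 0) (q.1 1) (q.1 2) q.2.1 (star q.2.1)
        + q.2.2 * nfH2 (q.1 3) (q.1 4) (q.1 5) (q.1 6) q.2.1 (star q.2.1)) := by
    unfold nfH1 nfH2
    fun_prop
  obtain ⟨C, hC⟩ := (isCompact_closedBall (0 : (Fin 7 → ℝ) × ℂ × ℝ)
    (max R 1)).exists_bound_of_continuousOn hc.continuousOn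
  refine ⟨max C 1, by positivity, fun w z E hw hz hE => ?_⟩
  refine (hC (w, z, E) ?_).trans (le_max_left _ _)
  simp only [Metric.mem_closedBall, dist_zero_right, Prod.norm_def, Real.norm_eq_abs, sup_le_iff]
  exact ⟨hw.trans (le_max_left _ _), hz.trans (le_max_left _ _), hE.trans (le_max_right _ _)⟩

theorem abs_vec_le {n : ℕ} (w : Fin n → ℝ) {R : ℝ} (hR : 0 ≤ R) (h : ∀ i, |w i| ≤ R) : ‖w‖ ≤ R :=
  (pi_norm_le_iff_of_nonneg hR).2 h

namespace OscCoeffs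

variable {N : OscCoeffs} {U : ℝ}

theorem Smooth.exists_zeta_sub_bound (hN : N.Smooth U) (Z : ℝ) : ∃ C, 0 < C ∧
    ∀ ε u, 0 < ε → u ∈ Ioc 0 U → smallE ε u ≤ 1 → ∀ z : ℝ → ℂ, ‖z u‖ ≤ Z →
      ‖N.zeta ε z u - z u‖ ≤ C * smallE ε u := by
  obtain ⟨C0, h0, k0⟩ := hN.a.exists_bound
  obtain ⟨C1, h1, k1⟩ := hN.c.exists_bound
  obtain ⟨C2, h2, k2⟩ := hN.B.exists_bound
  obtain ⟨C3, h3, k3⟩ := hN.b1.exists_bound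
  obtain ⟨C4, h4, k4⟩ := hN.b2.exists_bound
  obtain ⟨C5, h5, k5⟩ := hN.b3.exists_bound
  obtain ⟨C6, h6, k6⟩ := hN.b4.exists_bound
  obtain ⟨C, hC, hb⟩ := exists_nfH_bound (C0 + C1 + C2 + C3 + C4 + C5 + C6 + |Z|)
  refine ⟨C, hC, fun ε u hε hu hE z hz => ?_⟩
  have hu' : u ∈ Icc 0 U := ⟨hu.1.le, hu.2⟩
  have hEp := smallE_pos hε hu.1
  have hZ := le_abs_self Z
  have hZ' := abs_nonneg Z
  have := hb ![N.a u, N.c u, N.B u, N.b1 u, N.b2 u, N.b3 u, N.b4 u] (z u) (smallE ε u)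
    (abs_vec_le _ (by positivity) (by
      simp only [Fin.forall_fin_succ, Fin.isEmpty.forall_iff, Matrix.cons_val_zero,
        Matrix.cons_val_succ, and_true]
      have := k0 u hu'; have := k1 u hu'; have := k2 u hu'; have := k3 u hu'
      have := k4 u hu'; have := k5 u hu'; have := k6 u hu'
      refine ⟨?_, ?_, ?_, ?_, ?_, ?_, ?_⟩ <;> linarith)) (by linarith)
    (by rw [abs_of_pos hEp]; exact hE)
  have e : N.zeta ε z u - z u = (smallE ε u : ℂ) *
      (nfH1 (N.a u) (N.c u) (N.B u) (z u) (star (z u)) + smallE ε u *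
        nfH2 (N.b1 u) (N.b2 u) (N.b3 u) (N.b4 u) (z u) (star (z u))) := by
    rw [zeta]; ring
  rw [e, norm_mul, Complex.norm_real, Real.norm_eq_abs, abs_of_pos hEp, mul_comm C]
  exact mul_le_mul_of_nonneg_left this hEp.le

theorem nfH1_hasDerivWithinAt {a c B : ℝ → ℝ} {a' c' B' : ℝ} {z v : ℝ → ℂ} {z' v' : ℂ}
    {s : Set ℝ} {u : ℝ} (ha : HasDerivAt a a' u) (hc : HasDerivAt c c' u) (hB : HasDerivAt B B' u)
    (hz : HasDerivWithinAt z z' s u) (hv : HasDerivWithinAt v v' s u) :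
    HasDerivWithinAt (fun u => nfH1 (a u) (c u) (B u) (z u) (v u))
      (nfH1 a' c' B' (z u) (v u) + (2 * a u * z u - 2 * a u * v u) * z'
        + (-2 * a u * z u - 2 / 3 * c u * v u) * v') s u := by
  have ha' := ha.ofReal_comp.hasDerivWithinAt (s := s)
  have hc' := hc.ofReal_comp.hasDerivWithinAt (s := s)
  have hB' := hB.ofReal_comp.hasDerivWithinAt (s := s)
  have h := (((ha'.mul (hz.pow 2)).sub (((ha'.const_mul 2).mul hz).mul hv)).sub
    ((hc'.div_const 3).mul (hv.pow 2))).sub (hB'.const_mul Complex.I)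
  convert! h using 1
  simp only [nfH1, Pi.pow_apply, Pi.mul_apply]
  push_cast
  ring

theorem nfH2_hasDerivWithinAt {a b c d : ℝ → ℝ} {a' b' c' d' : ℝ} {z v : ℝ → ℂ} {z' v' : ℂ}
    {s : Set ℝ} {u : ℝ} (ha : HasDerivAt a a' u) (hb : HasDerivAt b b' u) (hc : HasDerivAt c c' u)
    (hd : HasDerivAt d d' u) (hz : HasDerivWithinAt z z' s u) (hv : HasDerivWithinAt v v' s u) :
    HasDerivWithinAt (fun u => nfH2 (a u) (b u) (c u) (d u) (z u) (v u))
      (nfH2 a' b' c' d' (z u) (v u) + (3 * a u * z u ^ 2 + b u * v u ^ 2) * z'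
        + (2 * b u * z u * v u + 3 * c u * v u ^ 2 + Complex.I * d u) * v') s u := by
  have ha' := ha.ofReal_comp.hasDerivWithinAt (s := s)
  have hb' := hb.ofReal_comp.hasDerivWithinAt (s := s)
  have hc' := hc.ofReal_comp.hasDerivWithinAt (s := s)
  have hd' := hd.ofReal_comp.hasDerivWithinAt (s := s)
  have h := (((ha'.mul (hz.pow 3)).add ((hb'.mul hz).mul (hv.pow 2))).add
    (hc'.mul (hv.pow 3))).add ((hd'.const_mul Complex.I).mul hv)
  convert! h using 1
  simp only [nfH2, Pi.pow_apply, Pi.mul_apply]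
  push_cast
  ring

end OscCoeffs

set_option maxRecDepth 20000 in

/-- The homological equations: the two steps of the normalizing transformation remove all terms of
orders `E⁻¹` and `E⁰` but the resonant one. -/
theorem nf_identity (w : Fin 13 → ℝ) (d : Fin 7 → ℝ) (z ρ : ℂ) (E : ℝ) (hE : E ≠ 0)
    (h9 : w 9 = 1 / 2 * (w 4 + 2 * w 1 ^ 2 + 2 * w 1 * w 2))
    (h10 : w 10 = -(1 / 2) * (w 6 - 2 * w 1 ^ 2 + 10 / 3 * w 1 * w 2))
    (h11 : w 11 = -(1 / 4) * (w 7 - 4 / 3 * w 1 * w 2))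
    (h12 : w 12 = 1 / 2 * (w 8 + 2 * w 3 * w 1 + 2 / 3 * w 3 * w 2))
    (v z' v' : ℂ) (hv : v = star z)
    (hz' : z' = w 0 * (-Complex.I * (E : ℂ)⁻¹ ^ 2 * z
      + (E : ℂ)⁻¹ * (Complex.I * (w 1 * z ^ 2 + 2 * w 1 * z * v + w 2 * v ^ 2) - w 3)
      + (Complex.I * (w 4 * z ^ 3 + w 5 * z ^ 2 * v + w 6 * z * v ^ 2
        + w 7 * v ^ 3) + w 8 * v)) + E * ρ)
    (hv' : v' = w 0 * (Complex.I * (E : ℂ)⁻¹ ^ 2 * v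
      + (E : ℂ)⁻¹ * (-Complex.I * (w 1 * v ^ 2 + 2 * w 1 * v * z + w 2 * z ^ 2) - w 3)
      + (-Complex.I * (w 4 * v ^ 3 + w 5 * v ^ 2 * z + w 6 * v * z ^ 2
        + w 7 * z ^ 3) + w 8 * z)) + E * star ρ) :
    z' + (-(3 / 4) * E * nfH1 (w 1) (w 2) (w 3) z v + E * (nfH1 (d 0) (d 1) (d 2) z v
        + (2 * w 1 * z - 2 * w 1 * v) * z' + (-2 * w 1 * z - 2 / 3 * w 2 * v) * v'))
      + (-(3 / 2) * E ^ 2 * nfH2 (w 9) (w 10) (w 11) (w 12) z v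
        + E ^ 2 * (nfH2 (d 3) (d 4) (d 5) (d 6) z v + (3 * w 9 * z ^ 2 + w 10 * v ^ 2) * z'
        + (2 * w 10 * z * v + 3 * w 11 * v ^ 2 + Complex.I * w 12) * v'))
      - w 0 * (-Complex.I * (E : ℂ)⁻¹ ^ 2 * (z + E * nfH1 (w 1) (w 2) (w 3) z v
          + E ^ 2 * nfH2 (w 9) (w 10) (w 11) (w 12) z v)
        + Complex.I * (w 5 + 6 * w 1 ^ 2 + 2 / 3 * w 2 ^ 2) * (z * v) * z)
      = E * nfErr (w, d, z, ρ, E) := by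
  have hE' : (E : ℂ) ≠ 0 := by exact_mod_cast hE
  have hEi : (E : ℂ) * (E : ℂ)⁻¹ = 1 := mul_inv_cancel₀ hE'
  simp only [nfErr, ← hv]
  generalize star ρ = ρ' at *
  subst hz' hv'
  simp only [nfH1, nfH2, h9, h10, h11, h12]
  push_cast
  field_simp
  ring_nf
  simp only [Complex.I_sq]
  ring_nf

namespace OscCoeffs

variable {N : OscCoeffs} {U : ℝ}

/-- In the variable `ζ` the system is a rotation with frequency depending on `|z|²` only, up to an
error of order `E`. -/
theorem Smooth.exists_normalForm (hN : N.Smooth U) (R₀ Z : ℝ) : ∃ C, 0 < C ∧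
    ∀ ε u, 0 < ε → u ∈ Ioc 0 U → smallE ε u ≤ 1 →
      ∀ (s : Set ℝ) (z : ℝ → ℂ) (z' : ℂ), HasDerivWithinAt z z' s u → ‖z u‖ ≤ Z →
        ‖u * z' - N.field (smallE ε u) u (z u)‖ ≤ R₀ * smallE ε u →
        ∃ ζ', HasDerivWithinAt (N.zeta ε z) ζ' s u ∧
          ‖u * ζ' - Complex.I * ((-N.ω u * (smallE ε u)⁻¹ ^ 2 + N.γ u * ‖z u‖ ^ 2 : ℝ) : ℂ)
            * N.zeta ε z u‖ ≤ C * smallE ε u := by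
  obtain ⟨C0, h0, k0⟩ := hN.a.exists_bound
  obtain ⟨C1, h1, k1⟩ := hN.c.exists_bound
  obtain ⟨C2, h2, k2⟩ := hN.B.exists_bound
  obtain ⟨C3, h3, k3⟩ := hN.b1.exists_bound
  obtain ⟨C4, h4, k4⟩ := hN.b2.exists_bound
  obtain ⟨C5, h5, k5⟩ := hN.b3.exists_bound
  obtain ⟨C6, h6, k6⟩ := hN.b4.exists_bound
  obtain ⟨D0, h0', k0'⟩ := (SmoothIcc.id.mul hN.a.deriv).exists_bound
  obtain ⟨D1, h1', k1'⟩ := (SmoothIcc.id.mul hN.c.deriv).exists_bound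
  obtain ⟨D2, h2', k2'⟩ := (SmoothIcc.id.mul hN.B.deriv).exists_bound
  obtain ⟨D3, h3', k3'⟩ := (SmoothIcc.id.mul hN.b1.deriv).exists_bound
  obtain ⟨D4, h4', k4'⟩ := (SmoothIcc.id.mul hN.b2.deriv).exists_bound
  obtain ⟨D5, h5', k5'⟩ := (SmoothIcc.id.mul hN.b3.deriv).exists_bound
  obtain ⟨D6, h6', k6'⟩ := (SmoothIcc.id.mul hN.b4.deriv).exists_bound
  obtain ⟨F0, g0, l0⟩ := hN.ω.exists_bound
  obtain ⟨F1, g1, l1⟩ := hN.c30.exists_bound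
  obtain ⟨F2, g2, l2⟩ := hN.c21.exists_bound
  obtain ⟨F3, g3, l3⟩ := hN.c12.exists_bound
  obtain ⟨F4, g4, l4⟩ := hN.c03.exists_bound
  obtain ⟨F5, g5, l5⟩ := hN.l.exists_bound
  obtain ⟨G, hG, kG⟩ := hN.γ.exists_bound
  obtain ⟨Cζ, hCζ, kζ⟩ := hN.exists_zeta_sub_bound Z
  set R := (C0 + C1 + C2 + C3 + C4 + C5 + C6) + (D0 + D1 + D2 + D3 + D4 + D5 + D6)
    + (F0 + F1 + F2 + F3 + F4 + F5) + |Z| + |R₀| + 1 with hR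
  obtain ⟨C, hC, hb⟩ := exists_nfErr_bound R
  refine ⟨C + G * Z ^ 2 * Cζ, by positivity, fun ε u hε hu hE s z z' hz hzZ hz' => ?_⟩
  have hu' : u ∈ Icc 0 U := ⟨hu.1.le, hu.2⟩
  have hu0 : (u : ℂ) ≠ 0 := by exact_mod_cast hu.1.ne'
  have hEp := smallE_pos hε hu.1
  have hv : HasDerivWithinAt (fun u => star (z u)) (star z') s u := hz.star
  have hEd := (hasDerivAt_smallE (ε := ε) hu.1).ofReal_comp.hasDerivWithinAt (s := s)
  have hd1 := nfH1_hasDerivWithinAt (hN.a.hasDerivAt hu') (hN.c.hasDerivAt hu')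
    (hN.B.hasDerivAt hu') hz hv
  have hd2 := nfH2_hasDerivWithinAt (hN.b1.hasDerivAt hu') (hN.b2.hasDerivAt hu')
    (hN.b3.hasDerivAt hu') (hN.b4.hasDerivAt hu') hz hv
  have hζ := (hz.add (hEd.mul hd1)).add ((hEd.pow 2).mul hd2)
  refine ⟨_, hζ, ?_⟩
  set E := smallE ε u with hEdef
  -- the error of the truncated vector field is written as `E ρ` with `ρ` bounded
  set ρ : ℂ := (E : ℂ)⁻¹ * (u * z' - N.field E u (z u)) with hρ
  have hE0 : (E : ℂ) ≠ 0 := by exact_mod_cast hEp.ne'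
  have hρb : ‖ρ‖ ≤ |R₀| := by
    rw [hρ, norm_mul, norm_inv, Complex.norm_real, Real.norm_eq_abs, abs_of_pos hEp,
      inv_mul_le_iff₀ hEp, mul_comm E]
    exact hz'.trans (mul_le_mul_of_nonneg_right (le_abs_self _) hEp.le)
  have hzρ : u * z' = N.field E u (z u) + E * ρ := by
    rw [hρ, mul_inv_cancel_left₀ hE0]; ring
  have hvρ : u * star z' = star (N.field E u (z u)) + E * star ρ := by
    have := congrArg star hzρ
    simpa [star_mul'] using this
  have key := nf_identity
    ![N.ω u, N.a u, N.c u, N.B u, N.c30 u, N.c21 u, N.c12 u, N.c03 u, N.l u,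
      N.b1 u, N.b2 u, N.b3 u, N.b4 u]
    ![u * deriv N.a u, u * deriv N.c u, u * deriv N.B u, u * deriv N.b1 u, u * deriv N.b2 u,
      u * deriv N.b3 u, u * deriv N.b4 u] (z u) ρ E hEp.ne' rfl rfl rfl rfl (star (z u))
    (u * z') (u * star z') rfl hzρ
    (by
      rw [hvρ, field]
      simp [star_mul'])
  have hbd := hb (![N.ω u, N.a u, N.c u, N.B u, N.c30 u, N.c21 u, N.c12 u, N.c03 u, N.l u,
      N.b1 u, N.b2 u, N.b3 u, N.b4 u], ![u * deriv N.a u, u * deriv N.c u, u * deriv N.B u,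
      u * deriv N.b1 u, u * deriv N.b2 u, u * deriv N.b3 u, u * deriv N.b4 u], z u, ρ, E) (by
    have := le_abs_self Z
    have := abs_nonneg Z
    have := abs_nonneg R₀
    have := k0 u hu'; have := k1 u hu'; have := k2 u hu'; have := k3 u hu'
    have := k4 u hu'; have := k5 u hu'; have := k6 u hu'
    have := k0' u hu'; have := k1' u hu'; have := k2' u hu'; have := k3' u hu'
    have := k4' u hu'; have := k5' u hu'; have := k6' u hu'
    have := l0 u hu'; have := l1 u hu'; have := l2 u hu'; have := l3 u hu'
    have := l4 u hu'; have := l5 u hu'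
    have hR0 : 0 ≤ R := by positivity
    simp only [Prod.norm_def, sup_le_iff]
    refine ⟨abs_vec_le _ hR0 ?_, abs_vec_le _ hR0 ?_, ?_, ?_, ?_⟩
    · simp only [Fin.forall_fin_succ, Fin.isEmpty.forall_iff, Matrix.cons_val_zero,
        Matrix.cons_val_succ, and_true]
      refine ⟨?_, ?_, ?_, ?_, ?_, ?_, ?_, ?_, ?_, ?_, ?_, ?_, ?_⟩ <;> linarith
    · simp only [Fin.forall_fin_succ, Fin.isEmpty.forall_iff, Matrix.cons_val_zero,
        Matrix.cons_val_succ, and_true]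
      refine ⟨?_, ?_, ?_, ?_, ?_, ?_, ?_⟩ <;> linarith
    · linarith
    · linarith
    · rw [Real.norm_eq_abs, abs_of_pos hEp]; linarith)
  have hζd := kζ ε u hε hu hE z hzZ
  rw [← hEdef] at hζd
  have hzz : z u * star (z u) = ((‖z u‖ ^ 2 : ℝ) : ℂ) := by
    rw [Complex.star_def, Complex.mul_conj, Complex.normSq_eq_norm_sq]
  -- in the cubic term, `z` may be replaced by `ζ` up to an error of order `E`
  have split : ∀ A : ℂ, A = E * nfErr (![N.ω u, N.a u, N.c u, N.B u, N.c30 u, N.c21 u, N.c12 u,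
      N.c03 u, N.l u, N.b1 u, N.b2 u, N.b3 u, N.b4 u], ![u * deriv N.a u, u * deriv N.c u,
      u * deriv N.B u, u * deriv N.b1 u, u * deriv N.b2 u, u * deriv N.b3 u, u * deriv N.b4 u],
      z u, ρ, E) - Complex.I * ((N.γ u * ‖z u‖ ^ 2 : ℝ) : ℂ) * (N.zeta ε z u - z u) →
      ‖A‖ ≤ (C + G * Z ^ 2 * Cζ) * E := by
    rintro A rfl
    refine (norm_sub_le _ _).trans ?_
    rw [norm_mul, norm_mul, norm_mul, Complex.norm_I, one_mul, Complex.norm_real,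
      Complex.norm_real, Real.norm_eq_abs, Real.norm_eq_abs, abs_of_pos hEp, abs_mul,
      abs_of_nonneg (sq_nonneg ‖z u‖)]
    have h1 : |N.γ u| * ‖z u‖ ^ 2 ≤ G * Z ^ 2 :=
      mul_le_mul (kG u hu') (pow_le_pow_left₀ (norm_nonneg _) hzZ 2) (by positivity) hG.le
    have h2 := mul_le_mul h1 hζd (norm_nonneg _) (by positivity)
    have h3 := mul_le_mul_of_nonneg_left hbd hEp.le
    linarith
  refine split _ ?_
  rw [← key]
  simp only [zeta, ← hEdef, hzz, Matrix.cons_val, nfH1, nfH2, OscCoeffs.γ, Pi.pow_apply]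
  push_cast
  field_simp
  ring

end OscCoeffs

theorem norm_sub_le_sub_of_norm_deriv_le {E : Type*} [NormedAddCommGroup E] [NormedSpace ℝ E]
    {f f' : ℝ → E} {B B' : ℝ → ℝ} {a b : ℝ}
    (hf : ∀ x ∈ Icc a b, HasDerivWithinAt f (f' x) (Icc a b) x)
    (hB : ∀ x ∈ Icc a b, HasDerivAt B (B' x) x) (h : ∀ x ∈ Icc a b, ‖f' x‖ ≤ B' x)
    {x : ℝ} (hx : x ∈ Icc a b) : ‖f x - f a‖ ≤ B x - B a := by
  refine image_norm_le_of_norm_deriv_right_le_deriv_boundary' (f := fun x => f x - f a)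
    (f' := f') (B := fun x => B x - B a) (B' := B')
    (fun y hy => (hf y hy).continuousWithinAt.sub continuousWithinAt_const) (fun y hy => ?_)
    (by simp) (fun y hy => (hB y hy).continuousAt.continuousWithinAt.sub continuousWithinAt_const)
    (fun y hy => ((hB y ⟨hy.1, hy.2.le⟩).sub_const _).hasDerivWithinAt)
    (fun y hy => h y ⟨hy.1, hy.2.le⟩) hx
  exact ((hf y ⟨hy.1, hy.2.le⟩).mono_of_mem_nhdsWithin
    (Icc_mem_nhdsGE_of_mem hy)).sub_const _

namespace OscCoeffs

variable {N : OscCoeffs} {U : ℝ}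

/-- Along a solution that stays bounded, `|z|²` is an adiabatic invariant, and `z` rotates by the
angle obtained from integrating the frequency at the initial value of `|z|²`. -/
theorem Smooth.exists_rotation_estimate (hN : N.Smooth U) (R₀ Z : ℝ) : ∃ C, 0 < C ∧
    ∀ ε u₀ u₁, 0 < ε → 0 < u₀ → u₀ ≤ u₁ → u₁ ≤ U → smallE ε u₀ ≤ 1 →
      ∀ (z z' : ℝ → ℂ) (ψ : ℝ → ℝ),
        (∀ u ∈ Icc u₀ u₁, HasDerivWithinAt z (z' u) (Icc u₀ u₁) u) →
        (∀ u ∈ Icc u₀ u₁, ‖z u‖ ≤ Z) →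
        (∀ u ∈ Icc u₀ u₁, ‖u * z' u - N.field (smallE ε u) u (z u)‖ ≤ R₀ * smallE ε u) →
        ψ u₀ = 0 →
        (∀ u ∈ Icc u₀ u₁, HasDerivWithinAt ψ
          ((N.ω u * (smallE ε u)⁻¹ ^ 2 - N.γ u * ‖z u₀‖ ^ 2) / u) (Icc u₀ u₁) u) →
        ∀ u ∈ Icc u₀ u₁, ‖z u * Complex.exp (Complex.I * ψ u) - z u₀‖
          ≤ C * (smallE ε u₀ * (1 + Real.log (U / u₀))) := by
  obtain ⟨C, hC, hnf⟩ := hN.exists_normalForm R₀ Z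
  obtain ⟨Cζ, hCζ, kζ⟩ := hN.exists_zeta_sub_bound Z
  obtain ⟨G, hG, kG⟩ := hN.γ.exists_bound
  set Y := |Z| + Cζ with hY
  have hY0 : 0 < Y := by positivity
  set C2 := 4 / 3 * (2 * Y * C) + 2 * (Cζ * (|Z| + Y)) with hC2
  set C3 := G * C2 * Y + C with hC3
  refine ⟨C3 + 2 * Cζ, by positivity, fun ε u₀ u₁ hε hu₀ hu₀₁ hu₁ hE₀ z z' ψ hz hzZ hzf hψ₀ hψ
    => ?_⟩
  have hpos : ∀ u ∈ Icc u₀ u₁, 0 < u := fun u hu => hu₀.trans_le hu.1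
  have hU : ∀ u ∈ Icc u₀ u₁, u ∈ Ioc 0 U := fun u hu => ⟨hpos u hu, hu.2.trans hu₁⟩
  have hEle : ∀ u ∈ Icc u₀ u₁, smallE ε u ≤ smallE ε u₀ := fun u hu => smallE_anti hu₀ hu.1
  have hEp : ∀ u ∈ Icc u₀ u₁, 0 < smallE ε u := fun u hu => smallE_pos hε (hpos u hu)
  have hmem₀ : u₀ ∈ Icc u₀ u₁ := ⟨le_rfl, hu₀₁⟩
  have hE0p := hEp u₀ hmem₀
  have hex := fun u (hu : u ∈ Icc u₀ u₁) => hnf ε u hε (hU u hu) ((hEle u hu).trans hE₀)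
    (Icc u₀ u₁) z (z' u) (hz u hu) (hzZ u hu) (hzf u hu)
  choose! ζ' hζ' hζe using hex
  set ζ := N.zeta ε z with hζdef
  have hζz : ∀ u ∈ Icc u₀ u₁, ‖ζ u - z u‖ ≤ Cζ * smallE ε u := fun u hu =>
    kζ ε u hε (hU u hu) ((hEle u hu).trans hE₀) z (hzZ u hu)
  have hzZ' : ∀ u ∈ Icc u₀ u₁, ‖z u‖ ≤ |Z| := fun u hu => (hzZ u hu).trans (le_abs_self Z)
  have hζY : ∀ u ∈ Icc u₀ u₁, ‖ζ u‖ ≤ Y := fun u hu => by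
    have h1 := norm_add_le (ζ u - z u) (z u)
    rw [sub_add_cancel] at h1
    have h2 := hζz u hu
    have h3 := hzZ' u hu
    have h4 : Cζ * smallE ε u ≤ Cζ * 1 :=
      mul_le_mul_of_nonneg_left ((hEle u hu).trans hE₀) hCζ.le
    linarith
  have hsq : ∀ u ∈ Icc u₀ u₁, |‖z u‖ ^ 2 - ‖ζ u‖ ^ 2| ≤ Cζ * (|Z| + Y) * smallE ε u₀ :=
    fun u hu => by
      have h1 : |‖z u‖ - ‖ζ u‖| ≤ Cζ * smallE ε u₀ := by
        rw [abs_sub_comm]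
        exact (abs_norm_sub_norm_le _ _).trans ((hζz u hu).trans
          (mul_le_mul_of_nonneg_left (hEle u hu) hCζ.le))
      rw [sq_sub_sq, abs_mul, abs_of_nonneg (by positivity : 0 ≤ ‖z u‖ + ‖ζ u‖)]
      calc _ ≤ (|Z| + Y) * (Cζ * smallE ε u₀) :=
            mul_le_mul (add_le_add (hzZ' u hu) (hζY u hu)) h1 (abs_nonneg _) (by positivity)
        _ = _ := by ring
  -- adiabatic invariance of `|ζ|²`
  have hinv : ∀ u ∈ Icc u₀ u₁, |‖ζ u‖ ^ 2 - ‖ζ u₀‖ ^ 2| ≤ 4 / 3 * (2 * Y * C) * smallE ε u₀ := by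
    intro u hu
    have hd : ∀ x ∈ Icc u₀ u₁, HasDerivAt (fun x => -(4 / 3) * (2 * Y * C) * smallE ε x)
        (2 * Y * C * smallE ε x / x) x := fun x hx => by
      refine ((hasDerivAt_smallE (ε := ε) (hpos x hx)).const_mul _).congr_deriv ?_
      ring
    have := norm_sub_le_sub_of_norm_deriv_le (f := fun x => ‖ζ x‖ ^ 2)
      (fun x hx => (hζ' x hx).norm_sq) hd (fun x hx => ?_) hu
    · rw [Real.norm_eq_abs] at this
      have h2 : 0 ≤ 4 / 3 * (2 * Y * C) * smallE ε u :=
        mul_nonneg (by positivity) (hEp u hu).le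
      linarith
    · have hx0 := hpos x hx
      set μ : ℝ := -N.ω x * (smallE ε x)⁻¹ ^ 2 + N.γ x * ‖z x‖ ^ 2 with hμ
      have e1 : inner ℝ (ζ x) (ζ' x) = x⁻¹
          * inner ℝ (ζ x) (x * ζ' x - Complex.I * (μ : ℂ) * ζ x) := by
        have hx0' : x ≠ 0 := hx0.ne'
        simp only [Complex.inner, Complex.mul_re, Complex.mul_im, Complex.sub_re, Complex.sub_im,
          Complex.ofReal_re, Complex.ofReal_im, Complex.I_re, Complex.I_im, Complex.conj_re,
          Complex.conj_im]
        field_simp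
        ring
      rw [e1, Real.norm_eq_abs, abs_mul, abs_mul, abs_of_pos (inv_pos.2 hx0), abs_of_pos two_pos]
      have h3 := (abs_real_inner_le_norm (ζ x) (x * ζ' x - Complex.I * (μ : ℂ) * ζ x)).trans
        (mul_le_mul (hζY x hx) (hζe x hx) (norm_nonneg _) hY0.le)
      calc _ ≤ 2 * (x⁻¹ * (Y * (C * smallE ε x))) := by gcongr
        _ = _ := by field_simp
  have hz2 : ∀ u ∈ Icc u₀ u₁, |‖z u‖ ^ 2 - ‖z u₀‖ ^ 2| ≤ C2 * smallE ε u₀ := fun u hu => by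
    have h1 := abs_le.1 (hsq u hu)
    have h2 := abs_le.1 (hsq u₀ hmem₀)
    have h3 := abs_le.1 (hinv u hu)
    rw [hC2, abs_le]
    constructor <;> linarith [h1.1, h1.2, h2.1, h2.2, h3.1, h3.2]
  -- the rotation is undone by the factor `exp (i ψ)`
  have hexp : ∀ u, ‖Complex.exp (Complex.I * ψ u)‖ = 1 := fun u => by
    rw [mul_comm]; exact Complex.norm_exp_ofReal_mul_I _
  intro u hu
  have hW : ∀ x ∈ Icc u₀ u₁, HasDerivWithinAt (fun x => ζ x * Complex.exp (Complex.I * ψ x))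
      (ζ' x * Complex.exp (Complex.I * ψ x) + ζ x * (Complex.exp (Complex.I * ψ x) *
        (Complex.I * (((N.ω x * (smallE ε x)⁻¹ ^ 2 - N.γ x * ‖z u₀‖ ^ 2) / x : ℝ) : ℂ))))
      (Icc u₀ u₁) x := fun x hx =>
    (hζ' x hx).mul (((hψ x hx).ofReal_comp.const_mul Complex.I).cexp)
  have hd : ∀ x ∈ Icc u₀ u₁, HasDerivAt (fun x => C3 * smallE ε u₀ * Real.log x)
      (C3 * smallE ε u₀ * x⁻¹) x := fun x hx =>
    (Real.hasDerivAt_log (hpos x hx).ne').const_mul _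
  have hest := norm_sub_le_sub_of_norm_deriv_le hW hd (fun x hx => ?_) hu
  · simp only [hψ₀, Complex.ofReal_zero, mul_zero, Complex.exp_zero, mul_one] at hest
    have hlog : Real.log u - Real.log u₀ ≤ Real.log (U / u₀) := by
      rw [Real.log_div ((hU u hu).1.trans_le (hU u hu).2).ne' hu₀.ne']
      have := Real.log_le_log (hpos u hu) (hU u hu).2
      linarith
    have e : z u * Complex.exp (Complex.I * ψ u) - z u₀
        = (ζ u * Complex.exp (Complex.I * ψ u) - ζ u₀)
          - (ζ u - z u) * Complex.exp (Complex.I * ψ u) + (ζ u₀ - z u₀) := by ring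
    rw [e]
    refine (norm_add_le _ _).trans ?_
    have h1 := norm_sub_le (ζ u * Complex.exp (Complex.I * ψ u) - ζ u₀)
      ((ζ u - z u) * Complex.exp (Complex.I * ψ u))
    rw [norm_mul, hexp, mul_one] at h1
    have h2 := (hζz u hu).trans (mul_le_mul_of_nonneg_left (hEle u hu) hCζ.le)
    have h3 := hζz u₀ hmem₀
    have h4 : C3 * smallE ε u₀ * (Real.log u - Real.log u₀)
        ≤ C3 * smallE ε u₀ * Real.log (U / u₀) :=
      mul_le_mul_of_nonneg_left hlog (by positivity)
    have h5 : 0 ≤ Real.log (U / u₀) := Real.log_nonneg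
      ((one_le_div hu₀).2 (hu₀₁.trans hu₁))
    have h6 : 0 ≤ 2 * Cζ * smallE ε u₀ * Real.log (U / u₀) := by positivity
    have h7 : 0 ≤ C3 * smallE ε u₀ := by positivity
    linarith
  · have hx0 := hpos x hx
    have hx0' : (x : ℂ) ≠ 0 := by exact_mod_cast hx0.ne'
    set μ : ℝ := -N.ω x * (smallE ε x)⁻¹ ^ 2 + N.γ x * ‖z x‖ ^ 2 with hμ
    have e1 : ζ' x * Complex.exp (Complex.I * ψ x) + ζ x * (Complex.exp (Complex.I * ψ x) *
        (Complex.I * (((N.ω x * (smallE ε x)⁻¹ ^ 2 - N.γ x * ‖z u₀‖ ^ 2) / x : ℝ) : ℂ)))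
        = (x : ℂ)⁻¹ * ((x * ζ' x - Complex.I * (μ : ℂ) * ζ x)
          + Complex.I * ((N.γ x * (‖z x‖ ^ 2 - ‖z u₀‖ ^ 2) : ℝ) : ℂ) * ζ x)
            * Complex.exp (Complex.I * ψ x) := by
      rw [hμ]
      push_cast
      field_simp
      ring
    rw [e1, norm_mul, hexp, mul_one, norm_mul, norm_inv, Complex.norm_real, Real.norm_eq_abs,
      abs_of_pos hx0, mul_comm (C3 * _)]
    refine mul_le_mul_of_nonneg_left ((norm_add_le _ _).trans ?_) (inv_pos.2 hx0).le
    rw [norm_mul, norm_mul, Complex.norm_I, one_mul, Complex.norm_real, Real.norm_eq_abs, abs_mul]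
    have h1 := (hζe x hx).trans (mul_le_mul_of_nonneg_left (hEle x hx) hC.le)
    have h2 : |N.γ x| * |‖z x‖ ^ 2 - ‖z u₀‖ ^ 2| * ‖ζ x‖ ≤ G * (C2 * smallE ε u₀) * Y :=
      mul_le_mul (mul_le_mul (kG x ⟨hx0.le, (hU x hx).2⟩) (hz2 x hx) (abs_nonneg _) hG.le)
        (hζY x hx) (norm_nonneg _) (by positivity)
    rw [hC3]
    linarith

end OscCoeffs

/-! ### Global existence and uniqueness for planar systems -/

/-- The coordinatewise retraction of the plane onto a square. -/
def clampSq (R : ℝ) (q : ℝ × ℝ) : ℝ × ℝ := (max (-R) (min R q.1), max (-R) (min R q.2))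

theorem clampSq_lipschitz (R : ℝ) : LipschitzWith 1 (clampSq R) := by
  have h1 : LipschitzWith 1 (fun x : ℝ => max (-R) (min R x)) :=
    (LipschitzWith.id.const_min R).const_max (-R)
  have h2 := (h1.comp LipschitzWith.prod_fst).prodMk (h1.comp LipschitzWith.prod_snd)
  rw [one_mul, max_self] at h2
  exact h2

theorem clampSq_mem {R : ℝ} (hR : 0 ≤ R) (q : ℝ × ℝ) : clampSq R q ∈ Metric.closedBall 0 R := by
  have h : ∀ x : ℝ, |max (-R) (min R x)| ≤ R := fun x =>
    abs_le.2 ⟨le_max_left _ _, max_le (by linarith) (min_le_left _ _)⟩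
  simp only [Metric.mem_closedBall, dist_zero_right, Prod.norm_def, Real.norm_eq_abs, sup_le_iff]
  exact ⟨h _, h _⟩

theorem clampSq_of_mem {R : ℝ} {q : ℝ × ℝ} (hq : ‖q‖ ≤ R) : clampSq R q = q := by
  simp only [Prod.norm_def, Real.norm_eq_abs, sup_le_iff, abs_le] at hq
  obtain ⟨⟨h1, h2⟩, h3, h4⟩ := hq
  simp [clampSq, h1, h2, h3, h4]

theorem exists_lipschitzOnWith_slice {F : ℝ × ℝ × ℝ → ℝ × ℝ} (hF : ContDiff ℝ 1 F) (a b R : ℝ) :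
    ∃ K, ∀ t ∈ Icc a b, LipschitzOnWith K (fun q => F (t, q)) (Metric.closedBall 0 R) := by
  obtain ⟨K, hK⟩ := hF.contDiffOn.exists_lipschitzOnWith (s := Icc a b ×ˢ Metric.closedBall 0 R)
    one_ne_zero
    ((convex_Icc a b).prod (convex_closedBall _ _)) (isCompact_Icc.prod (isCompact_closedBall _ _))
  refine ⟨K, fun t ht x hx y hy => ?_⟩
  refine (hK ⟨ht, hx⟩ ⟨ht, hy⟩).trans (le_of_eq ?_)
  simp [Prod.edist_eq]

/-- Solutions of a `C¹` system with the same initial value agree. -/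
theorem solution_unique {F : ℝ × ℝ × ℝ → ℝ × ℝ} (hF : ContDiff ℝ 1 F) {a b : ℝ}
    {X Y : ℝ → ℝ × ℝ} (hX : ∀ t ∈ Icc a b, HasDerivWithinAt X (F (t, X t)) (Icc a b) t)
    (hY : ∀ t ∈ Icc a b, HasDerivWithinAt Y (F (t, Y t)) (Icc a b) t) (h0 : X a = Y a) :
    EqOn X Y (Icc a b) := by
  have hXc : ContinuousOn X (Icc a b) := fun t ht => (hX t ht).continuousWithinAt
  have hYc : ContinuousOn Y (Icc a b) := fun t ht => (hY t ht).continuousWithinAt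
  obtain ⟨R1, hR1⟩ := isCompact_Icc.exists_bound_of_continuousOn hXc
  obtain ⟨R2, hR2⟩ := isCompact_Icc.exists_bound_of_continuousOn hYc
  obtain ⟨K, hK⟩ := exists_lipschitzOnWith_slice hF a b (max R1 R2)
  refine ODE_solution_unique_of_mem_Icc_right (v := fun t q => F (t, q)) (K := K)
    (s := fun _ => Metric.closedBall 0 (max R1 R2)) (fun t ht => hK t ⟨ht.1, ht.2.le⟩) hXc
    (fun t ht => (hX t ⟨ht.1, ht.2.le⟩).mono_of_mem_nhdsWithin (Icc_mem_nhdsGE_of_mem ht))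
    (fun t ht => ?_) hYc
    (fun t ht => (hY t ⟨ht.1, ht.2.le⟩).mono_of_mem_nhdsWithin (Icc_mem_nhdsGE_of_mem ht))
    (fun t ht => ?_) h0
  · simpa using Or.inl (hR1 t ⟨ht.1, ht.2.le⟩)
  · simpa using Or.inr (hR2 t ⟨ht.1, ht.2.le⟩)

/-- A solution exists on all of `[a, b]` as soon as a continuous quantity `ρ`, which controls the
size of solutions, satisfies an a priori estimate: it is smaller than `Z` wherever the solution is
defined and has not exceeded `Z` before. -/
theorem exists_solution_of_apriori {F : ℝ × ℝ × ℝ → ℝ × ℝ} (hF : ContDiff ℝ 1 F) {a b : ℝ}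
    (hab : a ≤ b) (x₀ : ℝ × ℝ) {ρ : ℝ → ℝ × ℝ → ℝ} {Z R : ℝ}
    (hρ : ContinuousOn (fun p : ℝ × ℝ × ℝ => ρ p.1 p.2) (Icc a b ×ˢ univ))
    (hρR : ∀ t ∈ Icc a b, ∀ q, ρ t q ≤ Z → ‖q‖ ≤ R) (h0 : ρ a x₀ ≤ Z)
    (hap : ∀ X : ℝ → ℝ × ℝ, X a = x₀ → ∀ t₁ ∈ Icc a b,
      (∀ t ∈ Icc a t₁, HasDerivWithinAt X (F (t, X t)) (Icc a t₁) t) →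
      (∀ t ∈ Icc a t₁, ρ t (X t) ≤ Z) → ρ t₁ (X t₁) < Z) :
    ∃ X : ℝ → ℝ × ℝ, X a = x₀ ∧ (∀ t ∈ Icc a b, HasDerivWithinAt X (F (t, X t)) (Icc a b) t) ∧
      ∀ t ∈ Icc a b, ρ t (X t) ≤ Z := by
  have hR : 0 ≤ R := (norm_nonneg _).trans (hρR a ⟨le_rfl, hab⟩ x₀ h0)
  obtain ⟨K, hK⟩ := exists_lipschitzOnWith_slice hF a b R
  have hcomp : IsCompact (Icc a b ×ˢ Metric.closedBall (0 : ℝ × ℝ) R) :=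
    isCompact_Icc.prod (isCompact_closedBall _ _)
  obtain ⟨L, hL⟩ := hcomp.exists_bound_of_continuousOn hF.continuous.continuousOn
  have hpl : IsPicardLindelof (fun t q => F (t, clampSq R q)) (⟨a, le_rfl, hab⟩ : Icc a b) x₀
      (max L 0 * (b - a)).toNNReal 0 L.toNNReal K := by
    refine ⟨fun t ht => ?_, fun x _ => ?_, fun t ht x _ => ?_, ?_⟩
    · have h := (hK t ht).comp ((clampSq_lipschitz R).lipschitzOnWith (s := univ))
        (fun x _ => clampSq_mem hR x)
      rw [mul_one] at h
      exact h.mono (subset_univ _)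
    · exact (hF.continuous.comp (by fun_prop)).continuousOn
    · exact (hL (t, clampSq R x) ⟨ht, clampSq_mem hR x⟩).trans (Real.le_coe_toNNReal L)
    · simp only [sub_self]
      rw [max_eq_left (by linarith), Real.coe_toNNReal', Real.coe_toNNReal _ (mul_nonneg
        (le_max_right _ _) (by linarith))]
      simp
  obtain ⟨X, hX0, hX⟩ := hpl.exists_eq_forall_mem_Icc_hasDerivWithinAt₀
  have hXc : ContinuousOn X (Icc a b) := fun t ht => (hX t ht).continuousWithinAt
  have hfc : ContinuousOn (fun t => ρ t (X t)) (Icc a b) :=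
    hρ.comp (continuousOn_id.prodMk hXc) (fun t ht => ⟨ht, mem_univ _⟩)
  -- as long as `ρ ≤ Z`, the solution of the clamped system solves the original one
  have hsol : ∀ t₁ ∈ Icc a b, (∀ t ∈ Icc a t₁, ρ t (X t) ≤ Z) →
      ∀ t ∈ Icc a t₁, HasDerivWithinAt X (F (t, X t)) (Icc a t₁) t := fun t₁ ht₁ h t ht => by
    have htb : t ∈ Icc a b := ⟨ht.1, ht.2.trans ht₁.2⟩
    have h1 := (hX t htb).mono (Icc_subset_Icc_right ht₁.2)
    rwa [clampSq_of_mem (hρR t htb _ (h t ht))] at h1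
  have hall : ∀ t ∈ Icc a b, ρ t (X t) ≤ Z := by
    by_contra! hcon
    obtain ⟨s, hs, hsZ⟩ := hcon
    -- the first time at which `ρ` reaches `Z`
    have hcl : IsCompact (Icc a b ∩ (fun t => ρ t (X t)) ⁻¹' Ici Z) :=
      isCompact_Icc.of_isClosed_subset (hfc.preimage_isClosed_of_isClosed isClosed_Icc isClosed_Ici)
        inter_subset_left
    obtain ⟨t₁, ⟨ht₁, ht₁Z⟩, hmin⟩ := hcl.exists_isLeast ⟨s, hs, hsZ.le⟩
    have hlt : ∀ t ∈ Ico a t₁, ρ t (X t) < Z := fun t ht => by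
      by_contra! h
      exact absurd (hmin ⟨⟨ht.1, ht.2.le.trans ht₁.2⟩, h⟩) (not_le.2 ht.2)
    have hle : ∀ t ∈ Icc a t₁, ρ t (X t) ≤ Z := by
      rcases ht₁.1.eq_or_lt with h | h
      · rintro t ⟨h1, h2⟩
        obtain rfl : t = a := le_antisymm (h ▸ h2) h1
        rw [hX0]; exact h0
      · intro t ht
        rcases ht.2.eq_or_lt with h2 | h2
        · subst h2
          have hcw : Tendsto (fun t => ρ t (X t)) (𝓝[Ico a t] t) (𝓝 (ρ t (X t))) :=
            ((hfc t ht₁).mono (fun x hx => ⟨hx.1, hx.2.le.trans ht₁.2⟩))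
          have : (𝓝[Ico a t] t).NeBot := by
            rw [← mem_closure_iff_nhdsWithin_neBot, closure_Ico h.ne]
            exact ⟨h.le, le_rfl⟩
          exact le_of_tendsto hcw (eventually_mem_nhdsWithin.mono fun x hx => (hlt x hx).le)
        · exact (hlt t ⟨ht.1, h2⟩).le
    exact absurd (hap X hX0 t₁ ht₁ (hsol t₁ ht₁ hle) hle) (not_lt.2 ht₁Z)
  exact ⟨X, hX0, hsol b ⟨hab, le_rfl⟩ hall, hall⟩

/-! ### Taylor expansions with parameters -/

section Taylor

variable {Q : Type*}

/-- The partial derivative with respect to the first, real, variable. -/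
def partialFst (G : ℝ × Q → ℝ) : ℝ × Q → ℝ := fun q => deriv (fun x => G (x, q.2)) q.1

/-- The Taylor coefficients at `0` with respect to the first variable, as functions of the
remaining ones. -/
def taylorCoeffFst (G : ℝ × Q → ℝ) (j : ℕ) (θ : Q) : ℝ := (partialFst^[j] G) (0, θ) / j.factorial

theorem taylorCoeffFst_zero (G : ℝ × Q → ℝ) (θ : Q) : taylorCoeffFst G 0 θ = G (0, θ) := by
  simp [taylorCoeffFst]

theorem taylorCoeffFst_one (G : ℝ × Q → ℝ) (θ : Q) :
    taylorCoeffFst G 1 θ = deriv (fun x => G (x, θ)) 0 := by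
  simp [taylorCoeffFst, partialFst]

theorem taylorCoeffFst_eq_iteratedDeriv (G : ℝ × Q → ℝ) (j : ℕ) (θ : Q) :
    taylorCoeffFst G j θ = iteratedDeriv j (fun x => G (x, θ)) 0 / j.factorial := by
  have h : ∀ x, (partialFst^[j] G) (x, θ) = iteratedDeriv j (fun x => G (x, θ)) x := by
    induction j with
    | zero => intro x; simp
    | succ j ih =>
      intro x
      rw [Function.iterate_succ_apply', iteratedDeriv_succ]
      simp only [partialFst]
      congr 1
      funext y
      exact ih y
  rw [taylorCoeffFst, h]

variable [NormedAddCommGroup Q] [NormedSpace ℝ Q]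

theorem contDiff_partialFst {G : ℝ × Q → ℝ} (hG : ContDiff ℝ ((⊤ : ℕ∞) : WithTop ℕ∞) G) :
    ContDiff ℝ ((⊤ : ℕ∞) : WithTop ℕ∞) (partialFst G) := by
  have h : partialFst G = fun q => fderiv ℝ G q (1, 0) := by
    funext q
    have h1 : HasFDerivAt G (fderiv ℝ G (q.1, q.2)) (q.1, q.2) :=
      (hG.differentiable (by simp)).differentiableAt.hasFDerivAt
    have h2 : HasDerivAt (fun x : ℝ => (x, q.2)) ((1 : ℝ), (0 : Q)) q.1 :=
      (hasDerivAt_id q.1).prodMk (hasDerivAt_const q.1 q.2)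
    exact (h1.comp_hasDerivAt q.1 h2).deriv
  rw [h]
  exact (hG.fderiv_right (m := ((⊤ : ℕ∞) : WithTop ℕ∞)) (by simp)).clm_apply contDiff_const

theorem hasDerivAt_partialFst {G : ℝ × Q → ℝ} (hG : ContDiff ℝ ((⊤ : ℕ∞) : WithTop ℕ∞) G)
    (x : ℝ) (θ : Q) : HasDerivAt (fun x => G (x, θ)) (partialFst G (x, θ)) x := by
  have h : DifferentiableAt ℝ (fun x => G (x, θ)) x :=
    ((hG.comp (contDiff_id.prodMk contDiff_const)).differentiable (by simp)).differentiableAt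
  exact h.hasDerivAt

theorem contDiff_iterate_partialFst {G : ℝ × Q → ℝ}
    (hG : ContDiff ℝ ((⊤ : ℕ∞) : WithTop ℕ∞) G) (j : ℕ) :
    ContDiff ℝ ((⊤ : ℕ∞) : WithTop ℕ∞) (partialFst^[j] G) := by
  induction j generalizing G with
  | zero => exact hG
  | succ j ih => exact ih (contDiff_partialFst hG)

theorem contDiff_taylorCoeffFst {G : ℝ × Q → ℝ} (hG : ContDiff ℝ ((⊤ : ℕ∞) : WithTop ℕ∞) G)
    (j : ℕ) : ContDiff ℝ ((⊤ : ℕ∞) : WithTop ℕ∞) (taylorCoeffFst G j) :=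
  ((contDiff_iterate_partialFst hG j).comp (contDiff_const.prodMk contDiff_id)).div_const _

theorem exists_taylor_bound {G : ℝ × Q → ℝ} (hG : ContDiff ℝ ((⊤ : ℕ∞) : WithTop ℕ∞) G)
    {S : Set Q} (hS : IsCompact S) (n : ℕ) : ∃ C, 0 < C ∧ ∀ θ ∈ S, ∀ x, |x| ≤ 1 →
      |G (x, θ) - ∑ j ∈ Finset.range n, taylorCoeffFst G j θ * x ^ j| ≤ C * |x| ^ n := by
  induction n generalizing G with
  | zero =>
    obtain ⟨C, hC⟩ := ((isCompact_Icc (a := (-1 : ℝ)) (b := 1)).prod hS).exists_bound_of_continuousOn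
      hG.continuous.continuousOn
    refine ⟨max C 1, by positivity, fun θ hθ x hx => ?_⟩
    have := hC (x, θ) ⟨abs_le.1 hx, hθ⟩
    simpa using Or.inl this
  | succ n ih =>
    obtain ⟨C, hC0, hC⟩ := ih (contDiff_partialFst hG)
    refine ⟨C, hC0, fun θ hθ x hx => ?_⟩
    have hd : ∀ y : ℝ, HasDerivAt
        (fun y => G (y, θ) - ∑ j ∈ Finset.range (n + 1), taylorCoeffFst G j θ * y ^ j)
        (partialFst G (y, θ) - ∑ j ∈ Finset.range n, taylorCoeffFst (partialFst G) j θ * y ^ j) y := by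
      intro y
      refine (hasDerivAt_partialFst hG y θ).sub ?_
      have h1 : HasDerivAt (fun y : ℝ => ∑ j ∈ Finset.range (n + 1), taylorCoeffFst G j θ * y ^ j)
          (∑ j ∈ Finset.range (n + 1), taylorCoeffFst G j θ * (j * y ^ (j - 1))) y :=
        HasDerivAt.fun_sum fun j _ => (hasDerivAt_pow j y).const_mul _
      refine h1.congr_deriv ?_
      rw [Finset.sum_range_succ']
      simp only [Nat.cast_zero, zero_mul, mul_zero, add_zero]
      refine Finset.sum_congr rfl fun j _ => ?_
      simp only [taylorCoeffFst, Function.iterate_succ_apply, Nat.factorial_succ, Nat.cast_mul,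
        Nat.add_sub_cancel]
      have : (j.factorial : ℝ) ≠ 0 := by positivity
      have : ((j + 1 : ℕ) : ℝ) ≠ 0 := by positivity
      field_simp
    have h0 : (0 : ℝ) ∈ Icc (-|x|) |x| := ⟨by simp, abs_nonneg x⟩
    have hx' : x ∈ Icc (-|x|) |x| := abs_le.1 le_rfl
    have hmv := (convex_Icc (-|x|) |x|).norm_image_sub_le_of_norm_hasDerivWithin_le
      (fun y _ => (hd y).hasDerivWithinAt) (C := C * |x| ^ n) (fun y hy => by
        have hy' : |y| ≤ |x| := abs_le.2 hy
        refine (hC θ hθ y (hy'.trans hx)).trans ?_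
        gcongr) h0 hx'
    have e0 : G (0, θ) - ∑ j ∈ Finset.range (n + 1), taylorCoeffFst G j θ * (0 : ℝ) ^ j = 0 := by
      rw [Finset.sum_range_succ']
      simp [taylorCoeffFst_zero]
    rw [e0] at hmv
    simpa [pow_succ, mul_assoc] using hmv

/-- Expansion to order `n` in `p` and order zero in `r`. -/
theorem exists_taylor_bound_mixed {H : ℝ × ℝ × Q → ℝ}
    (hH : ContDiff ℝ ((⊤ : ℕ∞) : WithTop ℕ∞) H) {S : Set Q} (hS : IsCompact S) (n : ℕ) :
    ∃ C, 0 < C ∧ ∀ θ ∈ S, ∀ p r, |p| ≤ 1 → |r| ≤ 1 →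
      |H (r, p, θ) - ∑ j ∈ Finset.range n, taylorCoeffFst (fun q : ℝ × Q => H (0, q)) j θ * p ^ j|
        ≤ C * (|p| ^ n + |r|) := by
  obtain ⟨C1, h1, k1⟩ := exists_taylor_bound hH
    ((isCompact_Icc (a := (-1 : ℝ)) (b := 1)).prod hS) 1
  obtain ⟨C2, h2, k2⟩ := exists_taylor_bound (G := fun q : ℝ × Q => H (0, q))
    (hH.comp (contDiff_const.prodMk contDiff_id)) hS n
  refine ⟨C1 + C2, by positivity, fun θ hθ p r hp hr => ?_⟩
  have e1 := k1 (p, θ) ⟨abs_le.1 hp, hθ⟩ r hr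
  have e2 := k2 θ hθ p hp
  simp only [Finset.range_one, Finset.sum_singleton, pow_zero, mul_one, taylorCoeffFst_zero,
    pow_one] at e1
  have h3 := (abs_sub_le _ _ _).trans (add_le_add e1 e2)
  have : 0 ≤ C1 * |p| ^ n := by positivity
  have : 0 ≤ C2 * |r| := by positivity
  linarith

/-- Expansion to order three in `(p, q)` of a function of `p` and `r = q²`. -/
theorem exists_taylor_bound_even {H : ℝ × ℝ × Q → ℝ}
    (hH : ContDiff ℝ ((⊤ : ℕ∞) : WithTop ℕ∞) H) {S : Set Q} (hS : IsCompact S) :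
    ∃ C, 0 < C ∧ ∀ θ ∈ S, ∀ p q, |p| ≤ 1 → |q| ≤ 1 →
      |H (q ^ 2, p, θ) - (H (0, 0, θ) + taylorCoeffFst (fun q : ℝ × Q => H (0, q)) 1 θ * p
        + taylorCoeffFst (fun q : ℝ × Q => H (0, q)) 2 θ * p ^ 2
        + taylorCoeffFst H 1 (0, θ) * q ^ 2)| ≤ C * (|p| + |q|) ^ 3 := by
  obtain ⟨C1, h1, k1⟩ := exists_taylor_bound hH
    ((isCompact_Icc (a := (-1 : ℝ)) (b := 1)).prod hS) 2
  obtain ⟨C2, h2, k2⟩ := exists_taylor_bound (G := fun q : ℝ × Q => H (0, q))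
    (hH.comp (contDiff_const.prodMk contDiff_id)) hS 3
  obtain ⟨C3, h3, k3⟩ := exists_taylor_bound (contDiff_taylorCoeffFst hH 1) hS 1
  refine ⟨C1 + C2 + C3, by positivity, fun θ hθ p q hp hq => ?_⟩
  have hq2 : |q ^ 2| ≤ 1 := by rw [abs_pow]; exact pow_le_one₀ (abs_nonneg _) hq
  have e1 := k1 (p, θ) ⟨abs_le.1 hp, hθ⟩ (q ^ 2) hq2
  have e2 := k2 θ hθ p hp
  have e3 := k3 θ hθ p hp
  simp only [Finset.sum_range_succ, Finset.range_zero, Finset.sum_empty, zero_add, pow_zero, mul_one,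
    taylorCoeffFst_zero, pow_one] at e1 e2 e3
  have hp0 := abs_nonneg p
  have hq0 := abs_nonneg q
  have b1 : |q ^ 2| ^ 2 ≤ (|p| + |q|) ^ 3 := by
    rw [abs_pow]
    calc (|q| ^ 2) ^ 2 = |q| * |q| ^ 3 := by ring
      _ ≤ 1 * |q| ^ 3 := by gcongr
      _ ≤ (|p| + |q|) ^ 3 := by rw [one_mul]; gcongr; linarith
  have b2 : |p| ^ 3 ≤ (|p| + |q|) ^ 3 := by gcongr; linarith
  have b3 : |p| * q ^ 2 ≤ (|p| + |q|) ^ 3 := by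
    rw [← sq_abs q]
    calc |p| * |q| ^ 2 ≤ (|p| + |q|) * (|p| + |q|) ^ 2 := by gcongr <;> linarith
      _ = _ := by ring
  have e3' : |taylorCoeffFst H 1 (p, θ) - taylorCoeffFst H 1 (0, θ)| * q ^ 2
      ≤ C3 * (|p| + |q|) ^ 3 := by
    calc _ ≤ C3 * |p| * q ^ 2 := by gcongr
      _ = C3 * (|p| * q ^ 2) := by ring
      _ ≤ _ := by gcongr
  have e1' := e1.trans (mul_le_mul_of_nonneg_left b1 h1.le)
  have e2' := e2.trans (mul_le_mul_of_nonneg_left b2 h2.le)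
  rw [← abs_of_nonneg (sq_nonneg q), ← abs_mul] at e3'
  have := (abs_add_three _ _ _).trans (add_le_add (add_le_add e1' e2') e3')
  refine le_trans (le_of_eq ?_) (this.trans (le_of_eq (by ring)))
  congr 1
  ring

end Taylor

/-! ### The branch of equilibria near the bifurcation -/

theorem hasDerivAt_integral_pow_mul_comp_mul {h : ℝ → ℝ}
    (hh : ContDiff ℝ ((⊤ : ℕ∞) : WithTop ℕ∞) h) (n : ℕ) (u : ℝ) :
    HasDerivAt (fun u => ∫ t in (0 : ℝ)..1, t ^ n * h (t * u))
      (∫ t in (0 : ℝ)..1, t ^ (n + 1) * deriv h (t * u)) u := by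
  have hd : ∀ x, HasDerivAt h (deriv h x) x := fun x =>
    ((hh.differentiable (by simp)) x).hasDerivAt
  have hdc : Continuous (deriv h) := hh.continuous_deriv (by simp)
  have hc : Continuous (fun q : ℝ × ℝ => q.2 ^ (n + 1) * deriv h (q.2 * q.1)) := by fun_prop
  obtain ⟨C, hC⟩ := ((isCompact_closedBall u 1).prod
    (isCompact_Icc (a := (0 : ℝ)) (b := 1))).exists_bound_of_continuousOn hc.continuousOn
  have hhc := hh.continuous
  refine (intervalIntegral.hasDerivAt_integral_of_dominated_loc_of_deriv_le
    (F := fun u t => t ^ n * h (t * u)) (F' := fun u t => t ^ (n + 1) * deriv h (t * u))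
    (bound := fun _ => C) (Metric.closedBall_mem_nhds u one_pos)
    (Eventually.of_forall fun x => (Continuous.aestronglyMeasurable (by fun_prop)))
    (Continuous.intervalIntegrable (by fun_prop) _ _)
    (Continuous.aestronglyMeasurable (by fun_prop))
    (Eventually.of_forall fun t ht x hx => ?_) intervalIntegrable_const
    (Eventually.of_forall fun t ht x hx => ?_)).2
  · rw [uIoc_of_le zero_le_one] at ht
    exact hC (x, t) ⟨hx, ht.1.le, ht.2⟩
  · have h1 : HasDerivAt (fun x => t * x) t x := by simpa using (hasDerivAt_id x).const_mul t
    refine (((hd (t * x)).comp x h1).const_mul (t ^ n)).congr_deriv ?_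
    ring

theorem contDiff_integral_pow_mul_comp_mul {h : ℝ → ℝ}
    (hh : ContDiff ℝ ((⊤ : ℕ∞) : WithTop ℕ∞) h) (n : ℕ) :
    ContDiff ℝ ((⊤ : ℕ∞) : WithTop ℕ∞) (fun u => ∫ t in (0 : ℝ)..1, t ^ n * h (t * u)) := by
  rw [contDiff_infty]
  intro m
  induction m generalizing h n with
  | zero =>
    refine contDiff_zero.2 (Differentiable.continuous (𝕜 := ℝ) fun u =>
      (hasDerivAt_integral_pow_mul_comp_mul hh n u).differentiableAt)
  | succ m ih =>
    push_cast
    refine contDiff_succ_iff_deriv.2 ⟨fun u =>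
      (hasDerivAt_integral_pow_mul_comp_mul hh n u).differentiableAt, by simp, ?_⟩
    have e : deriv (fun u => ∫ t in (0 : ℝ)..1, t ^ n * h (t * u))
        = fun u => ∫ t in (0 : ℝ)..1, t ^ (n + 1) * deriv h (t * u) :=
      funext fun u => (hasDerivAt_integral_pow_mul_comp_mul hh n u).deriv
    rw [e]
    exact ih (contDiff_infty_iff_deriv.1 hh).2 (n + 1)

/-- A smooth function vanishing at `0` is the product of `u` and a smooth function. -/
theorem exists_eq_mul_of_contDiff {f : ℝ → ℝ} (hf : ContDiff ℝ ((⊤ : ℕ∞) : WithTop ℕ∞) f)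
    (h0 : f 0 = 0) : ∃ g : ℝ → ℝ, ContDiff ℝ ((⊤ : ℕ∞) : WithTop ℕ∞) g ∧ (∀ u, f u = u * g u) ∧
      g 0 = deriv f 0 := by
  have hf' := (contDiff_infty_iff_deriv.1 hf).2
  refine ⟨_, contDiff_integral_pow_mul_comp_mul hf' 0, fun u => ?_, by simp⟩
  have hd : ∀ t ∈ uIcc (0 : ℝ) 1, HasDerivAt (fun t => f (t * u))
      (u * (t ^ 0 * deriv f (t * u))) t := by
    intro t _
    have h1 : HasDerivAt (fun t => t * u) u t := by simpa using (hasDerivAt_id t).mul_const u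
    refine ((((hf.differentiable (by simp)) (t * u)).hasDerivAt).comp t h1).congr_deriv ?_
    ring
  have hc : Continuous (fun t => u * (t ^ 0 * deriv f (t * u))) := by
    have := hf'.continuous
    fun_prop
  have := intervalIntegral.integral_eq_sub_of_hasDerivAt hd (hc.intervalIntegrable _ _)
  rw [intervalIntegral.integral_const_mul] at this
  simpa [h0] using this.symm

/-- `∂H/∂X = X E₁(X, u) - f(u)/2 + Y ∂M/∂X / 2` with `E₁ = 1 + V + X ∂V/∂X / 2`. -/
def hamE (V : ℝ → ℝ → ℝ) (q : ℝ × ℝ) : ℝ :=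
  1 + V q.1 q.2 + 1 / 2 * q.1 * deriv (fun X => V X q.2) q.1

/-- The partial derivative of `M(X, Y, u)` with respect to `X`. -/
def hamMX (M : ℝ → ℝ → ℝ → ℝ) (q : ℝ × ℝ × ℝ) : ℝ := deriv (fun X => M X q.2.1 q.2.2) q.1

/-- Twice the partial derivative of `H` with respect to `Y`. -/
def hamY (M : ℝ → ℝ → ℝ → ℝ) (q : ℝ × ℝ × ℝ) : ℝ :=
  1 + M q.1 q.2.1 q.2.2 + q.2.1 * deriv (fun Y => M q.1 Y q.2.2) q.2.1

section Hamiltonian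

variable {f : ℝ → ℝ} {M : ℝ → ℝ → ℝ → ℝ} {V : ℝ → ℝ → ℝ}

theorem contDiff_hamE
    (hV : ContDiff ℝ ((⊤ : ℕ∞) : WithTop ℕ∞) (fun p : ℝ × ℝ => V p.1 p.2)) :
    ContDiff ℝ ((⊤ : ℕ∞) : WithTop ℕ∞) (hamE V) := by
  have h := contDiff_partialFst hV
  exact (contDiff_const.add hV).add ((contDiff_const.mul contDiff_fst).mul h)

theorem contDiff_hamMX
    (hM : ContDiff ℝ ((⊤ : ℕ∞) : WithTop ℕ∞) (fun p : ℝ × ℝ × ℝ => M p.1 p.2.1 p.2.2)) :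
    ContDiff ℝ ((⊤ : ℕ∞) : WithTop ℕ∞) (hamMX M) :=
  contDiff_partialFst hM

theorem contDiff_hamY
    (hM : ContDiff ℝ ((⊤ : ℕ∞) : WithTop ℕ∞) (fun p : ℝ × ℝ × ℝ => M p.1 p.2.1 p.2.2)) :
    ContDiff ℝ ((⊤ : ℕ∞) : WithTop ℕ∞) (hamY M) := by
  have h1 : ContDiff ℝ ((⊤ : ℕ∞) : WithTop ℕ∞) (fun p : ℝ × ℝ × ℝ => M p.2.1 p.1 p.2.2) :=
    hM.comp (contDiff_snd.fst.prodMk (contDiff_fst.prodMk contDiff_snd.snd))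
  have h2 : ContDiff ℝ ((⊤ : ℕ∞) : WithTop ℕ∞)
      (fun q : ℝ × ℝ × ℝ => deriv (fun Y => M q.1 Y q.2.2) q.2.1) :=
    (contDiff_partialFst h1).comp
      (contDiff_snd.fst.prodMk (contDiff_fst.prodMk contDiff_snd.snd))
  exact (contDiff_const.add hM).add (contDiff_snd.fst.mul h2)

theorem slowFastHX_eq
    (hM : ContDiff ℝ ((⊤ : ℕ∞) : WithTop ℕ∞) (fun p : ℝ × ℝ × ℝ => M p.1 p.2.1 p.2.2))
    (hV : ContDiff ℝ ((⊤ : ℕ∞) : WithTop ℕ∞) (fun p : ℝ × ℝ => V p.1 p.2)) (u X Y : ℝ) :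
    slowFastHX f M V u X Y = X * hamE V (X, u) - f u / 2 + Y / 2 * hamMX M (X, Y, u) := by
  have h1 : HasDerivAt (fun X => M X Y u) (hamMX M (X, Y, u)) X := hasDerivAt_partialFst hM X (Y, u)
  have h2 : HasDerivAt (fun X => V X u) (deriv (fun X => V X u) X) X := hasDerivAt_partialFst hV X u
  have h := ((((h1.const_add 1).const_mul (1 / 2 * Y)).const_add 0).sub
    ((hasDerivAt_id X).const_mul (1 / 2 * f u))).add
    (((hasDerivAt_pow 2 X).const_mul (1 / 2)).mul (h2.const_add 1))
  rw [slowFastHX]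
  refine (HasDerivAt.deriv h).trans ?_
  simp only [hamE]
  push_cast
  ring

theorem slowFastHY_eq
    (hM : ContDiff ℝ ((⊤ : ℕ∞) : WithTop ℕ∞) (fun p : ℝ × ℝ × ℝ => M p.1 p.2.1 p.2.2)) (u X Y : ℝ) :
    slowFastHY f M V u X Y = hamY M (X, Y, u) / 2 := by
  have h1 : ContDiff ℝ ((⊤ : ℕ∞) : WithTop ℕ∞) (fun p : ℝ × ℝ × ℝ => M p.2.1 p.1 p.2.2) :=
    hM.comp (contDiff_snd.fst.prodMk (contDiff_fst.prodMk contDiff_snd.snd))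
  have h2 : HasDerivAt (fun Y => M X Y u) (deriv (fun Y => M X Y u) Y) Y :=
    hasDerivAt_partialFst h1 Y (X, u)
  have h := (((((hasDerivAt_id Y).const_mul (1 / 2)).mul (h2.const_add 1)).const_add 0).sub_const
    (1 / 2 * f u * X)).add_const (1 / 2 * X ^ 2 * (1 + V X u))
  rw [slowFastHY]
  refine (HasDerivAt.deriv h).trans ?_
  simp only [hamY, id]
  ring

theorem slowFastHXX_eq
    (hM : ContDiff ℝ ((⊤ : ℕ∞) : WithTop ℕ∞) (fun p : ℝ × ℝ × ℝ => M p.1 p.2.1 p.2.2))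
    (hV : ContDiff ℝ ((⊤ : ℕ∞) : WithTop ℕ∞) (fun p : ℝ × ℝ => V p.1 p.2)) (u X : ℝ) :
    slowFastHXX f M V u X 0 = deriv (fun X => X * hamE V (X, u)) X := by
  rw [slowFastHXX]
  simp only [slowFastHX_eq hM hV, zero_div, zero_mul, add_zero]
  rw [deriv_sub_const]

end Hamiltonian

/-- The squared branch `κ(u)²` is the product of `u` and a function `k₀` that is smooth and positive
up to the bifurcation, where it takes the value `1/2`. -/
theorem SlowFastAssumptions.exists_branch {f : ℝ → ℝ} {M : ℝ → ℝ → ℝ → ℝ} {V : ℝ → ℝ → ℝ}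
    {τ : ℝ} {κ : ℝ → ℝ} (hs : SlowFastAssumptions f M V τ κ) :
    ∃ k₀ : ℝ → ℝ, SmoothIcc (τ / 2) k₀ ∧ (∀ u ∈ Icc 0 (τ / 2), 0 < k₀ u) ∧ k₀ 0 = 1 / 2 ∧
      ∀ u ∈ Ioc 0 (τ / 2), κ u ^ 2 = u * k₀ u := by
  obtain ⟨f₁, hf₁, hff, hf₁0⟩ := exists_eq_mul_of_contDiff hs.smooth_f hs.f_zero
  have hE := contDiff_hamE hs.smooth_V
  have hE0 : hamE V (0, 0) = 1 := by simp [hamE, hs.V_zero]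
  set F : ℝ × ℝ → ℝ := fun q => 2 * q.2 * hamE V (q.1 * q.2, q.1) - f₁ q.1 with hF
  have hFc : ContDiff ℝ ((⊤ : ℕ∞) : WithTop ℕ∞) F := by fun_prop
  have hF0 : F (0, 1 / 2) = 0 := by simp [hF, hE0, hf₁0, hs.deriv_f_zero]
  have hcd : ContDiffAt ℝ ((⊤ : ℕ∞) : WithTop ℕ∞) F (0, 1 / 2) := hFc.contDiffAt
  have hinv : (fderiv ℝ F (0, 1 / 2) ∘L .inr ℝ ℝ ℝ).IsInvertible := by
    have h1 : HasDerivAt (fun k : ℝ => F (0, k)) (fderiv ℝ F (0, 1 / 2) (0, 1)) (1 / 2) :=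
      (hFc.differentiable (by simp)).differentiableAt.hasFDerivAt.comp_hasDerivAt (1 / 2 : ℝ)
        ((hasDerivAt_const _ (0 : ℝ)).prodMk (hasDerivAt_id _))
    have h2 : HasDerivAt (fun k : ℝ => F (0, k)) 2 (1 / 2) := by
      have : (fun k : ℝ => F (0, k)) = fun k => 2 * k - f₁ 0 := by
        funext k; simp [hF, hE0]
      rw [this]
      simpa using ((hasDerivAt_id (1 / 2 : ℝ)).const_mul 2).sub_const (f₁ 0)
    have h3 := h1.unique h2
    refine ⟨ContinuousLinearEquiv.unitsEquivAut ℝ (Units.mk0 2 two_ne_zero), ?_⟩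
    ext
    simpa using h3.symm
  have hne : ((⊤ : ℕ∞) : WithTop ℕ∞) ≠ 0 := by simp
  set g := hcd.implicitFunction hne hinv with hg
  have hgc : ContDiffAt ℝ ((⊤ : ℕ∞) : WithTop ℕ∞) g 0 := hcd.contDiffAt_implicitFunction hne hinv
  have hg0 : g 0 = 1 / 2 := hcd.implicitFunction_apply_self hne hinv
  have hiff : ∀ᶠ v in 𝓝 ((0 : ℝ), (1 / 2 : ℝ)), F v = F (0, 1 / 2) ↔ g v.1 = v.2 :=
    hcd.eventually_apply_eq_iff_implicitFunction hne hinv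
  have hτ := hs.tau_pos
  have heq : ∀ u, 0 < u → u < τ → 2 * (κ u ^ 2 / u) * hamE V (κ u ^ 2, u) = f₁ u := by
    intro u h0 h1
    have h := hs.kappa_eq u h0 h1
    rw [slowFastHX_eq hs.smooth_M hs.smooth_V, hff] at h
    field_simp
    linarith
  -- the quotient `κ(u)²/u` tends to `1/2`, so that it agrees with the implicit function
  have hκ2 : Tendsto (fun u => κ u ^ 2) (𝓝[>] 0) (𝓝 0) := by
    simpa using hs.kappa_bifurcates.pow 2
  have hu0 : Tendsto (fun u : ℝ => u) (𝓝[>] 0) (𝓝 0) :=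
    tendsto_nhdsWithin_of_tendsto_nhds tendsto_id
  have hEt : Tendsto (fun u => hamE V (κ u ^ 2, u)) (𝓝[>] 0) (𝓝 1) := by
    rw [← hE0]
    exact hE.continuous.continuousAt.tendsto.comp (hκ2.prodMk_nhds hu0)
  have hmem : ∀ᶠ u in 𝓝[>] (0 : ℝ), 0 < u ∧ u < τ :=
    (eventually_mem_nhdsWithin).and (nhdsWithin_le_nhds (Iio_mem_nhds hτ))
  have hkt : Tendsto (fun u => κ u ^ 2 / u) (𝓝[>] 0) (𝓝 (1 / 2)) := by
    have h1 : Tendsto (fun u => f₁ u / (2 * hamE V (κ u ^ 2, u))) (𝓝[>] 0) (𝓝 (f₁ 0 / (2 * 1))) :=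
      (hf₁.continuous.continuousAt.tendsto.comp hu0).div (hEt.const_mul 2) (by norm_num)
    rw [hf₁0, hs.deriv_f_zero, mul_one] at h1
    refine h1.congr' ?_
    filter_upwards [hmem, hEt.eventually_ne one_ne_zero] with u hu hE
    rw [← heq u hu.1 hu.2]
    field_simp
  have hgk : ∀ᶠ u in 𝓝[>] (0 : ℝ), g u = κ u ^ 2 / u := by
    filter_upwards [(hu0.prodMk_nhds hkt).eventually hiff, hmem] with u h hu
    refine h.1 ?_
    rw [hF0]
    simp only [hF]
    rw [mul_div_cancel₀ _ hu.1.ne', heq u hu.1 hu.2, sub_self]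
  set k₀ : ℝ → ℝ := fun u => if u ≤ 0 then g u else κ u ^ 2 / u with hk₀
  have hk₀g : k₀ =ᶠ[𝓝 0] g := by
    have h := eventually_nhdsWithin_iff.1 hgk
    filter_upwards [h] with u hu
    by_cases h0 : u ≤ 0
    · simp [hk₀, h0]
    · simp only [hk₀, h0, if_false]; exact (hu (not_le.1 h0)).symm
  have hk₀pos : ∀ u, 0 < u → k₀ u = κ u ^ 2 / u := fun u hu => by simp [hk₀, hu]
  refine ⟨k₀, fun u hu => ?_, fun u hu => ?_, ?_, fun u hu => ?_⟩
  · rcases hu.1.eq_or_lt with rfl | h0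
    · exact hgc.congr_of_eventuallyEq hk₀g
    · have h1 : k₀ =ᶠ[𝓝 u] fun u => κ u ^ 2 / u := by
        filter_upwards [Ioi_mem_nhds h0] with v hv using hk₀pos v hv
      refine ContDiffAt.congr_of_eventuallyEq ?_ h1
      have h2 := hs.kappa_smooth.contDiffAt (Ioo_mem_nhds h0 (by linarith [hu.2] : u < τ))
      exact (h2.pow 2).div contDiffAt_id h0.ne'
  · rcases hu.1.eq_or_lt with rfl | h0
    · simp [hk₀, hg0]
    · rw [hk₀pos u h0]
      have := hs.kappa_pos u h0 (by linarith [hu.2])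
      positivity
  · simp [hk₀, hg0]
  · rw [hk₀pos u hu.1, mul_div_cancel₀ _ hu.1.ne']

/-! ### The coefficients of the system rescaled at the branch -/

/-- `2 ∂H/∂Y` at `X = K (1 + p)²`, `Y = K² r`, as a function of `(r, p, K, u)`. -/
def modelY (M : ℝ → ℝ → ℝ → ℝ) (q : ℝ × ℝ × ℝ × ℝ) : ℝ :=
  hamY M (q.2.2.1 * (1 + q.2.1) ^ 2, q.2.2.1 ^ 2 * q.1, q.2.2.2)

/-- The restoring force at `X = K (1 + p)²`, `Y = 0`, divided by `K^{3/2}`, as a function of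
`(p, K, u)`. Here `f(u)` is expressed by `K` through the equation of the branch. -/
def modelE (V : ℝ → ℝ → ℝ) (q : ℝ × ℝ × ℝ) : ℝ :=
  2 * (1 + q.1) * ((1 + q.1) ^ 2 * hamE V (q.2.1 * (1 + q.1) ^ 2, q.2.2) - hamE V (q.2.1, q.2.2))

/-- The coefficient of `q²` in the restoring force at `X = K (1 + p)²`, `Y = K² r` with `r = q²`. -/
def modelMX (M : ℝ → ℝ → ℝ → ℝ) (q : ℝ × ℝ × ℝ × ℝ) : ℝ :=
  (1 + q.2.1) * (q.2.2.1 * hamMX M (q.2.2.1 * (1 + q.2.1) ^ 2, q.2.2.1 ^ 2 * q.1, q.2.2.2))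

section Model

variable {M : ℝ → ℝ → ℝ → ℝ} {V : ℝ → ℝ → ℝ}

theorem contDiff_modelY
    (hM : ContDiff ℝ ((⊤ : ℕ∞) : WithTop ℕ∞) (fun p : ℝ × ℝ × ℝ => M p.1 p.2.1 p.2.2)) :
    ContDiff ℝ ((⊤ : ℕ∞) : WithTop ℕ∞) (modelY M) := by
  have := contDiff_hamY hM
  unfold modelY
  fun_prop

theorem contDiff_modelE
    (hV : ContDiff ℝ ((⊤ : ℕ∞) : WithTop ℕ∞) (fun p : ℝ × ℝ => V p.1 p.2)) :
    ContDiff ℝ ((⊤ : ℕ∞) : WithTop ℕ∞) (modelE V) := by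
  have := contDiff_hamE hV
  unfold modelE
  fun_prop

theorem contDiff_modelMX
    (hM : ContDiff ℝ ((⊤ : ℕ∞) : WithTop ℕ∞) (fun p : ℝ × ℝ × ℝ => M p.1 p.2.1 p.2.2)) :
    ContDiff ℝ ((⊤ : ℕ∞) : WithTop ℕ∞) (modelMX M) := by
  have := contDiff_hamMX hM
  unfold modelMX
  fun_prop

theorem contDiff_slice_zero {H : ℝ × ℝ × ℝ × ℝ → ℝ}
    (hH : ContDiff ℝ ((⊤ : ℕ∞) : WithTop ℕ∞) H) :
    ContDiff ℝ ((⊤ : ℕ∞) : WithTop ℕ∞) (fun q : ℝ × ℝ × ℝ => H (0, q)) := by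
  fun_prop

end Model

/-- A smooth quotient `k₀` of the squared branch `K = κ²` by `u`, together with the functions `M`
and `V`. -/
structure BranchData where
  M : ℝ → ℝ → ℝ → ℝ
  V : ℝ → ℝ → ℝ
  k₀ : ℝ → ℝ

namespace BranchData

variable (D : BranchData)

/-- The point `(K(u), u)`. -/
def θ (u : ℝ) : ℝ × ℝ := (u * D.k₀ u, u)

/-- The constant term of the expansion `2 ∂H/∂Y = m + m₁ p + m₂ p² + m₃ q² + …`. -/
def m (u : ℝ) : ℝ := modelY D.M (0, 0, D.θ u)

/-- The coefficient of `p` in `2 ∂H/∂Y`. -/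
def m₁ (u : ℝ) : ℝ := taylorCoeffFst (fun q : ℝ × ℝ × ℝ => modelY D.M (0, q)) 1 (D.θ u)

/-- The coefficient of `p²` in `2 ∂H/∂Y`. -/
def m₂ (u : ℝ) : ℝ := taylorCoeffFst (fun q : ℝ × ℝ × ℝ => modelY D.M (0, q)) 2 (D.θ u)

/-- The coefficient of `q²` in `2 ∂H/∂Y`. -/
def m₃ (u : ℝ) : ℝ := taylorCoeffFst (modelY D.M) 1 (0, D.θ u)

/-- The Taylor coefficients `t₁ p + t₂ p² + t₃ p³ + …` of the restoring force. -/
def t (j : ℕ) (u : ℝ) : ℝ := taylorCoeffFst (modelE D.V) j (D.θ u)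

/-- The Taylor coefficients `n₀ + n₁ p + …` of the coefficient of `q²` in the restoring force. -/
def n (j : ℕ) (u : ℝ) : ℝ := taylorCoeffFst (fun q : ℝ × ℝ × ℝ => modelMX D.M (0, q)) j (D.θ u)

/-- The rescaled frequency of the linear oscillations: the frequency is `√u ω(u)`. -/
def ω (u : ℝ) : ℝ := Real.sqrt (D.k₀ u) * Real.sqrt (D.t 1 u) * Real.sqrt (D.m u)

/-- The scaling of the relative displacement `p` by which the linear part becomes a rotation. -/
def α (u : ℝ) : ℝ :=
  Real.sqrt (Real.sqrt (D.k₀ u) ^ 3 * Real.sqrt (D.t 1 u) / Real.sqrt (D.m u))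

/-- The scaling of the relative momentum `q` by which the linear part becomes a rotation. -/
def β (u : ℝ) : ℝ := Real.sqrt (D.k₀ u) ^ 3 / D.α u

/-- The logarithmic derivative `u κ'/κ` of the branch. -/
def k (u : ℝ) : ℝ := (1 + u * deriv D.k₀ u / D.k₀ u) / 2

/-- The coefficient of `P²` in the equation for `Q`, up to the factor `-ω`. -/
def d₁ (u : ℝ) : ℝ := D.t 2 u / (D.t 1 u * D.α u)

/-- The coefficient of `Q²` in the equation for `Q`, up to the factor `-ω`. -/
def d₂ (u : ℝ) : ℝ := D.α u * D.n 0 u / (D.t 1 u * D.β u ^ 2)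

/-- The coefficient of `P³` in the equation for `Q`, up to the factor `-ω`. -/
def d₃ (u : ℝ) : ℝ := D.t 3 u / (D.t 1 u * D.α u ^ 2)

/-- The coefficient of `P Q²` in the equation for `Q`, up to the factor `-ω`. -/
def d₄ (u : ℝ) : ℝ := D.n 1 u / (D.t 1 u * D.β u ^ 2)

/-- The coefficient of `P² Q` in the equation for `P`, up to the factor `ω`. -/
def a₂ (u : ℝ) : ℝ := D.m₂ u / (D.m u * D.α u ^ 2)

/-- The coefficient of `Q³` in the equation for `P`, up to the factor `ω`. -/
def a₃ (u : ℝ) : ℝ := D.m₃ u / (D.m u * D.β u ^ 2)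

/-- The coefficients in the complex variable `z = P + i Q`. -/
def coeffs : OscCoeffs where
  ω := D.ω
  a u := -(1 / 4) * (D.d₁ u + D.d₂ u)
  c u := 1 / 4 * (3 * D.d₂ u - D.d₁ u)
  B u := D.k u * D.α u / D.ω u
  c30 u := 1 / 8 * (D.a₃ u - D.a₂ u - D.d₃ u + D.d₄ u)
  c21 u := 1 / 8 * (-D.a₂ u - 3 * D.a₃ u - 3 * D.d₃ u - D.d₄ u)
  c12 u := 1 / 8 * (D.a₂ u + 3 * D.a₃ u - 3 * D.d₃ u - D.d₄ u)
  c03 u := 1 / 8 * (D.a₂ u - D.a₃ u - D.d₃ u + D.d₄ u)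
  l u := (u * deriv D.α u / D.α u + 3 / 4 - D.k u) / D.ω u

/-- The properties of the data of a branch that are used below. -/
structure Regular (U : ℝ) : Prop where
  smooth_M : ContDiff ℝ ((⊤ : ℕ∞) : WithTop ℕ∞) (fun p : ℝ × ℝ × ℝ => D.M p.1 p.2.1 p.2.2)
  smooth_V : ContDiff ℝ ((⊤ : ℕ∞) : WithTop ℕ∞) (fun p : ℝ × ℝ => D.V p.1 p.2)
  smooth_k₀ : SmoothIcc U D.k₀
  k₀_pos : ∀ u ∈ Icc 0 U, 0 < D.k₀ u
  k₀_zero : D.k₀ 0 = 1 / 2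
  M_zero : D.M 0 0 0 = 0
  V_zero : D.V 0 0 = 0
  m_pos : ∀ u ∈ Icc 0 U, 0 < D.m u
  t_pos : ∀ u ∈ Icc 0 U, 0 < D.t 1 u

theorem m_eq (u : ℝ) : D.m u = 1 + D.M (u * D.k₀ u) 0 u := by
  simp [m, modelY, hamY, θ]

namespace Regular

variable {D} {U : ℝ} (h : D.Regular U)
include h

theorem smooth_θ : ∀ u ∈ Icc 0 U, ContDiffAt ℝ ((⊤ : ℕ∞) : WithTop ℕ∞) D.θ u :=
  fun u hu => (SmoothIcc.id.mul h.smooth_k₀ u hu).prodMk contDiffAt_id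

theorem smooth_m : SmoothIcc U D.m :=
  SmoothIcc.comp_contDiff (contDiff_modelY h.smooth_M) fun u hu =>
    contDiffAt_const.prodMk (contDiffAt_const.prodMk (h.smooth_θ u hu))

theorem smooth_m₂ : SmoothIcc U D.m₂ := SmoothIcc.comp_contDiff
  (contDiff_taylorCoeffFst (contDiff_slice_zero (contDiff_modelY h.smooth_M)) 2) h.smooth_θ

theorem smooth_m₃ : SmoothIcc U D.m₃ :=
  SmoothIcc.comp_contDiff (contDiff_taylorCoeffFst (contDiff_modelY h.smooth_M) 1) fun u hu =>
    contDiffAt_const.prodMk (h.smooth_θ u hu)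

theorem smooth_t (j : ℕ) : SmoothIcc U (D.t j) :=
  SmoothIcc.comp_contDiff (contDiff_taylorCoeffFst (contDiff_modelE h.smooth_V) j) h.smooth_θ

theorem smooth_n (j : ℕ) : SmoothIcc U (D.n j) := SmoothIcc.comp_contDiff
  (contDiff_taylorCoeffFst (contDiff_slice_zero (contDiff_modelMX h.smooth_M)) j) h.smooth_θ

theorem α_sq_pos {u : ℝ} (hu : u ∈ Icc 0 U) :
    0 < Real.sqrt (D.k₀ u) ^ 3 * Real.sqrt (D.t 1 u) / Real.sqrt (D.m u) := by
  have := Real.sqrt_pos.2 (h.k₀_pos u hu)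
  have := Real.sqrt_pos.2 (h.t_pos u hu)
  have := Real.sqrt_pos.2 (h.m_pos u hu)
  positivity

theorem α_pos {u : ℝ} (hu : u ∈ Icc 0 U) : 0 < D.α u := Real.sqrt_pos.2 (h.α_sq_pos hu)

theorem α_sq {u : ℝ} (hu : u ∈ Icc 0 U) :
    D.α u ^ 2 = Real.sqrt (D.k₀ u) ^ 3 * Real.sqrt (D.t 1 u) / Real.sqrt (D.m u) :=
  Real.sq_sqrt (h.α_sq_pos hu).le

theorem β_pos {u : ℝ} (hu : u ∈ Icc 0 U) : 0 < D.β u :=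
  div_pos (pow_pos (Real.sqrt_pos.2 (h.k₀_pos u hu)) 3) (h.α_pos hu)

theorem ω_pos {u : ℝ} (hu : u ∈ Icc 0 U) : 0 < D.ω u :=
  mul_pos (mul_pos (Real.sqrt_pos.2 (h.k₀_pos u hu)) (Real.sqrt_pos.2 (h.t_pos u hu)))
    (Real.sqrt_pos.2 (h.m_pos u hu))

theorem smooth_ω : SmoothIcc U D.ω :=
  ((h.smooth_k₀.sqrt h.k₀_pos).mul ((h.smooth_t 1).sqrt h.t_pos)).mul (h.smooth_m.sqrt h.m_pos)

theorem smooth_α : SmoothIcc U D.α :=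
  SmoothIcc.sqrt ((((h.smooth_k₀.sqrt h.k₀_pos).pow 3).mul ((h.smooth_t 1).sqrt h.t_pos)).div
    (h.smooth_m.sqrt h.m_pos) fun u hu => (Real.sqrt_pos.2 (h.m_pos u hu)).ne')
    fun _ hu => h.α_sq_pos hu

theorem smooth_β : SmoothIcc U D.β :=
  ((h.smooth_k₀.sqrt h.k₀_pos).pow 3).div h.smooth_α fun _ hu => (h.α_pos hu).ne'

theorem smooth_k : SmoothIcc U D.k :=
  ((SmoothIcc.const 1).add ((SmoothIcc.id.mul h.smooth_k₀.deriv).div h.smooth_k₀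
    fun u hu => (h.k₀_pos u hu).ne')).div (SmoothIcc.const 2) fun _ _ => two_ne_zero

theorem smooth_d₁ : SmoothIcc U D.d₁ :=
  (h.smooth_t 2).div ((h.smooth_t 1).mul h.smooth_α)
    fun u hu => (mul_pos (h.t_pos u hu) (h.α_pos hu)).ne'

theorem smooth_d₂ : SmoothIcc U D.d₂ :=
  (h.smooth_α.mul (h.smooth_n 0)).div ((h.smooth_t 1).mul (h.smooth_β.pow 2))
    fun u hu => (mul_pos (h.t_pos u hu) (pow_pos (h.β_pos hu) 2)).ne'

theorem smooth_d₃ : SmoothIcc U D.d₃ :=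
  (h.smooth_t 3).div ((h.smooth_t 1).mul (h.smooth_α.pow 2))
    fun u hu => (mul_pos (h.t_pos u hu) (pow_pos (h.α_pos hu) 2)).ne'

theorem smooth_d₄ : SmoothIcc U D.d₄ :=
  (h.smooth_n 1).div ((h.smooth_t 1).mul (h.smooth_β.pow 2))
    fun u hu => (mul_pos (h.t_pos u hu) (pow_pos (h.β_pos hu) 2)).ne'

theorem smooth_a₂ : SmoothIcc U D.a₂ :=
  h.smooth_m₂.div (h.smooth_m.mul (h.smooth_α.pow 2))
    fun u hu => (mul_pos (h.m_pos u hu) (pow_pos (h.α_pos hu) 2)).ne'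

theorem smooth_a₃ : SmoothIcc U D.a₃ :=
  h.smooth_m₃.div (h.smooth_m.mul (h.smooth_β.pow 2))
    fun u hu => (mul_pos (h.m_pos u hu) (pow_pos (h.β_pos hu) 2)).ne'

theorem smooth_coeffs : D.coeffs.Smooth U where
  ω := h.smooth_ω
  a := (SmoothIcc.const _).mul (h.smooth_d₁.add h.smooth_d₂)
  c := (SmoothIcc.const _).mul (((SmoothIcc.const _).mul h.smooth_d₂).sub h.smooth_d₁)
  B := (h.smooth_k.mul h.smooth_α).div h.smooth_ω fun _ hu => (h.ω_pos hu).ne'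
  c30 := (SmoothIcc.const _).mul (((h.smooth_a₃.sub h.smooth_a₂).sub h.smooth_d₃).add h.smooth_d₄)
  c21 := (SmoothIcc.const _).mul (((h.smooth_a₂.neg.sub ((SmoothIcc.const _).mul h.smooth_a₃)).sub
    ((SmoothIcc.const _).mul h.smooth_d₃)).sub h.smooth_d₄)
  c12 := (SmoothIcc.const _).mul (((h.smooth_a₂.add ((SmoothIcc.const _).mul h.smooth_a₃)).sub
    ((SmoothIcc.const _).mul h.smooth_d₃)).sub h.smooth_d₄)
  c03 := (SmoothIcc.const _).mul (((h.smooth_a₂.sub h.smooth_a₃).sub h.smooth_d₃).add h.smooth_d₄)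
  l := (((SmoothIcc.id.mul h.smooth_α.deriv).div h.smooth_α fun _ hu => (h.α_pos hu).ne').add
    (SmoothIcc.const _) |>.sub h.smooth_k).div h.smooth_ω fun _ hu => (h.ω_pos hu).ne'

theorem ω_div_m {u : ℝ} (hu : u ∈ Icc 0 U) :
    D.ω u = D.α u * Real.sqrt (D.k₀ u) / D.β u * D.m u := by
  have h1 := Real.sqrt_pos.2 (h.k₀_pos u hu)
  have h2 := Real.sqrt_pos.2 (h.t_pos u hu)
  have h3 := Real.sqrt_pos.2 (h.m_pos u hu)
  have h4 := h.α_pos hu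
  have e : D.α u / D.β u = Real.sqrt (D.t 1 u) / Real.sqrt (D.m u) := by
    have := h.α_sq hu
    rw [β]
    field_simp at this ⊢
    linarith
  rw [mul_div_right_comm, e, ω]
  nth_rewrite 3 [← Real.sq_sqrt (h.m_pos u hu).le]
  field_simp

theorem ω_div_t {u : ℝ} (hu : u ∈ Icc 0 U) :
    D.ω u = D.β u * Real.sqrt (D.k₀ u) / D.α u * D.t 1 u := by
  have h1 := Real.sqrt_pos.2 (h.k₀_pos u hu)
  have h2 := Real.sqrt_pos.2 (h.t_pos u hu)
  have h3 := Real.sqrt_pos.2 (h.m_pos u hu)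
  have h4 := h.α_pos hu
  have e : D.β u / D.α u = Real.sqrt (D.m u) / Real.sqrt (D.t 1 u) := by
    have := h.α_sq hu
    rw [β]
    field_simp at this ⊢
    linarith
  rw [mul_div_right_comm, e, ω]
  nth_rewrite 3 [← Real.sq_sqrt (h.t_pos u hu).le]
  field_simp

/-- The product `α β = k₀^{3/2}` reflects that the change of variables is symplectic up to a
constant factor; consequently the two logarithmic derivatives cancel. -/
theorem deriv_β {u : ℝ} (hu : u ∈ Icc 0 U) :
    u * deriv D.β u / D.β u + 3 / 4 - 2 * D.k u
      = -(u * deriv D.α u / D.α u + 3 / 4 - D.k u) := by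
  have h1 := Real.sqrt_pos.2 (h.k₀_pos u hu)
  have h4 := h.α_pos hu
  have hk := h.k₀_pos u hu
  have hd := ((((h.smooth_k₀.hasDerivAt hu).sqrt hk.ne').pow 3).div (h.smooth_α.hasDerivAt hu)
    h4.ne')
  have e : deriv D.β u = _ := hd.deriv
  rw [e, β, k]
  simp only [Pi.pow_apply]
  have hs : D.k₀ u = Real.sqrt (D.k₀ u) ^ 2 := (Real.sq_sqrt hk.le).symm
  generalize Real.sqrt (D.k₀ u) = s at *
  rw [hs]
  push_cast
  field_simp
  ring

end Regular

end BranchData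

namespace BranchData

theorem n_zero (D : BranchData) (u : ℝ) : D.n 0 u = u * D.k₀ u * hamMX D.M (u * D.k₀ u, 0, u) := by
  simp [n, taylorCoeffFst_zero, modelMX, θ]

theorem n_at_zero (D : BranchData) (j : ℕ) : D.n j 0 = 0 := by
  have e : (fun x : ℝ => modelMX D.M (0, x, D.θ 0)) = fun _ => 0 := by
    funext x; simp [modelMX, θ]
  rw [n, taylorCoeffFst_eq_iteratedDeriv, e]
  simp

theorem t_one (D : BranchData)
    (hV : ContDiff ℝ ((⊤ : ℕ∞) : WithTop ℕ∞) (fun p : ℝ × ℝ => D.V p.1 p.2)) (u : ℝ) :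
    D.t 1 u = 4 * deriv (fun X => X * hamE D.V (X, u)) (u * D.k₀ u) := by
  rw [t, taylorCoeffFst_one]
  set K := u * D.k₀ u with hK
  have h1 := hasDerivAt_partialFst (contDiff_hamE hV) K u
  have h1' : HasDerivAt (fun X => hamE D.V (X, u)) (partialFst (hamE D.V) (K, u))
      (K * (1 + 0) ^ 2) := by simpa using h1
  have h2 : HasDerivAt (fun p : ℝ => K * (1 + p) ^ 2) (2 * K) 0 := by
    refine ((((hasDerivAt_id (0 : ℝ)).const_add 1).pow 2).const_mul K).congr_deriv ?_
    simp; ring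
  have h3 := h1'.comp (0 : ℝ) h2
  have h4 := (((hasDerivAt_id (0 : ℝ)).const_add 1).const_mul 2).mul
    (((((hasDerivAt_id (0 : ℝ)).const_add 1).pow 2).mul h3).sub_const (hamE D.V (K, u)))
  have h5 := (hasDerivAt_id K).mul h1
  have e5 : deriv (fun X => X * hamE D.V (X, u)) K = _ := h5.deriv
  rw [e5]
  refine (HasDerivAt.deriv h4).trans ?_
  simp
  ring

/-- At the bifurcation the restoring force is that of the cubic equation: its expansion is
`4 p + 6 p² + 2 p³`. -/
theorem t_at_zero (D : BranchData) (hV : D.V 0 0 = 0) :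
    D.t 1 0 = 4 ∧ D.t 2 0 = 6 ∧ D.t 3 0 = 2 := by
  have e : (fun x : ℝ => modelE D.V (x, D.θ 0)) = fun x => 4 * x + 6 * x ^ 2 + 2 * x ^ 3 := by
    funext x; simp [modelE, θ, hamE, hV]; ring
  have e1 : deriv (fun x : ℝ => 4 * x + 6 * x ^ 2 + 2 * x ^ 3)
      = fun x => 4 + 12 * x + 6 * x ^ 2 := by
    funext x
    refine HasDerivAt.deriv (((((hasDerivAt_id x).const_mul 4).add
      ((hasDerivAt_pow 2 x).const_mul 6)).add ((hasDerivAt_pow 3 x).const_mul 2)).congr_deriv ?_)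
    push_cast; ring
  have e2 : deriv (fun x : ℝ => 4 + 12 * x + 6 * x ^ 2) = fun x => 12 + 12 * x := by
    funext x
    refine HasDerivAt.deriv (((((hasDerivAt_id x).const_mul 12).const_add 4).add
      ((hasDerivAt_pow 2 x).const_mul 6)).congr_deriv ?_)
    push_cast; ring
  have e3 : deriv (fun x : ℝ => 12 + 12 * x) = fun _ => 12 := by
    funext x
    refine HasDerivAt.deriv ((((hasDerivAt_id x).const_mul 12).const_add 12).congr_deriv ?_)
    ring
  refine ⟨?_, ?_, ?_⟩
  · rw [t, taylorCoeffFst_eq_iteratedDeriv, e, iteratedDeriv_one, e1]; simp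
  · rw [t, taylorCoeffFst_eq_iteratedDeriv, e, iteratedDeriv_succ, iteratedDeriv_one, e1, e2]
    norm_num
  · rw [t, taylorCoeffFst_eq_iteratedDeriv, e, iteratedDeriv_succ, iteratedDeriv_succ,
      iteratedDeriv_one, e1, e2, e3]
    norm_num [Nat.factorial]

namespace Regular

variable {D : BranchData} {U : ℝ} (h : D.Regular U)
include h

/-- Both sides come from the same mixed term of the Hamiltonian. -/
theorem m₁_eq (u : ℝ) : D.m₁ u = 2 * D.n 0 u := by
  rw [D.n_zero, m₁, taylorCoeffFst_one]
  set K := u * D.k₀ u with hK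
  have h1 : HasDerivAt (fun X => D.M X 0 u) (hamMX D.M (K, 0, u)) (K * (1 + 0) ^ 2) := by
    have : HasDerivAt (fun X => D.M X 0 u) (hamMX D.M (K, 0, u)) K :=
      hasDerivAt_partialFst h.smooth_M K (0, u)
    simpa using this
  have h2 : HasDerivAt (fun p : ℝ => K * (1 + p) ^ 2) (2 * K) 0 := by
    refine ((((hasDerivAt_id (0 : ℝ)).const_add 1).pow 2).const_mul K).congr_deriv ?_
    simp; ring
  have h3 := ((h1.comp (0 : ℝ) h2).const_add 1)
  have e : (fun x => modelY D.M (0, x, D.θ u))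
      = fun x => 1 + ((fun X => D.M X 0 u) ∘ fun p : ℝ => K * (1 + p) ^ 2) x := by
    funext x
    simp [modelY, hamY, θ, hK]
  rw [e]
  refine h3.deriv.trans (by ring)

theorem m_zero : D.m 0 = 1 := by rw [m_eq]; simp [h.M_zero]

theorem m₂_zero : D.m₂ 0 = 0 := by
  have e : (fun x : ℝ => modelY D.M (0, x, D.θ 0)) = fun _ => 1 := by
    funext x; simp [modelY, hamY, θ, h.M_zero]
  rw [m₂, taylorCoeffFst_eq_iteratedDeriv, e]
  simp [iteratedDeriv_const]

theorem m₃_zero : D.m₃ 0 = 0 := by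
  have e : (fun x : ℝ => modelY D.M (x, 0, D.θ 0)) = fun _ => 1 := by
    funext x; simp [modelY, hamY, θ, h.M_zero]
  rw [m₃, taylorCoeffFst_one, e]
  simp

theorem ω_zero : D.ω 0 = Real.sqrt 2 := by
  have h4 : Real.sqrt 4 = 2 := by
    rw [show (4 : ℝ) = 2 ^ 2 by norm_num]; exact Real.sqrt_sq zero_le_two
  rw [ω, h.k₀_zero, (D.t_at_zero h.V_zero).1, h.m_zero, h4, Real.sqrt_one, mul_one,
    ← Real.sqrt_sq zero_le_two,
    ← Real.sqrt_mul (by norm_num)]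
  norm_num

theorem γ_zero (hU : 0 ≤ U) : D.coeffs.γ 0 = 3 / 2 := by
  have hmem : (0 : ℝ) ∈ Icc 0 U := ⟨le_rfl, hU⟩
  have hα := h.α_pos hmem
  have hα2 := h.α_sq hmem
  obtain ⟨e1, e2, e3⟩ := D.t_at_zero h.V_zero
  have h2 := Real.sq_sqrt (zero_le_two (α := ℝ))
  have h4 : Real.sqrt 4 = 2 := by
    rw [show (4 : ℝ) = 2 ^ 2 by norm_num]; exact Real.sqrt_sq zero_le_two
  have hs : 0 < Real.sqrt 2 := Real.sqrt_pos.2 zero_lt_two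
  have hh : Real.sqrt (1 / 2) = Real.sqrt 2 / 2 := by
    rw [Real.sqrt_div zero_le_one, Real.sqrt_one]
    field_simp
    exact h2.symm
  have hα2' : D.α 0 ^ 2 = Real.sqrt 2 / 2 := by
    rw [hα2, h.k₀_zero, e1, h.m_zero, h4, Real.sqrt_one, hh]
    have : Real.sqrt 2 ^ 3 = 2 * Real.sqrt 2 := by rw [pow_succ, h2]
    rw [div_pow, this]
    ring
  have hω : D.coeffs.ω 0 = Real.sqrt 2 := h.ω_zero
  have d1 : D.d₁ 0 = 6 / (4 * D.α 0) := by rw [d₁, e1, e2]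
  have d2 : D.d₂ 0 = 0 := by rw [d₂, D.n_at_zero]; simp
  have d3 : D.d₃ 0 = 2 / (4 * D.α 0 ^ 2) := by rw [d₃, e1, e3]
  have d4 : D.d₄ 0 = 0 := by rw [d₄, D.n_at_zero]; simp
  have a2 : D.a₂ 0 = 0 := by rw [a₂, h.m₂_zero]; simp
  have a3 : D.a₃ 0 = 0 := by rw [a₃, h.m₃_zero]; simp
  have e : D.coeffs.γ 0 = D.coeffs.ω 0 * (3 / (4 * D.α 0 ^ 2)) := by
    simp only [OscCoeffs.γ, coeffs, d1, d2, d3, d4, a2, a3]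
    field_simp
    ring
  rw [e, hω, hα2']
  field_simp
  norm_num

end Regular

end BranchData

/-- The conversion of the truncated equations from `P`, `Q` to `z = P + i Q`. -/
theorem OscCoeffs.field_eq_real (D : BranchData) (E u P Q : ℝ) :
    D.coeffs.field E u (P + Q * Complex.I)
      = D.ω u * (E⁻¹ ^ 2 * Q + E⁻¹ * (2 * D.d₂ u * P * Q - D.coeffs.B u)
          + (D.a₂ u * P ^ 2 * Q + D.a₃ u * Q ^ 3 + D.coeffs.l u * P) : ℝ)
        - Complex.I * (D.ω u * (E⁻¹ ^ 2 * P + E⁻¹ * (D.d₁ u * P ^ 2 + D.d₂ u * Q ^ 2)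
          + (D.d₃ u * P ^ 3 + D.d₄ u * P * Q ^ 2 + D.coeffs.l u * Q) : ℝ)) := by
  have hst : star ((P : ℂ) + Q * Complex.I) = P - Q * Complex.I := by
    simp [sub_eq_add_neg]
  have hω : D.coeffs.ω u = D.ω u := rfl
  have ha : D.coeffs.a u = -(1 / 4) * (D.d₁ u + D.d₂ u) := rfl
  have hc : D.coeffs.c u = 1 / 4 * (3 * D.d₂ u - D.d₁ u) := rfl
  have h30 : D.coeffs.c30 u = 1 / 8 * (D.a₃ u - D.a₂ u - D.d₃ u + D.d₄ u) := rfl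
  have h21 : D.coeffs.c21 u = 1 / 8 * (-D.a₂ u - 3 * D.a₃ u - 3 * D.d₃ u - D.d₄ u) := rfl
  have h12 : D.coeffs.c12 u = 1 / 8 * (D.a₂ u + 3 * D.a₃ u - 3 * D.d₃ u - D.d₄ u) := rfl
  have h03 : D.coeffs.c03 u = 1 / 8 * (D.a₂ u - D.a₃ u - D.d₃ u + D.d₄ u) := rfl
  rw [OscCoeffs.field, hst, hω, ha, hc, h30, h21, h12, h03]
  generalize D.coeffs.B u = B
  generalize D.coeffs.l u = l
  have i2 := Complex.I_sq
  have i3 : Complex.I ^ 3 = -Complex.I := Complex.I_pow_three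
  have i4 : Complex.I ^ 4 = 1 := Complex.I_pow_four
  push_cast
  ring_nf
  simp only [i2, i3, i4]
  ring

/-! ### The system in rescaled variables -/

namespace BranchData

variable (D : BranchData)

/-- The rescaled variable `z = P + i Q`, where `P = α p / E`, `Q = β q / E` and
`x = κ (1 + p)`, `y = κ² q`, `κ² = u k₀(u)`. -/
def zVar (ε : ℝ) (x y : ℝ → ℝ) (u : ℝ) : ℂ :=
  ((D.α u / smallE ε u * (x u / Real.sqrt (u * D.k₀ u) - 1) : ℝ) : ℂ)
    + ((D.β u / smallE ε u * (y u / (u * D.k₀ u)) : ℝ) : ℂ) * Complex.I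

theorem zVar_re (ε : ℝ) (x y : ℝ → ℝ) (u : ℝ) :
    (D.zVar ε x y u).re = D.α u / smallE ε u * (x u / Real.sqrt (u * D.k₀ u) - 1) := by
  simp only [zVar, Complex.add_re, Complex.mul_re, Complex.ofReal_re, Complex.ofReal_im,
    Complex.I_re, Complex.I_im]
  ring

theorem zVar_im (ε : ℝ) (x y : ℝ → ℝ) (u : ℝ) :
    (D.zVar ε x y u).im = D.β u / smallE ε u * (y u / (u * D.k₀ u)) := by
  simp only [zVar, Complex.add_im, Complex.mul_im, Complex.ofReal_re, Complex.ofReal_im,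
    Complex.I_re, Complex.I_im]
  ring

/-- The right-hand side of the equation for `x`, with the phase as time. -/
def fieldX (ε u x y : ℝ) : ℝ := ε⁻¹ * (y * hamY D.M (x ^ 2, y ^ 2, u))

/-- The right-hand side of the equation for `y`, with the phase as time; `f(u)/2` is expressed by
the branch. -/
def fieldY (ε u x y : ℝ) : ℝ :=
  -(ε⁻¹ * (2 * x * (x ^ 2 * hamE D.V (x ^ 2, u) - u * D.k₀ u * hamE D.V (u * D.k₀ u, u)
    + y ^ 2 / 2 * hamMX D.M (x ^ 2, y ^ 2, u))))

theorem inv_smallE_sq {ε u : ℝ} (hε : 0 < ε) (hu : 0 < u) :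
    (smallE ε u)⁻¹ ^ 2 = ε⁻¹ * (u * Real.sqrt u) := by
  rw [smallE, inv_pow, mul_pow, Real.sq_sqrt hε.le, mul_inv,
    ← Real.rpow_natCast, ← Real.rpow_mul hu.le, ← Real.rpow_neg hu.le]
  congr 1
  rw [Real.sqrt_eq_rpow]
  nth_rewrite 2 [← Real.rpow_one u]
  rw [← Real.rpow_add hu]
  norm_num

namespace Regular

variable {D} {U : ℝ} (h : D.Regular U)
include h

/-- The exact equations for the rescaled variables. -/
theorem hasDerivWithinAt_zVar {ε u : ℝ} (hε : 0 < ε) (hu : u ∈ Ioc 0 U) {s : Set ℝ} {x y : ℝ → ℝ}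
    (hx : HasDerivWithinAt x (D.fieldX ε u (x u) (y u)) s u)
    (hy : HasDerivWithinAt y (D.fieldY ε u (x u) (y u)) s u) :
    ∃ P' Q' : ℝ, HasDerivWithinAt (D.zVar ε x y) ((P' : ℂ) + Q' * Complex.I) s u ∧
      ∀ P Q p q E l, E = smallE ε u → P = (D.zVar ε x y u).re → Q = (D.zVar ε x y u).im →
        p = E * P / D.α u → q = E * Q / D.β u → l = u * deriv D.α u / D.α u + 3 / 4 - D.k u →
        u * P' = l * P + D.α u * Real.sqrt (D.k₀ u) / D.β u * E⁻¹ ^ 2 * Q *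
            modelY D.M (q ^ 2, p, D.θ u) - D.k u * D.α u * E⁻¹ ∧
        u * Q' = -(l * Q) - D.β u * Real.sqrt (D.k₀ u) * E⁻¹ ^ 3 *
            (modelE D.V (p, D.θ u) + q ^ 2 * modelMX D.M (q ^ 2, p, D.θ u)) := by
  have hu' : u ∈ Icc 0 U := ⟨hu.1.le, hu.2⟩
  have hk := h.k₀_pos u hu'
  have hK : 0 < u * D.k₀ u := mul_pos hu.1 hk
  have hE := smallE_pos hε hu.1
  have hα := h.α_pos hu'
  have hβ := h.β_pos hu'
  have hu0 := hu.1
  have dK : HasDerivAt (fun u => u * D.k₀ u) (1 * D.k₀ u + u * deriv D.k₀ u) u :=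
    (hasDerivAt_id u).mul (h.smooth_k₀.hasDerivAt hu')
  have dκ := dK.sqrt hK.ne'
  have dE := hasDerivAt_smallE (ε := ε) hu.1
  have dα := (h.smooth_α.hasDerivAt hu').div dE hE.ne'
  have dβ := (h.smooth_β.hasDerivAt hu').div dE hE.ne'
  have hs := Real.sqrt_pos.2 hK
  have dP := dα.hasDerivWithinAt (s := s) |>.mul ((hx.div dκ.hasDerivWithinAt hs.ne').sub_const 1)
  have dQ := dβ.hasDerivWithinAt (s := s) |>.mul (hy.div dK.hasDerivWithinAt hK.ne')
  refine ⟨_, _, dP.ofReal_comp.add (dQ.ofReal_comp.mul_const Complex.I), ?_⟩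
  rintro P Q p q E l rfl hP hQ hp hq rfl
  have hp' : x u = Real.sqrt (u * D.k₀ u) * (1 + p) := by
    rw [hp, hP, zVar_re]
    field_simp
    ring
  have hq' : y u = u * D.k₀ u * q := by
    rw [hq, hQ, zVar_im]
    field_simp
  have hP' : P = D.α u / smallE ε u * p := by rw [hp]; field_simp
  have hQ' : Q = D.β u / smallE ε u * q := by rw [hq]; field_simp
  have hX : x u ^ 2 = u * D.k₀ u * (1 + p) ^ 2 := by
    rw [hp', mul_pow, Real.sq_sqrt hK.le]
  have hY : y u ^ 2 = (u * D.k₀ u) ^ 2 * q ^ 2 := by rw [hq', mul_pow]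
  have hsq : (smallE ε u)⁻¹ ^ 2 = ε⁻¹ * (u * Real.sqrt u) := inv_smallE_sq hε hu.1
  have hκ : Real.sqrt (u * D.k₀ u) = Real.sqrt u * Real.sqrt (D.k₀ u) := Real.sqrt_mul hu.1.le _
  have hsu := Real.sq_sqrt hu.1.le
  have hsk := Real.sq_sqrt hk.le
  have hsu0 := Real.sqrt_pos.2 hu.1
  have hsk0 := Real.sqrt_pos.2 hk
  have hβd := h.deriv_β hu'
  constructor
  · simp only [fieldX, hX, hY, modelY, θ, Pi.div_apply]
    generalize hamY D.M (u * D.k₀ u * (1 + p) ^ 2, (u * D.k₀ u) ^ 2 * q ^ 2, u) = A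
    rw [hsq, hP', hQ', hp', hq', k, hκ]
    generalize smallE ε u = E at *
    generalize deriv D.α u = α'
    generalize deriv D.k₀ u = k'
    generalize D.β u = β' at *
    generalize D.α u = α at *
    have ek : D.k₀ u = Real.sqrt (D.k₀ u) ^ 2 := hsk.symm
    have eu : u = Real.sqrt u ^ 2 := hsu.symm
    generalize Real.sqrt (D.k₀ u) = sk at *
    generalize Real.sqrt u = su at *
    rw [ek, eu]
    field_simp
    ring
  · have hsq3 : (smallE ε u)⁻¹ ^ 3 = (smallE ε u)⁻¹ * (ε⁻¹ * (u * Real.sqrt u)) := by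
      rw [pow_succ, hsq, mul_comm]
    have e1 : modelE D.V (p, D.θ u) + q ^ 2 * modelMX D.M (q ^ 2, p, D.θ u)
        = 2 * (1 + p) * ((1 + p) ^ 2 * hamE D.V (u * D.k₀ u * (1 + p) ^ 2, u)
          - hamE D.V (u * D.k₀ u, u) + u * D.k₀ u * q ^ 2 / 2 *
            hamMX D.M (u * D.k₀ u * (1 + p) ^ 2, (u * D.k₀ u) ^ 2 * q ^ 2, u)) := by
      simp only [modelE, modelMX, θ]
      ring
    rw [e1, hsq3, ← neg_mul, ← hβd]
    simp only [fieldY, hX, hY, Pi.div_apply]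
    generalize hamMX D.M (u * D.k₀ u * (1 + p) ^ 2, (u * D.k₀ u) ^ 2 * q ^ 2, u) = A
    generalize hamE D.V (u * D.k₀ u * (1 + p) ^ 2, u) = A'
    generalize hamE D.V (u * D.k₀ u, u) = A''
    rw [hQ', hp', hq', k, hκ]
    generalize smallE ε u = E at *
    generalize deriv D.β u = α'
    generalize deriv D.k₀ u = k'
    generalize D.β u = β' at *
    have ek : D.k₀ u = Real.sqrt (D.k₀ u) ^ 2 := hsk.symm
    have eu : u = Real.sqrt u ^ 2 := hsu.symm
    generalize Real.sqrt (D.k₀ u) = sk at *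
    generalize Real.sqrt u = su at *
    rw [ek, eu]
    field_simp
    ring

end Regular

end BranchData

namespace BranchData

namespace Regular

variable {D : BranchData} {U : ℝ} (h : D.Regular U)
include h

/-- The rescaled variable solves the truncated system up to an error of order `E`. -/
theorem exists_field_estimate (Z : ℝ) : ∃ R₀ r, 0 < R₀ ∧ 0 < r ∧ r ≤ 1 ∧
    ∀ ε u, 0 < ε → u ∈ Ioc 0 U → smallE ε u ≤ r → ∀ (s : Set ℝ) (x y : ℝ → ℝ),
      HasDerivWithinAt x (D.fieldX ε u (x u) (y u)) s u →
      HasDerivWithinAt y (D.fieldY ε u (x u) (y u)) s u → ‖D.zVar ε x y u‖ ≤ Z →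
      ∃ z' : ℂ, HasDerivWithinAt (D.zVar ε x y) z' s u ∧
        ‖u * z' - D.coeffs.field (smallE ε u) u (D.zVar ε x y u)‖ ≤ R₀ * smallE ε u := by
  have hSc : IsCompact (D.θ '' Icc 0 U) := isCompact_Icc.image_of_continuousOn
    fun u hu => (h.smooth_θ u hu).continuousAt.continuousWithinAt
  obtain ⟨CA, hCA, kA⟩ := exists_taylor_bound_even (contDiff_modelY h.smooth_M) hSc
  obtain ⟨CB, hCB, kB⟩ := exists_taylor_bound (contDiff_modelE h.smooth_V) hSc 4
  obtain ⟨CN, hCN, kN⟩ := exists_taylor_bound_mixed (contDiff_modelMX h.smooth_M) hSc 2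
  obtain ⟨α₀, hα₀, kα⟩ := h.smooth_α.exists_lower_bound fun u hu => h.α_pos hu
  obtain ⟨β₀, hβ₀, kβ⟩ := h.smooth_β.exists_lower_bound fun u hu => h.β_pos hu
  obtain ⟨C1, hC1, k1⟩ := ((h.smooth_α.mul (h.smooth_k₀.sqrt h.k₀_pos)).div h.smooth_β
    fun u hu => (h.β_pos hu).ne').exists_bound
  obtain ⟨C2, hC2, k2⟩ := (h.smooth_β.mul (h.smooth_k₀.sqrt h.k₀_pos)).exists_bound
  set c := |Z| / α₀ + |Z| / β₀ + 1 with hc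
  have hZα : 0 ≤ |Z| / α₀ := by positivity
  have hZβ : 0 ≤ |Z| / β₀ := by positivity
  have hc1 : 1 ≤ c := by linarith
  have hc0 : 0 < c := by positivity
  refine ⟨C1 * |Z| * (CA * c ^ 3) + C2 * (CB * c ^ 4 + c ^ 2 * (CN * (c ^ 2 + c ^ 2))), c⁻¹,
    by positivity, by positivity, inv_le_one_of_one_le₀ hc1, fun ε u hε hu hEr s x y hx hy hz => ?_⟩
  have hu' : u ∈ Icc 0 U := ⟨hu.1.le, hu.2⟩
  obtain ⟨P', Q', hd, heq⟩ := h.hasDerivWithinAt_zVar hε hu hx hy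
  refine ⟨_, hd, ?_⟩
  set E := smallE ε u with hEdef
  have hE : 0 < E := smallE_pos hε hu.1
  set P := (D.zVar ε x y u).re with hP
  set Q := (D.zVar ε x y u).im with hQ
  have hzPQ : D.zVar ε x y u = (P : ℂ) + Q * Complex.I := (Complex.re_add_im _).symm
  have hPZ : |P| ≤ |Z| := (Complex.abs_re_le_norm _).trans (hz.trans (le_abs_self Z))
  have hQZ : |Q| ≤ |Z| := (Complex.abs_im_le_norm _).trans (hz.trans (le_abs_self Z))
  have hα := h.α_pos hu'
  have hβ := h.β_pos hu'
  have hm := h.m_pos u hu'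
  have ht := h.t_pos u hu'
  have hω := h.ω_pos hu'
  have hsk := Real.sqrt_pos.2 (h.k₀_pos u hu')
  obtain ⟨p, hp⟩ : ∃ p, p = E * P / D.α u := ⟨_, rfl⟩
  obtain ⟨q, hq⟩ : ∃ q, q = E * Q / D.β u := ⟨_, rfl⟩
  obtain ⟨eP, eQ⟩ := heq P Q p q E _ rfl rfl rfl hp hq rfl
  have hpb : |p| ≤ E * (|Z| / α₀) := by
    rw [hp, abs_div, abs_mul, abs_of_pos hE, abs_of_pos hα, mul_div_assoc]
    gcongr
    exact kα u hu'
  have hqb : |q| ≤ E * (|Z| / β₀) := by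
    rw [hq, abs_div, abs_mul, abs_of_pos hE, abs_of_pos hβ, mul_div_assoc]
    gcongr
    exact kβ u hu'
  have hpq : |p| + |q| ≤ c * E := by rw [hc]; linarith
  have hcE : c * E ≤ 1 := by
    have := mul_le_mul_of_nonneg_left hEr hc0.le
    rwa [mul_inv_cancel₀ hc0.ne'] at this
  have hp1 : |p| ≤ c * E := by linarith [abs_nonneg q]
  have hq1 : |q| ≤ c * E := by linarith [abs_nonneg p]
  have hq2 : |q ^ 2| ≤ (c * E) ^ 2 := by
    rw [abs_pow]; exact pow_le_pow_left₀ (abs_nonneg _) hq1 2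
  have hθ : D.θ u ∈ D.θ '' Icc 0 U := mem_image_of_mem _ hu'
  have bA := (kA _ hθ p q (hp1.trans hcE) (hq1.trans hcE)).trans
    (mul_le_mul_of_nonneg_left (pow_le_pow_left₀ (by positivity) hpq 3) hCA.le)
  have bB := (kB _ hθ p (hp1.trans hcE)).trans
    (mul_le_mul_of_nonneg_left (pow_le_pow_left₀ (abs_nonneg _) hp1 4) hCB.le)
  have bN := (kN _ hθ p (q ^ 2) (hp1.trans hcE)
    (hq2.trans (pow_le_one₀ (by positivity) hcE))).trans
    (mul_le_mul_of_nonneg_left (add_le_add (pow_le_pow_left₀ (abs_nonneg _) hp1 2) hq2) hCN.le)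
  have t0 : taylorCoeffFst (modelE D.V) 0 (D.θ u) = 0 := by
    simp [taylorCoeffFst_zero, modelE]
  simp only [Finset.sum_range_succ, Finset.range_zero, Finset.sum_empty, zero_add, pow_zero, mul_one,
    pow_one, t0] at bB bN
  change |modelY D.M (q ^ 2, p, D.θ u) - (D.m u + D.m₁ u * p + D.m₂ u * p ^ 2 + D.m₃ u * q ^ 2)|
    ≤ _ at bA
  change |modelE D.V (p, D.θ u) - (D.t 1 u * p + D.t 2 u * p ^ 2 + D.t 3 u * p ^ 3)| ≤ _ at bB
  change |modelMX D.M (q ^ 2, p, D.θ u) - (D.n 0 u + D.n 1 u * p)| ≤ _ at bN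
  rw [h.m₁_eq] at bA
  generalize modelY D.M (q ^ 2, p, D.θ u) = A at *
  generalize modelE D.V (p, D.θ u) = B at *
  generalize modelMX D.M (q ^ 2, p, D.θ u) = G at *
  have k1' := k1 u hu'
  have k2' := k2 u hu'
  have eω1 := h.ω_div_m hu'
  have eω2 := h.ω_div_t hu'
  have el : D.ω u * D.coeffs.l u = u * deriv D.α u / D.α u + 3 / 4 - D.k u := by
    simp only [coeffs]; field_simp
  have eB : D.ω u * D.coeffs.B u = D.k u * D.α u := by
    simp only [coeffs]; field_simp
  have ed1 : D.ω u * D.d₁ u = D.β u * Real.sqrt (D.k₀ u) * D.t 2 u / D.α u ^ 2 := by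
    rw [eω2, d₁]; field_simp
  have ed2 : D.ω u * D.d₂ u = Real.sqrt (D.k₀ u) * D.n 0 u / D.β u := by
    rw [eω2, d₂]; field_simp
  have ed3 : D.ω u * D.d₃ u = D.β u * Real.sqrt (D.k₀ u) * D.t 3 u / D.α u ^ 3 := by
    rw [eω2, d₃]; field_simp
  have ed4 : D.ω u * D.d₄ u = Real.sqrt (D.k₀ u) * D.n 1 u / (D.α u * D.β u) := by
    rw [eω2, d₄]; field_simp
  have ea2 : D.ω u * D.a₂ u = Real.sqrt (D.k₀ u) * D.m₂ u / (D.α u * D.β u) := by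
    rw [eω1, a₂]; field_simp
  have ea3 : D.ω u * D.a₃ u = D.α u * Real.sqrt (D.k₀ u) * D.m₃ u / D.β u ^ 3 := by
    rw [eω1, a₃]; field_simp
  rw [← el] at eP eQ
  -- the errors of the two equations are the Taylor remainders
  have rP : u * P' - D.ω u * (E⁻¹ ^ 2 * Q + E⁻¹ * (2 * D.d₂ u * P * Q - D.coeffs.B u)
      + (D.a₂ u * P ^ 2 * Q + D.a₃ u * Q ^ 3 + D.coeffs.l u * P))
      = D.α u * Real.sqrt (D.k₀ u) / D.β u * Q * (E⁻¹ ^ 2 * (A - (D.m u + 2 * D.n 0 u * p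
        + D.m₂ u * p ^ 2 + D.m₃ u * q ^ 2))) := by
    have e : D.ω u * (E⁻¹ ^ 2 * Q + E⁻¹ * (2 * D.d₂ u * P * Q - D.coeffs.B u)
        + (D.a₂ u * P ^ 2 * Q + D.a₃ u * Q ^ 3 + D.coeffs.l u * P))
        = D.ω u * E⁻¹ ^ 2 * Q + E⁻¹ * (2 * (D.ω u * D.d₂ u) * P * Q - D.ω u * D.coeffs.B u)
          + (D.ω u * D.a₂ u * P ^ 2 * Q + D.ω u * D.a₃ u * Q ^ 3 + D.ω u * D.coeffs.l u * P) := by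
      ring
    rw [e, eP, ed2, ea2, ea3, eB, hp, hq, eω1]
    field_simp
    ring
  have rQ : u * Q' + D.ω u * (E⁻¹ ^ 2 * P + E⁻¹ * (D.d₁ u * P ^ 2 + D.d₂ u * Q ^ 2)
      + (D.d₃ u * P ^ 3 + D.d₄ u * P * Q ^ 2 + D.coeffs.l u * Q))
      = -(D.β u * Real.sqrt (D.k₀ u) * (E⁻¹ ^ 3 *
        ((B - (D.t 1 u * p + D.t 2 u * p ^ 2 + D.t 3 u * p ^ 3))
          + q ^ 2 * (G - (D.n 0 u + D.n 1 u * p))))) := by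
    have e : D.ω u * (E⁻¹ ^ 2 * P + E⁻¹ * (D.d₁ u * P ^ 2 + D.d₂ u * Q ^ 2)
        + (D.d₃ u * P ^ 3 + D.d₄ u * P * Q ^ 2 + D.coeffs.l u * Q))
        = D.ω u * E⁻¹ ^ 2 * P + E⁻¹ * (D.ω u * D.d₁ u * P ^ 2 + D.ω u * D.d₂ u * Q ^ 2)
          + (D.ω u * D.d₃ u * P ^ 3 + D.ω u * D.d₄ u * P * Q ^ 2 + D.ω u * D.coeffs.l u * Q) := by
      ring
    rw [e, eQ, ed1, ed2, ed3, ed4, hp, hq, eω2]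
    field_simp
    ring
  have hEi : 0 ≤ E⁻¹ := (inv_pos.2 hE).le
  have bP : |D.α u * Real.sqrt (D.k₀ u) / D.β u * Q * (E⁻¹ ^ 2 * (A - (D.m u + 2 * D.n 0 u * p
        + D.m₂ u * p ^ 2 + D.m₃ u * q ^ 2)))| ≤ C1 * |Z| * (CA * c ^ 3) * E := by
    rw [abs_mul, abs_mul, abs_mul, abs_of_nonneg (pow_nonneg hEi 2)]
    calc _ ≤ C1 * |Z| * (E⁻¹ ^ 2 * (CA * (c * E) ^ 3)) := by gcongr
      _ = _ := by field_simp
  have bQ : |D.β u * Real.sqrt (D.k₀ u) * (E⁻¹ ^ 3 *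
        ((B - (D.t 1 u * p + D.t 2 u * p ^ 2 + D.t 3 u * p ^ 3))
          + q ^ 2 * (G - (D.n 0 u + D.n 1 u * p))))|
      ≤ C2 * (CB * c ^ 4 + c ^ 2 * (CN * (c ^ 2 + c ^ 2))) * E := by
    have b3 : |(B - (D.t 1 u * p + D.t 2 u * p ^ 2 + D.t 3 u * p ^ 3))
          + q ^ 2 * (G - (D.n 0 u + D.n 1 u * p))|
        ≤ CB * (c * E) ^ 4 + (c * E) ^ 2 * (CN * ((c * E) ^ 2 + (c * E) ^ 2)) := by
      refine (abs_add_le _ _).trans (add_le_add bB ?_)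
      rw [abs_mul]
      exact mul_le_mul hq2 bN (abs_nonneg _) (by positivity)
    rw [abs_mul (D.β u * _), abs_mul (E⁻¹ ^ 3), abs_of_nonneg (pow_nonneg hEi 3)]
    calc _ ≤ C2 * (E⁻¹ ^ 3 * (CB * (c * E) ^ 4
          + (c * E) ^ 2 * (CN * ((c * E) ^ 2 + (c * E) ^ 2)))) := by gcongr
      _ = _ := by field_simp
  rw [hzPQ, OscCoeffs.field_eq_real]
  have e : (u : ℂ) * ((P' : ℂ) + Q' * Complex.I)
      - (D.ω u * (E⁻¹ ^ 2 * Q + E⁻¹ * (2 * D.d₂ u * P * Q - D.coeffs.B u)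
          + (D.a₂ u * P ^ 2 * Q + D.a₃ u * Q ^ 3 + D.coeffs.l u * P) : ℝ)
        - Complex.I * (D.ω u * (E⁻¹ ^ 2 * P + E⁻¹ * (D.d₁ u * P ^ 2 + D.d₂ u * Q ^ 2)
          + (D.d₃ u * P ^ 3 + D.d₄ u * P * Q ^ 2 + D.coeffs.l u * Q) : ℝ)))
      = ((u * P' - D.ω u * (E⁻¹ ^ 2 * Q + E⁻¹ * (2 * D.d₂ u * P * Q - D.coeffs.B u)
          + (D.a₂ u * P ^ 2 * Q + D.a₃ u * Q ^ 3 + D.coeffs.l u * P)) : ℝ) : ℂ)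
        + ((u * Q' + D.ω u * (E⁻¹ ^ 2 * P + E⁻¹ * (D.d₁ u * P ^ 2 + D.d₂ u * Q ^ 2)
          + (D.d₃ u * P ^ 3 + D.d₄ u * P * Q ^ 2 + D.coeffs.l u * Q)) : ℝ) : ℂ) * Complex.I := by
    push_cast
    ring
  rw [e, rP, rQ]
  refine (norm_add_le _ _).trans ?_
  rw [norm_mul, Complex.norm_I, mul_one, Complex.norm_real, Complex.norm_real, Real.norm_eq_abs,
    Real.norm_eq_abs, abs_neg, add_mul]
  exact add_le_add bP bQ

end Regular

end BranchData

/-! ### Orbits near the branch -/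

theorem hasDerivWithinAt_integral_of_continuousOn {g : ℝ → ℝ} {a b : ℝ} (hab : a ≤ b)
    (hg : ContinuousOn g (Icc a b)) {u : ℝ} (hu : u ∈ Icc a b) :
    HasDerivWithinAt (fun u => ∫ v in a..u, g v) (g u) (Icc a b) u := by
  have hG : Continuous (IccExtend hab ((Icc a b).domRestrict g)) := by
    rw [continuousOn_iff_continuous_domRestrict] at hg
    exact hg.Icc_extend'
  have he : ∀ v ∈ Icc a b, IccExtend hab ((Icc a b).domRestrict g) v = g v := fun v hv => by
    rw [IccExtend_of_mem _ _ hv, domRestrict_apply]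
  have hd := (hG.integral_hasStrictDerivAt a u).hasDerivAt.hasDerivWithinAt (s := Icc a b)
  rw [he u hu] at hd
  have hc : ∀ v ∈ Icc a b, (∫ w in a..v, g w)
      = ∫ w in a..v, IccExtend hab ((Icc a b).domRestrict g) w := fun v hv => by
    refine intervalIntegral.integral_congr fun w hw => (he w ?_).symm
    rw [uIcc_of_le hv.1] at hw
    exact ⟨hw.1, hw.2.trans hv.2⟩
  exact hd.congr hc (hc u hu)

theorem continuousOn_smallE (ε : ℝ) : ContinuousOn (smallE ε) (Ioi 0) := fun _ hu =>
  (hasDerivAt_smallE hu).continuousAt.continuousWithinAt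

namespace BranchData

variable (D : BranchData)

/-- The `x`-coordinate of the point at phase `u` with rescaled variable `z`. -/
def xVar (ε : ℝ) (z : ℂ) (u : ℝ) : ℝ :=
  Real.sqrt (u * D.k₀ u) * (1 + smallE ε u / D.α u * z.re)

/-- The `y`-coordinate of the point at phase `u` with rescaled variable `z`. -/
def yVar (ε : ℝ) (z : ℂ) (u : ℝ) : ℝ := u * D.k₀ u * (smallE ε u / D.β u * z.im)

/-- The angular velocity, with the phase as time, at which `z` turns clockwise when `|z| = w`. -/
def angVel (ε w u : ℝ) : ℝ :=
  (D.ω u * (smallE ε u)⁻¹ ^ 2 - D.coeffs.γ u * w ^ 2) / u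

namespace Regular

variable {D} {U : ℝ} (h : D.Regular U)
include h

theorem zVar_eq_iff {ε u : ℝ} (hε : 0 < ε) (hu : u ∈ Ioc 0 U) (x y : ℝ → ℝ) (z : ℂ) :
    D.zVar ε x y u = z ↔ x u = D.xVar ε z u ∧ y u = D.yVar ε z u := by
  have hu' : u ∈ Icc 0 U := ⟨hu.1.le, hu.2⟩
  have hK : 0 < u * D.k₀ u := mul_pos hu.1 (h.k₀_pos u hu')
  have hs := Real.sqrt_pos.2 hK
  have hE := smallE_pos hε hu.1
  have hα := h.α_pos hu'
  have hβ := h.β_pos hu'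
  have hu0 := hu.1
  have hk := h.k₀_pos u hu'
  rw [Complex.ext_iff, zVar_re, zVar_im, xVar, yVar]
  refine and_congr ⟨fun e => ?_, fun e => ?_⟩ ⟨fun e => ?_, fun e => ?_⟩
  · rw [← e]; field_simp; ring
  · rw [e]; field_simp; ring
  · rw [← e]; field_simp
  · rw [e]; field_simp

theorem continuousOn_sqrt_branch : ContinuousOn (fun u => Real.sqrt (u * D.k₀ u)) (Icc 0 U) :=
  (continuousOn_id.mul h.smooth_k₀.continuousOn).sqrt

theorem exists_orbit_bound {ε u₀ : ℝ} (hε : 0 < ε) (hu₀ : 0 < u₀) (Z : ℝ) : ∃ R, ∀ u ∈ Icc u₀ U,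
    ∀ q : ℝ × ℝ, ‖D.zVar ε (fun _ => q.1) (fun _ => q.2) u‖ ≤ Z → ‖q‖ ≤ R := by
  have hsub : Icc u₀ U ⊆ Icc 0 U := Icc_subset_Icc_left hu₀.le
  have hcE : ContinuousOn (smallE ε) (Icc u₀ U) :=
    (continuousOn_smallE ε).mono fun u hu => hu₀.trans_le hu.1
  have hc1 : ContinuousOn (fun u => Real.sqrt (u * D.k₀ u) * (1 + smallE ε u / D.α u * Z))
      (Icc u₀ U) :=
    (h.continuousOn_sqrt_branch.mono hsub).mul (continuousOn_const.add
      ((hcE.div (h.smooth_α.continuousOn.mono hsub) fun u hu => (h.α_pos (hsub hu)).ne').mul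
        continuousOn_const))
  have hc2 : ContinuousOn (fun u => u * D.k₀ u * (smallE ε u / D.β u * Z)) (Icc u₀ U) :=
    (continuousOn_id.mul (h.smooth_k₀.continuousOn.mono hsub)).mul
      ((hcE.div (h.smooth_β.continuousOn.mono hsub) fun u hu => (h.β_pos (hsub hu)).ne').mul
        continuousOn_const)
  obtain ⟨R1, k1⟩ := isCompact_Icc.exists_bound_of_continuousOn hc1
  obtain ⟨R2, k2⟩ := isCompact_Icc.exists_bound_of_continuousOn hc2
  refine ⟨max R1 R2, fun u hu q hq => ?_⟩
  have hu1 : u ∈ Ioc 0 U := ⟨hu₀.trans_le hu.1, hu.2⟩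
  have hE := smallE_pos hε hu1.1
  have hα := h.α_pos (hsub hu)
  have hβ := h.β_pos (hsub hu)
  have hK : 0 < u * D.k₀ u := mul_pos hu1.1 (h.k₀_pos u (hsub hu))
  set z := D.zVar ε (fun _ => q.1) (fun _ => q.2) u with hz
  obtain ⟨e1, e2⟩ := (h.zVar_eq_iff hε hu1 (fun _ => q.1) (fun _ => q.2) z).1 hz.symm
  have b1 := (Complex.abs_re_le_norm z).trans hq
  have b2 := (Complex.abs_im_le_norm z).trans hq
  rw [Prod.norm_def]
  refine max_le_max ?_ ?_
  · refine le_trans ?_ ((le_abs_self _).trans (k1 u hu))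
    rw [e1, xVar, Real.norm_eq_abs, abs_mul, abs_of_nonneg (Real.sqrt_nonneg _)]
    refine mul_le_mul_of_nonneg_left ((abs_add_le _ _).trans ?_) (Real.sqrt_nonneg _)
    rw [abs_one, abs_mul, abs_of_pos (div_pos hE hα)]
    gcongr
  · refine le_trans ?_ ((le_abs_self _).trans (k2 u hu))
    rw [e2, yVar, Real.norm_eq_abs, abs_mul, abs_of_pos hK, abs_mul, abs_of_pos (div_pos hE hβ)]
    gcongr

theorem continuousOn_zVar {ε u₀ : ℝ} (hε : 0 < ε) (hu₀ : 0 < u₀) :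
    ContinuousOn (fun p : ℝ × ℝ × ℝ => D.zVar ε (fun _ => p.2.1) (fun _ => p.2.2) p.1)
      (Icc u₀ U ×ˢ univ) := by
  have hsub : Icc u₀ U ⊆ Icc 0 U := Icc_subset_Icc_left hu₀.le
  have hf : MapsTo (Prod.fst : ℝ × ℝ × ℝ → ℝ) (Icc u₀ U ×ˢ univ) (Icc u₀ U) := fun p hp => hp.1
  have hf' : MapsTo (Prod.fst : ℝ × ℝ × ℝ → ℝ) (Icc u₀ U ×ˢ univ) (Icc 0 U) :=
    fun p hp => hsub hp.1
  have cE := ((continuousOn_smallE ε).mono fun u (hu : u ∈ Icc u₀ U) => hu₀.trans_le hu.1).comp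
    continuousOn_fst hf
  have cα := h.smooth_α.continuousOn.comp continuousOn_fst hf'
  have cβ := h.smooth_β.continuousOn.comp continuousOn_fst hf'
  have ck := (continuousOn_id.mul h.smooth_k₀.continuousOn).comp continuousOn_fst hf'
  have cs := h.continuousOn_sqrt_branch.comp continuousOn_fst hf'
  have hK : ∀ p ∈ Icc u₀ U ×ˢ (univ : Set (ℝ × ℝ)), 0 < p.1 * D.k₀ p.1 := fun p hp =>
    mul_pos (hu₀.trans_le hp.1.1) (h.k₀_pos _ (hf' hp))
  have hE : ∀ p ∈ Icc u₀ U ×ˢ (univ : Set (ℝ × ℝ)), smallE ε p.1 ≠ 0 := fun p hp =>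
    (smallE_pos hε (hu₀.trans_le hp.1.1)).ne'
  have c1 := (cα.div cE hE).mul (((continuousOn_snd.fst).div cs
    fun p hp => (Real.sqrt_pos.2 (hK p hp)).ne').sub (continuousOn_const (c := (1 : ℝ))))
  have c2 := (cβ.div cE hE).mul ((continuousOn_snd.snd).div ck fun p hp => (hK p hp).ne')
  exact (Complex.continuous_ofReal.comp_continuousOn c1).add
    ((Complex.continuous_ofReal.comp_continuousOn c2).mul continuousOn_const)

theorem continuousOn_angVel {ε u₀ : ℝ} (hε : 0 < ε) (hu₀ : 0 < u₀) (w : ℝ) :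
    ContinuousOn (D.angVel ε w) (Icc u₀ U) := by
  have hsub : Icc u₀ U ⊆ Icc 0 U := Icc_subset_Icc_left hu₀.le
  have hcE : ContinuousOn (smallE ε) (Icc u₀ U) :=
    (continuousOn_smallE ε).mono fun u hu => hu₀.trans_le hu.1
  exact (((h.smooth_ω.continuousOn.mono hsub).mul ((hcE.inv₀ fun u hu =>
    (smallE_pos hε (hu₀.trans_le hu.1)).ne').pow 2)).sub
    ((h.smooth_coeffs.γ.continuousOn.mono hsub).mul continuousOn_const)).div continuousOn_id
      fun u hu => (hu₀.trans_le hu.1).ne'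

/-- Orbits starting near the branch exist up to phase `U`, and in the rescaled variable they are
rotations up to a small error. The vector field is only required to agree with the system for
phases in `(0, U]`. -/
theorem exists_orbit (A : ℝ) : ∃ C r, 0 < C ∧ 0 < r ∧
    ∀ (ε u₀ : ℝ) (F : ℝ × ℝ × ℝ → ℝ × ℝ), 0 < ε → u₀ ∈ Ioc 0 U → ContDiff ℝ 1 F →
      (∀ u ∈ Ioc 0 U, ∀ x y, F (u, x, y) = (D.fieldX ε u x y, D.fieldY ε u x y)) →
      smallE ε u₀ * (1 + Real.log (U / u₀)) ≤ r → ∀ z₀ : ℂ, ‖z₀‖ ≤ A →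
      ∃ X : ℝ → ℝ × ℝ, (∀ u ∈ Icc u₀ U, HasDerivWithinAt X (F (u, X u)) (Icc u₀ U) u) ∧
        D.zVar ε (fun u => (X u).1) (fun u => (X u).2) u₀ = z₀ ∧
        ∀ u ∈ Icc u₀ U, ‖D.zVar ε (fun u => (X u).1) (fun u => (X u).2) u
          * Complex.exp (Complex.I * ((∫ v in u₀..u, D.angVel ε ‖z₀‖ v : ℝ) : ℂ)) - z₀‖
            ≤ C * (smallE ε u₀ * (1 + Real.log (U / u₀))) := by
  set Z := |A| + 1 with hZ
  obtain ⟨R₀, r, hR₀, hr, hr1, hfield⟩ := h.exists_field_estimate Z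
  obtain ⟨C, hC, hest⟩ := h.smooth_coeffs.exists_rotation_estimate R₀ Z
  refine ⟨C, min r (1 / (2 * C)), hC, by positivity, fun ε u₀ F hε hu₀ hF hFeq hsmall z₀ hz₀ => ?_⟩
  have hlog : 0 ≤ Real.log (U / u₀) := Real.log_nonneg ((one_le_div hu₀.1).2 hu₀.2)
  have hE₀ := smallE_pos hε hu₀.1
  have hEr : smallE ε u₀ ≤ r := by
    have h1 : smallE ε u₀ * 1 ≤ smallE ε u₀ * (1 + Real.log (U / u₀)) :=
      mul_le_mul_of_nonneg_left (by linarith) hE₀.le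
    rw [mul_one] at h1
    exact h1.trans (hsmall.trans (min_le_left _ _))
  have hz₀' : ‖z₀‖ ≤ |A| := hz₀.trans (le_abs_self A)
  -- the estimate on an initial segment on which the solution stays bounded
  have main : ∀ X : ℝ → ℝ × ℝ, ∀ t₁ ∈ Icc u₀ U,
      D.zVar ε (fun u => (X u).1) (fun u => (X u).2) u₀ = z₀ →
      (∀ t ∈ Icc u₀ t₁, HasDerivWithinAt X (F (t, X t)) (Icc u₀ t₁) t) →
      (∀ t ∈ Icc u₀ t₁, ‖D.zVar ε (fun u => (X u).1) (fun u => (X u).2) t‖ ≤ Z) →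
      ∀ u ∈ Icc u₀ t₁, ‖D.zVar ε (fun u => (X u).1) (fun u => (X u).2) u
          * Complex.exp (Complex.I * ((∫ v in u₀..u, D.angVel ε ‖z₀‖ v : ℝ) : ℂ)) - z₀‖
            ≤ C * (smallE ε u₀ * (1 + Real.log (U / u₀))) := by
    intro X t₁ ht₁ hX0 hX hXZ
    have hU : ∀ u ∈ Icc u₀ t₁, u ∈ Ioc 0 U := fun u hu =>
      ⟨hu₀.1.trans_le hu.1, hu.2.trans ht₁.2⟩
    have hz : ∀ u ∈ Icc u₀ t₁, ∃ z' : ℂ,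
        HasDerivWithinAt (D.zVar ε (fun u => (X u).1) (fun u => (X u).2)) z' (Icc u₀ t₁) u ∧
        ‖u * z' - D.coeffs.field (smallE ε u) u
          (D.zVar ε (fun u => (X u).1) (fun u => (X u).2) u)‖ ≤ R₀ * smallE ε u := by
      intro u hu
      have hd := hX u hu
      rw [show X u = ((X u).1, (X u).2) from rfl, hFeq u (hU u hu)] at hd
      exact hfield ε u hε (hU u hu) ((smallE_anti hu₀.1 hu.1).trans hEr) _ _ _
        hd.fst hd.snd (hXZ u hu)
    choose! z' hz1 hz2 using hz
    have hcv := (h.continuousOn_angVel hε hu₀.1 ‖z₀‖).mono (Icc_subset_Icc_right ht₁.2)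
    have := hest ε u₀ t₁ hε hu₀.1 ht₁.1 ht₁.2 (hEr.trans hr1) _ z'
      (fun u => ∫ v in u₀..u, D.angVel ε ‖z₀‖ v) hz1 hXZ hz2 (by simp) (fun u hu => by
        rw [hX0]
        exact hasDerivWithinAt_integral_of_continuousOn ht₁.1 hcv hu)
    rw [hX0] at this
    exact this
  obtain ⟨R, hR⟩ := h.exists_orbit_bound hε hu₀.1 Z
  have hinit := (h.zVar_eq_iff hε hu₀ (fun _ => D.xVar ε z₀ u₀) (fun _ => D.yVar ε z₀ u₀) z₀).2
    ⟨rfl, rfl⟩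
  obtain ⟨X, hX0, hX, hXZ⟩ := exists_solution_of_apriori hF hu₀.2 (D.xVar ε z₀ u₀, D.yVar ε z₀ u₀)
    (ρ := fun t q => ‖D.zVar ε (fun _ => q.1) (fun _ => q.2) t‖) (Z := Z) (R := R)
    (h.continuousOn_zVar hε hu₀.1).norm hR (by rw [hinit]; linarith)
    (fun X hX0 t₁ ht₁ hX hXZ => by
      have h0 : D.zVar ε (fun u => (X u).1) (fun u => (X u).2) u₀ = z₀ :=
        (h.zVar_eq_iff hε hu₀ _ _ z₀).2 ⟨by rw [hX0], by rw [hX0]⟩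
      have h1 := main X t₁ ht₁ h0 hX hXZ t₁ ⟨ht₁.1, le_rfl⟩
      have h2 : C * (smallE ε u₀ * (1 + Real.log (U / u₀))) ≤ 1 / 2 := by
        have := mul_le_mul_of_nonneg_left (hsmall.trans (min_le_right _ _)) hC.le
        refine this.trans (le_of_eq ?_)
        field_simp
      have h3 : ‖Complex.exp (Complex.I * ((∫ v in u₀..t₁, D.angVel ε ‖z₀‖ v : ℝ) : ℂ))‖ = 1 := by
        rw [mul_comm]; exact Complex.norm_exp_ofReal_mul_I _
      have h4 := norm_le_norm_add_norm_sub' (D.zVar ε (fun u => (X u).1) (fun u => (X u).2) t₁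
          * Complex.exp (Complex.I * ((∫ v in u₀..t₁, D.angVel ε ‖z₀‖ v : ℝ) : ℂ))) z₀
      rw [norm_mul, h3, mul_one] at h4
      change ‖D.zVar ε (fun u => (X u).1) (fun u => (X u).2) t₁‖ < Z
      linarith)
  have h0 : D.zVar ε (fun u => (X u).1) (fun u => (X u).2) u₀ = z₀ :=
    (h.zVar_eq_iff hε hu₀ _ _ z₀).2 ⟨by rw [hX0], by rw [hX0]⟩
  exact ⟨X, hX, h0, main X U ⟨hu₀.2, le_rfl⟩ h0 hX hXZ⟩

end Regular

end BranchData

/-! ### The slow-fast system in the notation of the branch -/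

theorem muScale_pos {ε δ : ℝ} (hε : 0 < ε) (hδ : 0 < δ) : 0 < muScale ε δ :=
  mul_pos (Real.rpow_pos_of_pos hε _) (Real.rpow_pos_of_pos hδ _)

theorem muScale_pow_three {ε δ : ℝ} (hε : 0 < ε) (hδ : 0 < δ) :
    muScale ε δ ^ 3 * (δ ^ (3 / 4 : ℝ)) ^ 2 = ε := by
  rw [muScale, mul_pow, ← Real.rpow_natCast, ← Real.rpow_natCast, ← Real.rpow_natCast,
    ← Real.rpow_mul hε.le, ← Real.rpow_mul hδ.le, ← Real.rpow_mul hδ.le, mul_assoc,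
    ← Real.rpow_add hδ]
  norm_num

theorem smallE_sq_mul {ε u : ℝ} (hε : 0 < ε) (hu : 0 < u) :
    smallE ε u ^ 2 * (u * Real.sqrt u) = ε := by
  have h := BranchData.inv_smallE_sq hε hu
  have := smallE_pos hε hu
  have := Real.sqrt_pos.2 hu
  field_simp at h
  linarith

/-- The right-hand side of the system, with the phase as time, as a function of `(u, x, y)`. -/
def slowFastField (f : ℝ → ℝ) (M : ℝ → ℝ → ℝ → ℝ) (V : ℝ → ℝ → ℝ) (ε : ℝ) (p : ℝ × ℝ × ℝ) : ℝ × ℝ :=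
  (ε⁻¹ * (2 * p.2.2 * slowFastHY f M V p.1 (p.2.1 ^ 2) (p.2.2 ^ 2)),
    ε⁻¹ * (-(2 * p.2.1 * slowFastHX f M V p.1 (p.2.1 ^ 2) (p.2.2 ^ 2))))

namespace BranchData.Regular

variable {D : BranchData} {U : ℝ} (h : D.Regular U)
include h

theorem α_sq_mul_m {u : ℝ} (hu : u ∈ Icc 0 U) : D.α u ^ 2 * D.m u = D.ω u * D.k₀ u := by
  have h1 := Real.sqrt_pos.2 (h.m_pos u hu)
  rw [h.α_sq hu, ω]
  nth_rewrite 2 [← Real.sq_sqrt (h.m_pos u hu).le]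
  nth_rewrite 3 [← Real.sq_sqrt (h.k₀_pos u hu).le]
  field_simp

theorem β_sq_mul_ω {u : ℝ} (hu : u ∈ Icc 0 U) : D.β u ^ 2 * D.ω u = D.k₀ u ^ 2 * D.m u := by
  have h1 := h.α_sq_mul_m hu
  have h2 := h.α_pos hu
  have hk := h.k₀_pos u hu
  rw [β, div_pow, div_mul_eq_mul_div, div_eq_iff (pow_pos h2 2).ne', ← pow_mul,
    show 3 * 2 = 2 * 3 by rfl, pow_mul, Real.sq_sqrt hk.le]
  linear_combination -D.k₀ u ^ 2 * h1

end BranchData.Regular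

namespace SlowFastAssumptions

variable {f : ℝ → ℝ} {M : ℝ → ℝ → ℝ → ℝ} {V : ℝ → ℝ → ℝ} {τ : ℝ} {κ : ℝ → ℝ}
  (hs : SlowFastAssumptions f M V τ κ)
include hs

theorem half_mem {u : ℝ} (hu : u ∈ Ioc 0 (τ / 2)) : u < τ := by
  have := hs.tau_pos; have := hu.2; linarith

theorem contDiff_slowFastField (ε : ℝ) : ContDiff ℝ 1 (slowFastField f M V ε) := by
  have e : slowFastField f M V ε = fun p : ℝ × ℝ × ℝ =>
      (ε⁻¹ * (2 * p.2.2 * (hamY M (p.2.1 ^ 2, p.2.2 ^ 2, p.1) / 2)),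
        ε⁻¹ * (-(2 * p.2.1 * (p.2.1 ^ 2 * hamE V (p.2.1 ^ 2, p.1) - f p.1 / 2
          + p.2.2 ^ 2 / 2 * hamMX M (p.2.1 ^ 2, p.2.2 ^ 2, p.1))))) := by
    funext p
    rw [slowFastField, slowFastHX_eq hs.smooth_M hs.smooth_V, slowFastHY_eq hs.smooth_M]
  rw [e]
  have h1 := (contDiff_hamY hs.smooth_M).of_le (m := 1) (by exact_mod_cast le_top)
  have h2 := (contDiff_hamE hs.smooth_V).of_le (m := 1) (by exact_mod_cast le_top)
  have h3 := (contDiff_hamMX hs.smooth_M).of_le (m := 1) (by exact_mod_cast le_top)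
  have h4 := hs.smooth_f.of_le (m := 1) (by exact_mod_cast le_top)
  fun_prop

theorem exists_regular : ∃ k₀ : ℝ → ℝ, (⟨M, V, k₀⟩ : BranchData).Regular (τ / 2) ∧
    ∀ u ∈ Ioc 0 (τ / 2), κ u ^ 2 = u * k₀ u := by
  obtain ⟨k₀, h1, h2, h3, h4⟩ := hs.exists_branch
  refine ⟨k₀, ⟨hs.smooth_M, hs.smooth_V, h1, h2, h3, hs.M_zero, hs.V_zero, fun u hu => ?_,
    fun u hu => ?_⟩, h4⟩
  · rw [BranchData.m_eq]
    exact hs.one_add_M_pos _ _ _ (mul_nonneg hu.1 (h2 u hu).le) le_rfl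
  · rcases hu.1.eq_or_lt with rfl | h0
    · rw [(BranchData.t_at_zero _ hs.V_zero).1]
      norm_num
    · rw [BranchData.t_one _ hs.smooth_V]
      have := hs.kappa_nondeg u h0 (hs.half_mem ⟨h0, hu.2⟩)
      rw [slowFastHXX_eq hs.smooth_M hs.smooth_V, h4 u ⟨h0, hu.2⟩] at this
      exact mul_pos (by norm_num) this

theorem slowFastField_eq {k₀ : ℝ → ℝ} (hk : ∀ u ∈ Ioc 0 (τ / 2), κ u ^ 2 = u * k₀ u) (ε : ℝ) {u : ℝ}
    (hu : u ∈ Ioc 0 (τ / 2)) (x y : ℝ) :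
    slowFastField f M V ε (u, x, y) = ((⟨M, V, k₀⟩ : BranchData).fieldX ε u x y,
      (⟨M, V, k₀⟩ : BranchData).fieldY ε u x y) := by
  have e := hs.kappa_eq u hu.1 (hs.half_mem hu)
  rw [slowFastHX_eq hs.smooth_M hs.smooth_V, hk u hu] at e
  simp only [slowFastField, BranchData.fieldX, BranchData.fieldY,
    slowFastHX_eq hs.smooth_M hs.smooth_V, slowFastHY_eq hs.smooth_M]
  refine Prod.ext (by ring) ?_
  simp only
  linear_combination -2 * ε⁻¹ * x * e

theorem kappa_eq_sqrt {k₀ : ℝ → ℝ} (hk : ∀ u ∈ Ioc 0 (τ / 2), κ u ^ 2 = u * k₀ u) {u : ℝ}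
    (hu : u ∈ Ioc 0 (τ / 2)) : κ u = Real.sqrt (u * k₀ u) := by
  rw [← hk u hu, Real.sqrt_sq (hs.kappa_pos u hu.1 (hs.half_mem hu)).le]

section Branch

variable {k₀ : ℝ → ℝ} (h : (⟨M, V, k₀⟩ : BranchData).Regular (τ / 2))
  (hk : ∀ u ∈ Ioc 0 (τ / 2), κ u ^ 2 = u * k₀ u)
include h hk

theorem vartheta_eq {u : ℝ} (hu : u ∈ Ioc 0 (τ / 2)) :
    vartheta f M V κ u = u * (⟨M, V, k₀⟩ : BranchData).ω u ^ 2 / 2 := by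
  have hu' : u ∈ Icc 0 (τ / 2) := ⟨hu.1.le, hu.2⟩
  have e1 := BranchData.m_eq ⟨M, V, k₀⟩ u
  have e2 := BranchData.t_one ⟨M, V, k₀⟩ hs.smooth_V u
  rw [BranchData.ω, mul_pow, mul_pow, Real.sq_sqrt (h.k₀_pos u hu').le,
    Real.sq_sqrt (h.t_pos u hu').le, Real.sq_sqrt (h.m_pos u hu').le, vartheta,
    slowFastHXX_eq hs.smooth_M hs.smooth_V, hk u hu, e1, e2]
  ring

theorem sqrt_vartheta_eq {u : ℝ} (hu : u ∈ Ioc 0 (τ / 2)) : Real.sqrt 2 *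
    Real.sqrt (vartheta f M V κ u) = Real.sqrt u * (⟨M, V, k₀⟩ : BranchData).ω u := by
  have hu' : u ∈ Icc 0 (τ / 2) := ⟨hu.1.le, hu.2⟩
  rw [← Real.sqrt_mul zero_le_two, hs.vartheta_eq h hk hu, mul_div_cancel₀ _ two_ne_zero,
    Real.sqrt_mul hu.1.le, Real.sqrt_sq (h.ω_pos hu').le]

theorem omegaHat_eq {ε δ u : ℝ} (hε : 0 < ε) (hδ : 0 < δ) (hu : u ∈ Ioc 0 (τ / 2)) :
    omegaHat f M V κ ε δ u
      = (muScale ε δ)⁻¹ * (Real.sqrt u * (⟨M, V, k₀⟩ : BranchData).ω u) := by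
  rw [omegaHat, mul_comm (2 : ℝ), mul_assoc, Real.sqrt_mul (sq_nonneg _),
    Real.sqrt_sq (inv_pos.2 (muScale_pos hε hδ)).le, Real.sqrt_mul zero_le_two,
    hs.sqrt_vartheta_eq h hk hu]

/-- The action-angle variables are, up to the symmetry `η`, polar coordinates of the rescaled
variable `z = √(2ϱ) e^{iφ}`. -/
theorem innerX_eq {ε δ u : ℝ} (hε : 0 < ε) (hδ : 0 < δ) (hu : u ∈ Ioc 0 (τ / 2)) (η ϱ φ : ℝ)
    {z : ℂ} (hz : z.re = Real.sqrt (2 * ϱ) * Real.cos φ) :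
    innerX f M V κ ε δ η u ϱ φ = η * (⟨M, V, k₀⟩ : BranchData).xVar ε z u := by
  set D : BranchData := ⟨M, V, k₀⟩ with hD
  have hu' : u ∈ Icc 0 (τ / 2) := ⟨hu.1.le, hu.2⟩
  have hμ := muScale_pos hε hδ
  have hω := h.ω_pos hu'
  have hα := h.α_pos hu'
  have hm := h.m_pos u hu'
  have hk0 : 0 < k₀ u := h.k₀_pos u hu'
  have hE := smallE_pos hε hu.1
  have hsu := Real.sqrt_pos.2 hu.1
  have hα2 : D.α u ^ 2 * D.m u = D.ω u * k₀ u := h.α_sq_mul_m hu'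
  have hμ3 := muScale_pow_three hε hδ
  have hd := Real.rpow_pos_of_pos hδ (3 / 4)
  have hK : 0 < u * k₀ u := mul_pos hu.1 hk0
  have hΩ : 0 < (muScale ε δ)⁻¹ * (Real.sqrt u * D.ω u) := by positivity
  have em : 1 + M (κ u ^ 2) 0 u = D.m u := by rw [hk u hu, BranchData.m_eq]
  have key : muScale ε δ * δ ^ (3 / 4 : ℝ) * (Real.sqrt (D.m u)
      / Real.sqrt ((muScale ε δ)⁻¹ * (Real.sqrt u * D.ω u)))
      = Real.sqrt (u * k₀ u) * (smallE ε u / D.α u) := by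
    have := Real.sqrt_pos.2 hm
    have := Real.sqrt_pos.2 hΩ
    have := Real.sqrt_pos.2 hK
    refine (pow_left_inj₀ (by positivity) (by positivity) two_ne_zero).1 ?_
    have eE := smallE_sq_mul hε hu.1
    simp only [mul_pow, div_pow, Real.sq_sqrt hm.le, Real.sq_sqrt hΩ.le, Real.sq_sqrt hK.le]
    field_simp
    rw [← sub_eq_zero]
    linear_combination (D.α u ^ 2 * D.m u) * hμ3 + ε * hα2 - D.ω u * k₀ u * eE
  rw [innerX, hs.omegaHat_eq h hk hε hδ hu, em, hs.kappa_eq_sqrt hk hu, BranchData.xVar, hz]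
  linear_combination η * (Real.sqrt (2 * ϱ) * Real.cos φ) * key

theorem innerY_eq {ε δ u : ℝ} (hε : 0 < ε) (hδ : 0 < δ) (hu : u ∈ Ioc 0 (τ / 2)) (η ϱ φ : ℝ)
    {z : ℂ} (hz : z.im = Real.sqrt (2 * ϱ) * Real.sin φ) :
    innerY f M V κ ε δ η u ϱ φ = η * (⟨M, V, k₀⟩ : BranchData).yVar ε z u := by
  set D : BranchData := ⟨M, V, k₀⟩ with hD
  have hu' : u ∈ Icc 0 (τ / 2) := ⟨hu.1.le, hu.2⟩
  have hμ := muScale_pos hε hδ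
  have hω := h.ω_pos hu'
  have hβ := h.β_pos hu'
  have hm := h.m_pos u hu'
  have hk0 : 0 < k₀ u := h.k₀_pos u hu'
  have hE := smallE_pos hε hu.1
  have hsu := Real.sqrt_pos.2 hu.1
  have hβ2 : D.β u ^ 2 * D.ω u = k₀ u ^ 2 * D.m u := h.β_sq_mul_ω hu'
  have hμ3 := muScale_pow_three hε hδ
  have hd := Real.rpow_pos_of_pos hδ (3 / 4)
  have hK : 0 < u * k₀ u := mul_pos hu.1 hk0
  have hΩ : 0 < (muScale ε δ)⁻¹ * (Real.sqrt u * D.ω u) := by positivity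
  have em : 1 + M (κ u ^ 2) 0 u = D.m u := by rw [hk u hu, BranchData.m_eq]
  have key : muScale ε δ ^ 2 * δ ^ (3 / 4 : ℝ) * (Real.sqrt ((muScale ε δ)⁻¹
      * (Real.sqrt u * D.ω u)) / Real.sqrt (D.m u)) = u * k₀ u * (smallE ε u / D.β u) := by
    have := Real.sqrt_pos.2 hm
    have := Real.sqrt_pos.2 hΩ
    refine (pow_left_inj₀ (by positivity) (by positivity) two_ne_zero).1 ?_
    have eE := smallE_sq_mul hε hu.1
    have eu := Real.sq_sqrt hu.1.le
    simp only [mul_pow, div_pow, Real.sq_sqrt hm.le, Real.sq_sqrt hΩ.le]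
    field_simp
    rw [← sub_eq_zero]
    linear_combination Real.sqrt u * (D.β u ^ 2 * D.ω u) * hμ3 + ε * Real.sqrt u * hβ2
      - Real.sqrt u * k₀ u ^ 2 * D.m u * eE + smallE ε u ^ 2 * k₀ u ^ 2 * D.m u * u * eu
  rw [innerY, hs.omegaHat_eq h hk hε hδ hu, em, BranchData.yVar, hz]
  linear_combination η * (Real.sqrt (2 * ϱ) * Real.sin φ) * key

end Branch

end SlowFastAssumptions

/-! ### The phase -/

theorem integral_sqrt_zero {u : ℝ} (hu : 0 ≤ u) :
    ∫ v in (0 : ℝ)..u, Real.sqrt v = 2 / 3 * (u * Real.sqrt u) := by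
  have e : ∀ v : ℝ, Real.sqrt v = v ^ (1 / 2 : ℝ) := fun v => Real.sqrt_eq_rpow v
  simp_rw [e]
  rw [integral_rpow (Or.inl (by norm_num)), Real.zero_rpow (by norm_num),
    Real.rpow_add' hu (by norm_num), Real.rpow_one]
  ring

namespace SmoothIcc

variable {U : ℝ} {c : ℝ → ℝ}

theorem exists_eq_add_mul (hc : SmoothIcc U c) :
    ∃ g : ℝ → ℝ, ContinuousOn g (Icc 0 U) ∧ ∀ v, c v = c 0 + v * g v := by
  refine ⟨dslope c 0, fun v hv => ContinuousAt.continuousWithinAt ?_, fun v => ?_⟩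
  · rcases eq_or_ne v 0 with rfl | h
    · exact continuousAt_dslope_same.2 ((hc 0 hv).differentiableAt (by simp))
    · exact (continuousAt_dslope_of_ne h).2 (hc v hv).continuousAt
  · have := sub_smul_dslope c 0 v
    rw [sub_zero, smul_eq_mul] at this
    linarith

/-- The contribution of the linear frequency to the phase. -/
theorem exists_integral_sqrt_mul_bound (hc : SmoothIcc U c) (hU : 0 ≤ U) :
    ∃ C, 0 ≤ C ∧ ∀ u ∈ Icc 0 U, |(∫ v in u..U, Real.sqrt v * c v)
      - ((∫ v in (0 : ℝ)..U, Real.sqrt v * c v) - 2 / 3 * c 0 * (u * Real.sqrt u))|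
        ≤ C * (u ^ 2 * Real.sqrt u) := by
  obtain ⟨g, hg, hcg⟩ := hc.exists_eq_add_mul
  obtain ⟨C, hC⟩ := isCompact_Icc.exists_bound_of_continuousOn hg
  have hC0 : 0 ≤ C := (norm_nonneg _).trans (hC 0 ⟨le_rfl, hU⟩)
  refine ⟨C, hC0, fun u hu => ?_⟩
  have hcont : ContinuousOn (fun v => Real.sqrt v * c v) (Icc 0 U) :=
    Real.continuous_sqrt.continuousOn.mul hc.continuousOn
  have hi : ∀ a ∈ Icc 0 U, ∀ b ∈ Icc 0 U,
      IntervalIntegrable (fun v => Real.sqrt v * c v) MeasureTheory.volume a b := fun a ha b hb =>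
    (hcont.mono (uIcc_subset_Icc ha hb)).intervalIntegrable
  have h0 : (0 : ℝ) ∈ Icc 0 U := ⟨le_rfl, hU⟩
  have hUm : U ∈ Icc 0 U := ⟨hU, le_rfl⟩
  have e1 := intervalIntegral.integral_add_adjacent_intervals (hi 0 h0 u hu) (hi u hu U hUm)
  have e2 : (∫ v in (0 : ℝ)..u, Real.sqrt v * c v) - ∫ v in (0 : ℝ)..u, c 0 * Real.sqrt v
      = ∫ v in (0 : ℝ)..u, Real.sqrt v * (v * g v) := by
    rw [← intervalIntegral.integral_sub (hi 0 h0 u hu)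
      ((Real.continuous_sqrt.const_mul _).intervalIntegrable _ _)]
    refine intervalIntegral.integral_congr fun v _ => ?_
    rw [hcg v]; ring
  rw [intervalIntegral.integral_const_mul, integral_sqrt_zero hu.1] at e2
  have e3 : ‖∫ v in (0 : ℝ)..u, Real.sqrt v * (v * g v)‖ ≤ (Real.sqrt u * (u * C)) * |u - 0| := by
    refine intervalIntegral.norm_integral_le_of_norm_le_const fun v hv => ?_
    rw [uIoc_of_le hu.1] at hv
    rw [norm_mul, norm_mul, Real.norm_of_nonneg (Real.sqrt_nonneg v), Real.norm_of_nonneg hv.1.le]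
    exact mul_le_mul (Real.sqrt_le_sqrt hv.2) (mul_le_mul hv.2 (hC v ⟨hv.1.le, hv.2.trans hu.2⟩)
      (norm_nonneg _) hu.1) (mul_nonneg hv.1.le (norm_nonneg _)) (Real.sqrt_nonneg _)
  rw [← e2, sub_zero, abs_of_nonneg hu.1, Real.norm_eq_abs, abs_sub_comm] at e3
  refine (le_of_eq ?_).trans (e3.trans (le_of_eq (by ring)))
  congr 1
  linarith

/-- The contribution of the nonlinearity to the phase diverges logarithmically as `u → 0`. -/
theorem exists_integral_div_bound (hc : SmoothIcc U c) (hU : 0 ≤ U) :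
    ∃ e C, 0 ≤ C ∧ ∀ u ∈ Ioc 0 U,
      |(∫ v in u..U, c v / v) - (c 0 * Real.log (U / u) + e)| ≤ C * u := by
  obtain ⟨g, hg, hcg⟩ := hc.exists_eq_add_mul
  obtain ⟨C, hC⟩ := isCompact_Icc.exists_bound_of_continuousOn hg
  have hC0 : 0 ≤ C := (norm_nonneg _).trans (hC 0 ⟨le_rfl, hU⟩)
  refine ⟨∫ v in (0 : ℝ)..U, g v, C, hC0, fun u hu => ?_⟩
  have hi : ∀ a ∈ Icc 0 U, ∀ b ∈ Icc 0 U, IntervalIntegrable g MeasureTheory.volume a b :=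
    fun a ha b hb => (hg.mono (uIcc_subset_Icc ha hb)).intervalIntegrable
  have h0 : (0 : ℝ) ∈ Icc 0 U := ⟨le_rfl, hU⟩
  have hUm : U ∈ Icc 0 U := ⟨hU, le_rfl⟩
  have hum : u ∈ Icc 0 U := ⟨hu.1.le, hu.2⟩
  have e1 := intervalIntegral.integral_add_adjacent_intervals (hi 0 h0 u hum) (hi u hum U hUm)
  have hn : (0 : ℝ) ∉ uIcc u U := by
    rw [uIcc_of_le hu.2]; exact fun h => hu.1.not_ge h.1
  have e2 : ∫ v in u..U, c v / v = c 0 * Real.log (U / u) + ∫ v in u..U, g v := by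
    rw [← integral_inv hn, ← intervalIntegral.integral_const_mul,
      ← intervalIntegral.integral_add ((intervalIntegral.intervalIntegrable_inv
        (fun v hv => ne_of_mem_of_not_mem hv hn) continuousOn_id).const_mul _) (hi u hum U hUm)]
    refine intervalIntegral.integral_congr fun v hv => ?_
    have : v ≠ 0 := ne_of_mem_of_not_mem hv hn
    rw [hcg v]
    field_simp
  have e3 : ‖∫ v in (0 : ℝ)..u, g v‖ ≤ C * |u - 0| := by
    refine intervalIntegral.norm_integral_le_of_norm_le_const fun v hv => ?_
    rw [uIoc_of_le hu.1.le] at hv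
    exact hC v ⟨hv.1.le, hv.2.trans hu.2⟩
  rw [sub_zero, abs_of_pos hu.1, Real.norm_eq_abs, ← abs_neg] at e3
  refine (le_of_eq ?_).trans e3
  congr 1
  rw [e2]
  linarith

end SmoothIcc

namespace BranchData.Regular

variable {D : BranchData} {U : ℝ} (h : D.Regular U)
include h

theorem exists_phase_bound (hU : 0 ≤ U) : ∃ e C, 0 ≤ C ∧ ∀ ε u w : ℝ, 0 < ε → u ∈ Ioc 0 U →
    |(∫ v in u..U, D.angVel ε w v) - (ε⁻¹ * ((∫ v in (0 : ℝ)..U, Real.sqrt v * D.ω v)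
      - 2 / 3 * Real.sqrt 2 * (u * Real.sqrt u)) - w ^ 2 * (3 / 2 * Real.log (U / u) + e))|
        ≤ C * (ε⁻¹ * (u ^ 2 * Real.sqrt u) + w ^ 2 * u) := by
  obtain ⟨C1, hC1, b1⟩ := h.smooth_ω.exists_integral_sqrt_mul_bound hU
  obtain ⟨e, C2, hC2, b2⟩ := h.smooth_coeffs.γ.exists_integral_div_bound hU
  rw [h.ω_zero] at b1
  rw [h.γ_zero hU] at b2
  refine ⟨e, C1 + C2, by positivity, fun ε u w hε hu => ?_⟩
  have hsub : Icc u U ⊆ Icc 0 U := Icc_subset_Icc_left hu.1.le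
  have hn : ∀ v ∈ Icc u U, v ≠ 0 := fun v hv => (hu.1.trans_le hv.1).ne'
  have i1 : IntervalIntegrable (fun v => Real.sqrt v * D.ω v) MeasureTheory.volume u U := by
    refine ContinuousOn.intervalIntegrable_of_Icc hu.2 ?_
    exact Real.continuous_sqrt.continuousOn.mul (h.smooth_ω.continuousOn.mono hsub)
  have i2 : IntervalIntegrable (fun v => D.coeffs.γ v / v) MeasureTheory.volume u U := by
    refine ContinuousOn.intervalIntegrable_of_Icc hu.2 ?_
    exact (h.smooth_coeffs.γ.continuousOn.mono hsub).div continuousOn_id hn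
  have e1 : ∫ v in u..U, D.angVel ε w v = ε⁻¹ * (∫ v in u..U, Real.sqrt v * D.ω v)
      - w ^ 2 * ∫ v in u..U, D.coeffs.γ v / v := by
    rw [← intervalIntegral.integral_const_mul, ← intervalIntegral.integral_const_mul,
      ← intervalIntegral.integral_sub (i1.const_mul _) (i2.const_mul _)]
    refine intervalIntegral.integral_congr fun v hv => ?_
    rw [uIcc_of_le hu.2] at hv
    have h0 := hn v hv
    simp only [angVel, inv_smallE_sq hε (hu.1.trans_le hv.1)]
    field_simp
  rw [e1]
  have a1 := mul_le_mul_of_nonneg_left (b1 u ⟨hu.1.le, hu.2⟩) (inv_pos.2 hε).le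
  have a2 := mul_le_mul_of_nonneg_left (b2 u hu) (sq_nonneg w)
  rw [← abs_of_pos (inv_pos.2 hε), ← abs_mul, abs_of_pos (inv_pos.2 hε)] at a1
  rw [← abs_of_nonneg (sq_nonneg w), ← abs_mul, abs_of_nonneg (sq_nonneg w)] at a2
  have p1 : 0 ≤ ε⁻¹ * (u ^ 2 * Real.sqrt u) := by positivity
  have p2 : 0 ≤ w ^ 2 * u := mul_nonneg (sq_nonneg w) hu.1.le
  have p3 := mul_nonneg hC2 p1
  have p4 := mul_nonneg hC1 p2
  refine (le_of_eq ?_).trans ((abs_sub _ _).trans ((add_le_add a1 a2).trans ?_))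
  · congr 1; ring
  · linarith

end BranchData.Regular

theorem SlowFastAssumptions.integral_sqrt_mul_ω {f : ℝ → ℝ} {M : ℝ → ℝ → ℝ → ℝ} {V : ℝ → ℝ → ℝ}
    {τ : ℝ} {κ : ℝ → ℝ} (hs : SlowFastAssumptions f M V τ κ) {k₀ : ℝ → ℝ}
    (h : (⟨M, V, k₀⟩ : BranchData).Regular (τ / 2))
    (hk : ∀ u ∈ Ioc 0 (τ / 2), κ u ^ 2 = u * k₀ u) :
    ∫ v in (0 : ℝ)..(τ / 2), Real.sqrt v * (⟨M, V, k₀⟩ : BranchData).ω v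
      = Real.sqrt 2 * eOne f M V τ κ := by
  rw [eOne, ← intervalIntegral.integral_const_mul]
  exact intervalIntegral.integral_congr_Ioo_of_le (half_pos hs.tau_pos).le fun v hv =>
    (hs.sqrt_vartheta_eq h hk ⟨hv.1, hv.2.le⟩).symm

/-! ### The size of the parameters -/

theorem muScale_sq {ε δ : ℝ} (hε : 0 < ε) (hδ : 0 < δ) :
    muScale ε δ ^ 2 = ε ^ (2 / 3 : ℝ) * δ⁻¹ := by
  rw [muScale, mul_pow, ← Real.rpow_natCast, ← Real.rpow_natCast, ← Real.rpow_mul hε.le,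
    ← Real.rpow_mul hδ.le, ← Real.rpow_neg_one]
  norm_num

section Params

variable {ε δ s : ℝ} (hε : 0 < ε) (hδ : 0 < δ) (hs : 0 < s)
include hε hδ hs

theorem log_inv_muScale : 3 * Real.log (muScale ε δ ^ 2 * s)
    = -(2 * Real.log ε⁻¹) + 3 * Real.log (δ⁻¹ * s) := by
  rw [muScale_sq hε hδ, mul_assoc, Real.log_mul (Real.rpow_pos_of_pos hε _).ne'
    (mul_pos (inv_pos.2 hδ) hs).ne', Real.log_rpow hε, Real.log_inv]
  ring

theorem smallE_muScale : smallE ε (muScale ε δ ^ 2 * s)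
    = δ ^ (3 / 4 : ℝ) * s ^ (-(3 / 4) : ℝ) := by
  rw [muScale_sq hε hδ, smallE, Real.mul_rpow (by positivity) hs.le,
    Real.mul_rpow (by positivity) (by positivity), ← Real.rpow_mul hε.le, Real.sqrt_eq_rpow,
    Real.inv_rpow hδ.le, ← Real.rpow_neg hδ.le, ← mul_assoc, ← mul_assoc, ← Real.rpow_add hε]
  norm_num

theorem inv_mul_muScale_sqrt : ε⁻¹ * (muScale ε δ ^ 2 * s * Real.sqrt (muScale ε δ ^ 2 * s))
    = δ ^ (-(3 / 2) : ℝ) * s ^ (3 / 2 : ℝ) := by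
  have hμ := muScale_pos hε hδ
  have e : s ^ (3 / 2 : ℝ) = s * Real.sqrt s := by
    rw [Real.sqrt_eq_rpow, show (3 / 2 : ℝ) = 1 + 1 / 2 by norm_num, Real.rpow_add hs,
      Real.rpow_one]
  have e2 : δ ^ (-(3 / 2) : ℝ) * (δ ^ (3 / 4 : ℝ)) ^ 2 = 1 := by
    rw [← Real.rpow_natCast, ← Real.rpow_mul hδ.le, ← Real.rpow_add hδ]
    norm_num
  have e3 := muScale_pow_three hε hδ
  rw [Real.sqrt_mul (sq_nonneg _), Real.sqrt_sq hμ.le, e, inv_mul_eq_iff_eq_mul₀ hε.ne']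
  have h1 : muScale ε δ ^ 3 = ε * δ ^ (-(3 / 2) : ℝ) := by
    linear_combination δ ^ (-(3 / 2) : ℝ) * e3 - muScale ε δ ^ 3 * e2
  linear_combination s * Real.sqrt s * h1

end Params

/-- The smallness conditions on `ε` and `δ` put the initial phase `μ² s` into `(0, U)`, and they
make the errors in the initial smallness, in the frequency and in the logarithm comparable to
`δ^{3/4} ln ε⁻¹`. -/
theorem exists_params_bound {U s : ℝ} (hU : 0 < U) (hs : 0 < s) : ∃ r C, 0 < r ∧ 0 < C ∧
    ∀ ε δ : ℝ, 0 < ε → ε ≤ r → 0 < δ → δ ^ (3 / 4 : ℝ) * Real.log ε⁻¹ ≤ r →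
      ε ^ (2 / 3 : ℝ) * δ ^ (-(7 / 2) : ℝ) * Real.log δ⁻¹ ^ 3 ≤ r →
      0 < muScale ε δ ^ 2 * s ∧ muScale ε δ ^ 2 * s < U ∧
      smallE ε (muScale ε δ ^ 2 * s) * (1 + Real.log (U / (muScale ε δ ^ 2 * s)))
        ≤ C * (δ ^ (3 / 4 : ℝ) * Real.log ε⁻¹) ∧
      ε⁻¹ * ((muScale ε δ ^ 2 * s) ^ 2 * Real.sqrt (muScale ε δ ^ 2 * s))
        ≤ C * (δ ^ (3 / 4 : ℝ) * Real.log ε⁻¹) ∧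
      muScale ε δ ^ 2 * s ≤ C * (δ ^ (3 / 4 : ℝ) * Real.log ε⁻¹) := by
  set S := s ^ (-(3 / 4) : ℝ) with hS
  have hSpos : 0 < S := Real.rpow_pos_of_pos hs _
  set T := s * s ^ (3 / 2 : ℝ) with hT
  have hTpos : 0 < T := mul_pos hs (Real.rpow_pos_of_pos hs _)
  set Λ := |Real.log (U / s)| with hΛ
  refine ⟨min (Real.exp (-1)) (U / (2 * s)), S * (2 + Λ) + T + s, lt_min (Real.exp_pos _)
    (by positivity), by positivity, fun ε δ hε hεr hδ h1 h2 => ?_⟩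
  have hL : 1 ≤ Real.log ε⁻¹ := by
    have := Real.log_le_log hε (hεr.trans (min_le_left _ _))
    rw [Real.log_exp] at this
    rw [Real.log_inv]; linarith
  have hdp : 0 < δ ^ (3 / 4 : ℝ) := Real.rpow_pos_of_pos hδ _
  have hd1 : δ ^ (3 / 4 : ℝ) ≤ Real.exp (-1) :=
    ((le_mul_of_one_le_right hdp.le hL).trans h1).trans (min_le_left _ _)
  have hLd : 1 ≤ Real.log δ⁻¹ := by
    have := Real.log_le_log hdp hd1
    rw [Real.log_exp, Real.log_rpow hδ] at this
    rw [Real.log_inv]; linarith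
  have hδ1 : δ ≤ 1 := by
    rw [Real.log_inv] at hLd
    exact ((Real.log_neg_iff hδ).1 (by linarith)).le
  have hX : 0 < ε ^ (2 / 3 : ℝ) * δ ^ (-(7 / 2) : ℝ) := by positivity
  have h3 : ε ^ (2 / 3 : ℝ) * δ ^ (-(7 / 2) : ℝ) ≤ min (Real.exp (-1)) (U / (2 * s)) :=
    (le_mul_of_one_le_right hX.le (one_le_pow₀ hLd)).trans h2
  have h3e : ε ^ (2 / 3 : ℝ) * δ ^ (-(7 / 2) : ℝ) ≤ 1 :=
    (h3.trans (min_le_left _ _)).trans (Real.exp_le_one_iff.2 (by norm_num))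
  have h3u := h3.trans (min_le_right _ _)
  set Q := δ ^ (3 / 4 : ℝ) * Real.log ε⁻¹ with hQ
  have hQpos : 0 < Q := mul_pos hdp (by linarith)
  have hdQ : δ ^ (3 / 4 : ℝ) ≤ Q := le_mul_of_one_le_right hdp.le hL
  have hu0 : 0 < muScale ε δ ^ 2 * s := mul_pos (pow_pos (muScale_pos hε hδ) 2) hs
  have hμX : muScale ε δ ^ 2 = ε ^ (2 / 3 : ℝ) * δ ^ (-(7 / 2) : ℝ) * δ ^ (5 / 2 : ℝ) := by
    rw [muScale_sq hε hδ, mul_assoc, ← Real.rpow_add hδ, ← Real.rpow_neg_one]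
    norm_num
  have hd5 : δ ^ (5 / 2 : ℝ) ≤ δ ^ (3 / 4 : ℝ) :=
    Real.rpow_le_rpow_of_exponent_ge hδ hδ1 (by norm_num)
  have hd5' : δ ^ (5 / 2 : ℝ) ≤ 1 := Real.rpow_le_one hδ.le hδ1 (by norm_num)
  have hμQ : muScale ε δ ^ 2 ≤ Q := by
    rw [hμX]
    exact (mul_le_of_le_one_left (by positivity) h3e).trans (hd5.trans hdQ)
  have hμU : muScale ε δ ^ 2 ≤ U / (2 * s) := by
    rw [hμX]
    exact (mul_le_of_le_one_right hX.le hd5').trans h3u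
  refine ⟨hu0, ?_, ?_, ?_, ?_⟩
  · have := mul_le_mul_of_nonneg_right hμU hs.le
    have e : U / (2 * s) * s = U / 2 := by field_simp
    linarith
  · rw [smallE_muScale hε hδ hs]
    have e := log_inv_muScale hε hδ hs
    have e' : Real.log (U / (muScale ε δ ^ 2 * s))
        = Real.log (U / s) + 2 / 3 * Real.log ε⁻¹ - Real.log δ⁻¹ := by
      rw [Real.log_mul (inv_pos.2 hδ).ne' hs.ne'] at e
      rw [Real.log_div hU.ne' hu0.ne', Real.log_div hU.ne' hs.ne']
      linarith
    have hb : 1 + Real.log (U / (muScale ε δ ^ 2 * s)) ≤ (2 + Λ) * Real.log ε⁻¹ := by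
      have := mul_le_mul_of_nonneg_left hL (abs_nonneg (Real.log (U / s)))
      have := le_abs_self (Real.log (U / s))
      rw [e']
      linarith
    have := mul_le_mul_of_nonneg_left hb (mul_pos hdp hSpos).le
    have p1 := mul_pos hTpos hQpos
    have p2 := mul_pos hs hQpos
    refine this.trans ?_
    have e2 : δ ^ (3 / 4 : ℝ) * S * ((2 + Λ) * Real.log ε⁻¹) = S * (2 + Λ) * Q := by
      rw [hQ]; ring
    rw [e2]
    linarith
  · have e := inv_mul_muScale_sqrt hε hδ hs
    have e2 : ε⁻¹ * ((muScale ε δ ^ 2 * s) ^ 2 * Real.sqrt (muScale ε δ ^ 2 * s))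
        = ε ^ (2 / 3 : ℝ) * δ ^ (-(7 / 2) : ℝ) * δ * T := by
      have e3 : δ ^ (5 / 2 : ℝ) * δ ^ (-(3 / 2) : ℝ) = δ := by
        rw [← Real.rpow_add hδ]; norm_num
      rw [hT]
      linear_combination muScale ε δ ^ 2 * s * e
        + s * s ^ (3 / 2 : ℝ) * δ ^ (-(3 / 2) : ℝ) * hμX
        + ε ^ (2 / 3 : ℝ) * δ ^ (-(7 / 2) : ℝ) * s * s ^ (3 / 2 : ℝ) * e3
    have hδQ : δ ≤ Q := by
      refine le_trans ?_ hdQ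
      have := Real.rpow_le_rpow_of_exponent_ge hδ hδ1 (show (3 / 4 : ℝ) ≤ 1 by norm_num)
      rwa [Real.rpow_one] at this
    rw [e2]
    have : ε ^ (2 / 3 : ℝ) * δ ^ (-(7 / 2) : ℝ) * δ ≤ Q :=
      (mul_le_of_le_one_left hδ.le h3e).trans hδQ
    have := mul_le_mul_of_nonneg_right this hTpos.le
    have : 0 < (S * (2 + Λ)) * Q := by positivity
    have p2 := mul_pos hs hQpos
    linarith
  · have := mul_le_mul_of_nonneg_right hμQ hs.le
    have : 0 < (S * (2 + Λ)) * Q := by positivity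
    have p1 := mul_pos hTpos hQpos
    linarith

/-! ### Continuous polar coordinates -/

/-- The path `√(2ϱ) e^{iφ}` determines `ϱ`, and the continuous angle up to its initial value. -/
theorem polar_unique {ϱ₁ ϱ₂ φ₁ φ₂ : ℝ → ℝ} {a b : ℝ} (hab : a ≤ b)
    (h₁ : ContinuousOn φ₁ (Icc a b)) (h₂ : ContinuousOn φ₂ (Icc a b))
    (p₁ : ∀ u ∈ Icc a b, 0 < ϱ₁ u) (p₂ : ∀ u ∈ Icc a b, 0 < ϱ₂ u)
    (heq : ∀ u ∈ Icc a b, (Real.sqrt (2 * ϱ₁ u) : ℂ) * Complex.exp (φ₁ u * Complex.I)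
      = Real.sqrt (2 * ϱ₂ u) * Complex.exp (φ₂ u * Complex.I))
    (h0 : φ₁ a = φ₂ a) : ϱ₁ b = ϱ₂ b ∧ φ₁ b = φ₂ b := by
  have hϱ : ∀ u ∈ Icc a b, ϱ₁ u = ϱ₂ u := fun u hu => by
    have := congrArg norm (heq u hu)
    rw [norm_mul, norm_mul, Complex.norm_exp_ofReal_mul_I, Complex.norm_exp_ofReal_mul_I, mul_one,
      mul_one, Complex.norm_real, Complex.norm_real, Real.norm_of_nonneg (Real.sqrt_nonneg _),
      Real.norm_of_nonneg (Real.sqrt_nonneg _), Real.sqrt_inj (by linarith [p₁ u hu])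
        (by linarith [p₂ u hu])] at this
    linarith
  refine ⟨hϱ b ⟨hab, le_rfl⟩, ?_⟩
  have hcos : ∀ u ∈ Icc a b, Real.cos |φ₁ u - φ₂ u| = 1 := fun u hu => by
    have e := heq u hu
    rw [hϱ u hu] at e
    have hs : (Real.sqrt (2 * ϱ₂ u) : ℂ) ≠ 0 := by
      have := Real.sqrt_pos.2 (show 0 < 2 * ϱ₂ u by linarith [p₂ u hu])
      exact_mod_cast this.ne'
    have e2 := mul_left_cancel₀ hs e
    have e3 : Complex.exp ((φ₁ u - φ₂ u : ℝ) * Complex.I) = 1 := by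
      rw [Complex.ofReal_sub, sub_mul, Complex.exp_sub, e2, div_self (Complex.exp_ne_zero _)]
    have := congrArg Complex.re e3
    rwa [Complex.exp_ofReal_mul_I_re, Complex.one_re, ← Real.cos_abs] at this
  by_contra hne
  have hpos : 0 < |φ₁ b - φ₂ b| := abs_pos.2 (sub_ne_zero.2 hne)
  -- the difference would have to pass through `π`, where the cosine is `-1`
  have hπ : Real.pi ≤ |φ₁ b - φ₂ b| := by
    by_contra hlt
    have := Real.cos_lt_cos_of_nonneg_of_le_pi le_rfl (not_le.1 hlt).le hpos
    rw [Real.cos_zero, hcos b ⟨hab, le_rfl⟩] at this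
    exact lt_irrefl _ this
  obtain ⟨v, hv, hv'⟩ := intermediate_value_Icc hab (h₁.sub h₂).abs
    (show Real.pi ∈ Icc |φ₁ a - φ₂ a| |φ₁ b - φ₂ b| from
      ⟨by rw [h0, sub_self, abs_zero]; exact Real.pi_pos.le, hπ⟩)
  have := hcos v hv
  rw [show |φ₁ v - φ₂ v| = Real.pi from hv', Real.cos_pi] at this
  norm_num at this

/-- A path close to a rotation has continuous polar coordinates, in which the radius is almost
constant and the angle is almost that of the rotation. -/
theorem exists_polar {Z : ℝ → ℂ} {ψ : ℝ → ℝ} {a b d ϱ₀ φ₀ : ℝ} {z₀ : ℂ} (hab : a ≤ b)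
    (hϱ₀ : 0 < ϱ₀) (hz₀ : z₀ = Real.sqrt (2 * ϱ₀) * Complex.exp (φ₀ * Complex.I))
    (hZ : ContinuousOn Z (Icc a b)) (hψ : ContinuousOn ψ (Icc a b)) (hψ0 : ψ a = 0)
    (hZ0 : Z a = z₀)
    (hd : ∀ u ∈ Icc a b, ‖Z u * Complex.exp (Complex.I * (ψ u : ℂ)) - z₀‖ ≤ d)
    (hd' : d ≤ ‖z₀‖ / 2) :
    ∃ ϱ φ : ℝ → ℝ, ContinuousOn ϱ (Icc a b) ∧ ContinuousOn φ (Icc a b) ∧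
      (∀ u ∈ Icc a b, 0 < ϱ u) ∧
      (∀ u ∈ Icc a b, Z u = Real.sqrt (2 * ϱ u) * Complex.exp (φ u * Complex.I)) ∧
      ϱ a = ϱ₀ ∧ φ a = φ₀ ∧
      |ϱ b - ϱ₀| ≤ 2 * ‖z₀‖ * d ∧ |φ b - (φ₀ - ψ b)| ≤ 2 * (d / ‖z₀‖) := by
  have hs0 : 0 < Real.sqrt (2 * ϱ₀) := Real.sqrt_pos.2 (by linarith)
  have hn0 : ‖z₀‖ = Real.sqrt (2 * ϱ₀) := by
    rw [hz₀, norm_mul, Complex.norm_exp_ofReal_mul_I, mul_one, Complex.norm_real,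
      Real.norm_of_nonneg hs0.le]
  have hnpos : 0 < ‖z₀‖ := hn0 ▸ hs0
  have hzne : z₀ ≠ 0 := norm_pos_iff.1 hnpos
  set W : ℝ → ℂ := fun u => Z u * Complex.exp (Complex.I * (ψ u : ℂ)) / z₀ with hW
  have hWc : ContinuousOn W (Icc a b) :=
    (hZ.mul (Complex.continuous_exp.comp_continuousOn (continuousOn_const.mul
      (Complex.continuous_ofReal.comp_continuousOn hψ)))).div_const _
  have hW1 : ∀ u ∈ Icc a b, ‖W u - 1‖ ≤ d / ‖z₀‖ := fun u hu => by
    have e : W u - 1 = (Z u * Complex.exp (Complex.I * (ψ u : ℂ)) - z₀) / z₀ := by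
      rw [hW]; field_simp
    rw [e, norm_div]
    exact div_le_div_of_nonneg_right (hd u hu) hnpos.le
  have hd2 : d / ‖z₀‖ ≤ 1 / 2 := by rw [div_le_iff₀ hnpos]; linarith
  have hslit : ∀ u ∈ Icc a b, W u ∈ Complex.slitPlane := fun u hu => by
    left
    have := (abs_le.1 ((Complex.abs_re_le_norm (W u - 1)).trans ((hW1 u hu).trans hd2))).1
    rw [Complex.sub_re, Complex.one_re] at this
    linarith
  have hZW : ∀ u, Z u = z₀ * W u * Complex.exp (-(ψ u * Complex.I)) := fun u => by
    have := Complex.exp_ne_zero ((ψ u : ℂ) * Complex.I)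
    simp only [hW]
    rw [Complex.exp_neg, mul_comm Complex.I]
    field_simp
  have hZn : ∀ u, ‖Z u‖ = ‖z₀‖ * ‖W u‖ := fun u => by
    rw [hZW u, norm_mul, norm_mul, ← neg_mul, ← Complex.ofReal_neg,
      Complex.norm_exp_ofReal_mul_I, mul_one]
  have hsq : ∀ u, Real.sqrt (2 * (‖Z u‖ ^ 2 / 2)) = ‖Z u‖ := fun u => by
    rw [mul_div_cancel₀ _ two_ne_zero, Real.sqrt_sq (norm_nonneg _)]
  have ha : a ∈ Icc a b := ⟨le_rfl, hab⟩
  have hb : b ∈ Icc a b := ⟨hab, le_rfl⟩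
  refine ⟨fun u => ‖Z u‖ ^ 2 / 2, fun u => φ₀ - ψ u + (W u).arg, (hZ.norm.pow 2).div_const 2,
    (continuousOn_const.sub hψ).add fun u hu =>
      (Complex.continuousAt_arg (hslit u hu)).comp_continuousWithinAt (hWc u hu),
    fun u hu => ?_, fun u hu => ?_, ?_, ?_, ?_, ?_⟩
  · have : 0 < ‖W u‖ := norm_pos_iff.2 (Complex.slitPlane_ne_zero (hslit u hu))
    have : 0 < ‖Z u‖ := by rw [hZn]; positivity
    positivity
  · simp only
    rw [hsq, hZn, hn0, Complex.ofReal_mul, Complex.ofReal_add, Complex.ofReal_sub, add_mul, sub_mul,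
      sub_eq_add_neg, Complex.exp_add, Complex.exp_add]
    conv_lhs => rw [hZW u, hz₀, ← Complex.norm_mul_exp_arg_mul_I (W u)]
    ring
  · simp only
    rw [hZ0, hn0, Real.sq_sqrt (by linarith)]
    ring
  · have : W a = 1 := by
      simp only [hW, hψ0, hZ0, Complex.ofReal_zero, mul_zero, Complex.exp_zero, mul_one]
      exact div_self hzne
    simp only
    rw [this, hψ0, Complex.arg_one]
    ring
  · have h1 : |‖Z b‖ - ‖z₀‖| ≤ d := by
      have := abs_norm_sub_norm_le (Z b * Complex.exp (Complex.I * (ψ b : ℂ))) z₀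
      rw [norm_mul, mul_comm Complex.I, Complex.norm_exp_ofReal_mul_I, mul_one,
        mul_comm _ Complex.I] at this
      exact this.trans (hd b hb)
    have h2 := abs_le.1 h1
    have e : ‖Z b‖ ^ 2 / 2 - ϱ₀ = (‖Z b‖ - ‖z₀‖) * ((‖Z b‖ + ‖z₀‖) / 2) := by
      have : ‖z₀‖ ^ 2 = 2 * ϱ₀ := by rw [hn0, Real.sq_sqrt (by linarith)]
      linear_combination (1 / 2) * this
    simp only
    rw [e, abs_mul, abs_of_nonneg (show 0 ≤ (‖Z b‖ + ‖z₀‖) / 2 by positivity), mul_comm]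
    exact mul_le_mul (by linarith) h1 (abs_nonneg _) (by positivity)
  · have e : φ₀ - ψ b + (W b).arg - (φ₀ - ψ b) = (Complex.log (1 + (W b - 1))).im := by
      rw [Complex.log_im, add_sub_cancel, add_sub_cancel_left]
    simp only
    rw [e]
    have h1 := hW1 b hb
    have := Complex.norm_log_one_add_half_le_self (h1.trans hd2)
    refine (Complex.abs_im_le_norm _).trans (this.trans ?_)
    have := norm_nonneg (W b - 1)
    linarith

/-! ### The inner map -/

theorem BranchData.Regular.continuousOn_zVar_comp {D : BranchData} {U : ℝ} (h : D.Regular U)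
    {ε a : ℝ} (hε : 0 < ε) (ha : 0 < a) {X : ℝ → ℝ × ℝ} (hX : ContinuousOn X (Icc a U)) :
    ContinuousOn (D.zVar ε (fun u => (X u).1) (fun u => (X u).2)) (Icc a U) := by
  have hc := (h.continuousOn_zVar hε ha).comp (continuousOn_id.prodMk hX)
    fun u hu => mk_mem_prod hu (mem_univ _)
  refine hc.congr fun u _ => ?_
  simp only [Function.comp_apply, BranchData.zVar, id]

namespace SlowFastAssumptions

variable {f : ℝ → ℝ} {M : ℝ → ℝ → ℝ → ℝ} {V : ℝ → ℝ → ℝ} {τ : ℝ} {κ : ℝ → ℝ}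
  (hs : SlowFastAssumptions f M V τ κ)

theorem isOrbitOn_iff {ε a b : ℝ} {x y : ℝ → ℝ} : IsOrbitOn f M V ε a b x y ↔
    ∀ u ∈ Icc a b, HasDerivWithinAt (fun u => (x u, y u)) (slowFastField f M V ε (u, x u, y u))
      (Icc a b) u :=
  forall₂_congr fun _ _ => ⟨fun h => h.1.prodMk h.2, fun h => ⟨h.fst, h.snd⟩⟩

/-- The system is invariant under `(x, y) ↦ (-x, -y)`. -/
theorem _root_.IsOrbitOn.smul {ε a b η : ℝ} {x y : ℝ → ℝ} (h : IsOrbitOn f M V ε a b x y)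
    (hη : η ^ 2 = 1) : IsOrbitOn f M V ε a b (fun u => η * x u) (fun u => η * y u) := by
  intro u hu
  obtain ⟨h1, h2⟩ := h u hu
  refine ⟨(h1.const_mul η).congr_deriv ?_, (h2.const_mul η).congr_deriv ?_⟩
  · rw [mul_pow, mul_pow, hη, one_mul, one_mul]; ring
  · rw [mul_pow, mul_pow, hη, one_mul, one_mul]; ring

theorem _root_.IsOrbitOn.congr {ε a b : ℝ} {x y x' y' : ℝ → ℝ} (h : IsOrbitOn f M V ε a b x y)
    (hx : EqOn x' x (Icc a b)) (hy : EqOn y' y (Icc a b)) : IsOrbitOn f M V ε a b x' y' := by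
  intro u hu
  rw [hx hu, hy hu]
  exact ⟨(h u hu).1.congr_of_mem hx hu, (h u hu).2.congr_of_mem hy hu⟩

include hs

section Branch

variable {k₀ : ℝ → ℝ} (h : (⟨M, V, k₀⟩ : BranchData).Regular (τ / 2))
  (hk : ∀ u ∈ Ioc 0 (τ / 2), κ u ^ 2 = u * k₀ u)
include h hk

theorem eq_of_inner_eq {ε δ η u ϱ₁ φ₁ ϱ₂ φ₂ : ℝ} (hε : 0 < ε) (hδ : 0 < δ) (hη : η ≠ 0)
    (hu : u ∈ Ioc 0 (τ / 2))
    (hx : innerX f M V κ ε δ η u ϱ₁ φ₁ = innerX f M V κ ε δ η u ϱ₂ φ₂)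
    (hy : innerY f M V κ ε δ η u ϱ₁ φ₁ = innerY f M V κ ε δ η u ϱ₂ φ₂) :
    (Real.sqrt (2 * ϱ₁) : ℂ) * Complex.exp (φ₁ * Complex.I)
      = Real.sqrt (2 * ϱ₂) * Complex.exp (φ₂ * Complex.I) := by
  have hre : ∀ ϱ φ : ℝ, ((Real.sqrt (2 * ϱ) : ℂ) * Complex.exp (φ * Complex.I)).re
      = Real.sqrt (2 * ϱ) * Real.cos φ := fun ϱ φ => by
    rw [Complex.re_ofReal_mul, Complex.exp_ofReal_mul_I_re]
  have him : ∀ ϱ φ : ℝ, ((Real.sqrt (2 * ϱ) : ℂ) * Complex.exp (φ * Complex.I)).im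
      = Real.sqrt (2 * ϱ) * Real.sin φ := fun ϱ φ => by
    rw [Complex.im_ofReal_mul, Complex.exp_ofReal_mul_I_im]
  rw [hs.innerX_eq h hk hε hδ hu _ _ _ (hre ϱ₁ φ₁),
    hs.innerX_eq h hk hε hδ hu _ _ _ (hre ϱ₂ φ₂)] at hx
  rw [hs.innerY_eq h hk hε hδ hu _ _ _ (him ϱ₁ φ₁),
    hs.innerY_eq h hk hε hδ hu _ _ _ (him ϱ₂ φ₂)] at hy
  have e := fun z : ℂ => h.zVar_eq_iff hε hu
    (fun _ => (⟨M, V, k₀⟩ : BranchData).xVar ε ((Real.sqrt (2 * ϱ₁) : ℂ)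
      * Complex.exp (φ₁ * Complex.I)) u)
    (fun _ => (⟨M, V, k₀⟩ : BranchData).yVar ε ((Real.sqrt (2 * ϱ₁) : ℂ)
      * Complex.exp (φ₁ * Complex.I)) u) z
  exact ((e _).2 ⟨rfl, rfl⟩).symm.trans
    ((e _).2 ⟨mul_left_cancel₀ hη hx, mul_left_cancel₀ hη hy⟩)

/-- The inner map is single-valued. -/
theorem innerMapsTo_unique {ε δ uStar η : ℝ} (hε : 0 < ε) (hδ : 0 < δ) (hη : η ≠ 0)
    (huStar : 0 < uStar) {p q₁ q₂ : ℝ × ℝ} (h₁ : InnerMapsTo f M V τ κ ε δ uStar η p q₁)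
    (h₂ : InnerMapsTo f M V τ κ ε δ uStar η p q₂) : q₁ = q₂ := by
  obtain ⟨hlt, ϱ₁, φ₁, -, c₁, p₁, o₁, i₁, rfl⟩ := h₁
  obtain ⟨-, ϱ₂, φ₂, -, c₂, p₂, o₂, i₂, rfl⟩ := h₂
  obtain ⟨iϱ, iφ⟩ := Prod.ext_iff.1 (i₁.trans i₂.symm)
  have hu₀ : 0 < muScale ε δ ^ 2 * uStar := mul_pos (pow_pos (muScale_pos hε hδ) 2) huStar
  have hX := solution_unique (hs.contDiff_slowFastField ε) (isOrbitOn_iff.1 o₁)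
    (isOrbitOn_iff.1 o₂) (by
      change ϱ₁ _ = ϱ₂ _ at iϱ
      change φ₁ _ = φ₂ _ at iφ
      simp only [iϱ, iφ])
  have := polar_unique hlt.le c₁ c₂ p₁ p₂ (fun u hu => by
    obtain ⟨ex, ey⟩ := Prod.ext_iff.1 (hX hu)
    exact hs.eq_of_inner_eq h hk hε hδ hη ⟨hu₀.trans_le hu.1, hu.2⟩ ex ey) iφ
  exact Prod.ext this.1 this.2

/-- An orbit close to a rotation in the rescaled variable gives a value of the inner map. -/
theorem exists_innerMapsTo {ε δ uStar η ϱ₀ φ₀ d : ℝ} (hε : 0 < ε) (hδ : 0 < δ) (hη : η ^ 2 = 1)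
    (huStar : 0 < uStar) (hlt : muScale ε δ ^ 2 * uStar < τ / 2) (hϱ₀ : 0 < ϱ₀)
    {X : ℝ → ℝ × ℝ} {z₀ : ℂ} (hz₀ : z₀ = Real.sqrt (2 * ϱ₀) * Complex.exp (φ₀ * Complex.I))
    (hX : ∀ u ∈ Icc (muScale ε δ ^ 2 * uStar) (τ / 2), HasDerivWithinAt X
      (slowFastField f M V ε (u, X u)) (Icc (muScale ε δ ^ 2 * uStar) (τ / 2)) u)
    (hX0 : (⟨M, V, k₀⟩ : BranchData).zVar ε (fun u => (X u).1) (fun u => (X u).2)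
      (muScale ε δ ^ 2 * uStar) = z₀)
    (hXd : ∀ u ∈ Icc (muScale ε δ ^ 2 * uStar) (τ / 2),
      ‖(⟨M, V, k₀⟩ : BranchData).zVar ε (fun u => (X u).1) (fun u => (X u).2) u
        * Complex.exp (Complex.I * ((∫ v in (muScale ε δ ^ 2 * uStar)..u,
          (⟨M, V, k₀⟩ : BranchData).angVel ε ‖z₀‖ v : ℝ) : ℂ)) - z₀‖ ≤ d)
    (hd : d ≤ ‖z₀‖ / 2) :
    ∃ q : ℝ × ℝ, InnerMapsTo f M V τ κ ε δ uStar η (ϱ₀, φ₀) q ∧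
      |q.1 - ϱ₀| ≤ 2 * ‖z₀‖ * d ∧
      |q.2 - (φ₀ - ∫ v in (muScale ε δ ^ 2 * uStar)..(τ / 2),
        (⟨M, V, k₀⟩ : BranchData).angVel ε ‖z₀‖ v)| ≤ 2 * (d / ‖z₀‖) := by
  set D : BranchData := ⟨M, V, k₀⟩ with hD
  set u₀ := muScale ε δ ^ 2 * uStar with hu₀
  have hu₀pos : 0 < u₀ := mul_pos (pow_pos (muScale_pos hε hδ) 2) huStar
  have hXc : ContinuousOn X (Icc u₀ (τ / 2)) := fun u hu => (hX u hu).continuousWithinAt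
  have hψ : ContinuousOn (fun u => ∫ v in u₀..u, D.angVel ε ‖z₀‖ v) (Icc u₀ (τ / 2)) := fun u hu =>
    (hasDerivWithinAt_integral_of_continuousOn hlt.le
      (h.continuousOn_angVel hε hu₀pos ‖z₀‖) hu).continuousWithinAt
  obtain ⟨ϱ, φ, cϱ, cφ, hpos, hpol, ha, hb, b1, b2⟩ := exists_polar hlt.le hϱ₀ hz₀
    (h.continuousOn_zVar_comp hε hu₀pos hXc) hψ
    intervalIntegral.integral_same hX0 hXd hd
  refine ⟨(ϱ (τ / 2), φ (τ / 2)), ⟨hlt, ϱ, φ, cϱ, cφ, hpos, ?_, by rw [← hu₀, ha, hb], rfl⟩, b1, b2⟩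
  have ho : IsOrbitOn f M V ε u₀ (τ / 2) (fun u => (X u).1) (fun u => (X u).2) :=
    isOrbitOn_iff.2 hX
  have hxy : ∀ u ∈ Icc u₀ (τ / 2), innerX f M V κ ε δ η u (ϱ u) (φ u) = η * (X u).1 ∧
      innerY f M V κ ε δ η u (ϱ u) (φ u) = η * (X u).2 := fun u hu => by
    have hu' : u ∈ Ioc 0 (τ / 2) := ⟨hu₀pos.trans_le hu.1, hu.2⟩
    obtain ⟨e1, e2⟩ := (h.zVar_eq_iff hε hu' _ _ _).1 (hpol u hu)
    rw [e1, e2]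
    exact ⟨hs.innerX_eq h hk hε hδ hu' η _ _
        (by rw [Complex.re_ofReal_mul, Complex.exp_ofReal_mul_I_re]),
      hs.innerY_eq h hk hε hδ hu' η _ _
        (by rw [Complex.im_ofReal_mul, Complex.exp_ofReal_mul_I_im])⟩
  exact (ho.smul hη).congr (fun u hu => (hxy u hu).1) fun u hu => (hxy u hu).2

end Branch

end SlowFastAssumptions

theorem mainTheorem3 (f : ℝ → ℝ) (M : ℝ → ℝ → ℝ → ℝ) (V : ℝ → ℝ → ℝ) (τ : ℝ) (κ : ℝ → ℝ)
    (hsys : SlowFastAssumptions f M V τ κ) :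
    ∃ e₂ : ℝ, 0 < e₂ ∧
      ∀ uStar : ℝ, 0 < uStar → ∀ a b : ℝ, 0 < a → a ≤ b →
        ∃ r : ℝ, 0 < r ∧ ∃ C : ℝ, 0 < C ∧
          ∀ ε δ : ℝ, 0 < ε → ε ≤ r → 0 < δ →
            δ ^ (3 / 4 : ℝ) * Real.log ε⁻¹ ≤ r →
            ε ^ (2 / 3 : ℝ) * δ ^ (-(7 / 2) : ℝ) * Real.log δ⁻¹ ^ 3 ≤ r →
            ∀ η : ℝ, (η = 1 ∨ η = -1) →
              ∀ ϱ₀ : ℝ, a ≤ ϱ₀ → ϱ₀ ≤ b → ∀ φ₀ : ℝ,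
                (∃! q : ℝ × ℝ, InnerMapsTo f M V τ κ ε δ uStar η (ϱ₀, φ₀) q) ∧
                ∀ q : ℝ × ℝ, InnerMapsTo f M V τ κ ε δ uStar η (ϱ₀, φ₀) q →
                  |q.1 - ϱ₀| ≤ C * (δ ^ (3 / 4 : ℝ) * Real.log ε⁻¹) ∧
                  |q.2 - (φ₀ - Real.sqrt 2 * ε⁻¹ * eOne f M V τ κ
                      + (2 * Real.log (e₂ * ε⁻¹) - 3 * Real.log (δ⁻¹ * uStar)) * ϱ₀
                      + 2 * Real.sqrt 2 / 3 * δ ^ (-(3 / 2) : ℝ) * uStar ^ (3 / 2 : ℝ))|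
                    ≤ C * (δ ^ (3 / 4 : ℝ) * Real.log ε⁻¹) := by
  obtain ⟨k₀, h, hk⟩ := hsys.exists_regular
  set D : BranchData := ⟨M, V, k₀⟩ with hD
  have hU : 0 < τ / 2 := half_pos hsys.tau_pos
  obtain ⟨e, Cp, hCp, hphase⟩ := h.exists_phase_bound hU.le
  refine ⟨Real.exp ((3 * Real.log (τ / 2) + 2 * e) / 2), Real.exp_pos _,
    fun uStar huStar a b ha hab => ?_⟩
  obtain ⟨Co, ro, hCo, hro, horbit⟩ := h.exists_orbit (Real.sqrt (2 * b))
  obtain ⟨rq, Cq, hrq, hCq, hparams⟩ := exists_params_bound hU huStar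
  have hA : 0 < Real.sqrt (2 * a) := Real.sqrt_pos.2 (by linarith)
  have hb : 0 < b := ha.trans_le hab
  refine ⟨min rq (min (ro / Cq) (Real.sqrt (2 * a) / 2 / (Co * Cq))), by positivity,
    2 * Real.sqrt (2 * b) * (Co * Cq) + (2 * (Co * Cq / Real.sqrt (2 * a))
      + Cp * (Cq + 2 * b * Cq)), by positivity,
    fun ε δ hε hεr hδ hr1 hr2 η hη ϱ₀ haϱ hϱb φ₀ => ?_⟩
  have hr1q := hr1.trans (min_le_left _ _)
  obtain ⟨hu₀, hlt, hb1, hb2, hb3⟩ := hparams ε δ hε (hεr.trans (min_le_left _ _)) hδ hr1q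
    (hr2.trans (min_le_left _ _))
  set u₀ := muScale ε δ ^ 2 * uStar with hu₀def
  set Q := δ ^ (3 / 4 : ℝ) * Real.log ε⁻¹ with hQ
  have hQpos : 0 < Q := pos_of_mul_pos_right (hu₀.trans_le hb3) hCq.le
  have hQo : Cq * Q ≤ ro := by
    have := hr1.trans ((min_le_right _ _).trans (min_le_left _ _))
    rwa [le_div_iff₀ hCq, mul_comm] at this
  have hQa : Co * Cq * Q ≤ Real.sqrt (2 * a) / 2 := by
    have := hr1.trans ((min_le_right _ _).trans (min_le_right _ _))
    rwa [le_div_iff₀ (mul_pos hCo hCq), mul_comm] at this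
  have hϱ₀ : 0 < ϱ₀ := ha.trans_le haϱ
  set z₀ : ℂ := Real.sqrt (2 * ϱ₀) * Complex.exp (φ₀ * Complex.I) with hz₀
  have hn0 : ‖z₀‖ = Real.sqrt (2 * ϱ₀) := by
    rw [hz₀, norm_mul, Complex.norm_exp_ofReal_mul_I, mul_one, Complex.norm_real,
      Real.norm_of_nonneg (Real.sqrt_nonneg _)]
  have hna : Real.sqrt (2 * a) ≤ ‖z₀‖ := hn0 ▸ Real.sqrt_le_sqrt (by linarith)
  have hnb : ‖z₀‖ ≤ Real.sqrt (2 * b) := hn0 ▸ Real.sqrt_le_sqrt (by linarith)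
  have hnpos : 0 < ‖z₀‖ := hA.trans_le hna
  have hn2 : ‖z₀‖ ^ 2 = 2 * ϱ₀ := by rw [hn0, Real.sq_sqrt (by linarith)]
  have hη1 : η ^ 2 = 1 := by rcases hη with rfl | rfl <;> norm_num
  have hη0 : η ≠ 0 := by rintro rfl; norm_num at hη1
  obtain ⟨X, hX, hX0, hXd⟩ := horbit ε u₀ (slowFastField f M V ε) hε ⟨hu₀, hlt.le⟩
    (hsys.contDiff_slowFastField ε) (fun u hu x y => hsys.slowFastField_eq hk ε hu x y)
    (hb1.trans hQo) z₀ hnb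
  have hd : ∀ u ∈ Icc u₀ (τ / 2), _ ≤ Co * Cq * Q := fun u hu => (hXd u hu).trans (by
    rw [mul_assoc]; exact mul_le_mul_of_nonneg_left hb1 hCo.le)
  obtain ⟨q, hq, hq1, hq2⟩ := hsys.exists_innerMapsTo h hk hε hδ hη1 huStar hlt hϱ₀ hz₀ hX hX0 hd
    (hQa.trans (by linarith))
  have huniq : ∀ q', InnerMapsTo f M V τ κ ε δ uStar η (ϱ₀, φ₀) q' → q' = q := fun q' hq' =>
    hsys.innerMapsTo_unique h hk hε hδ hη0 huStar hq' hq
  refine ⟨⟨q, hq, huniq⟩, fun q' hq' => ?_⟩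
  rw [huniq q' hq']
  have hc1 : 0 ≤ 2 * Real.sqrt (2 * b) * (Co * Cq) * Q := by positivity
  have hc2 : 0 ≤ (2 * (Co * Cq / Real.sqrt (2 * a)) + Cp * (Cq + 2 * b * Cq)) * Q := by positivity
  constructor
  · have : 2 * ‖z₀‖ * (Co * Cq * Q) ≤ 2 * Real.sqrt (2 * b) * (Co * Cq * Q) := by gcongr
    linarith
  · have hp := hphase ε u₀ ‖z₀‖ hε ⟨hu₀, hlt.le⟩
    rw [hsys.integral_sqrt_mul_ω h hk, hn2] at hp
    have hp' : Cp * (ε⁻¹ * (u₀ ^ 2 * Real.sqrt u₀) + 2 * ϱ₀ * u₀)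
        ≤ Cp * (Cq + 2 * b * Cq) * Q := by
      rw [mul_assoc Cp]
      refine mul_le_mul_of_nonneg_left ?_ hCp
      have := mul_le_mul (show 2 * ϱ₀ ≤ 2 * b by linarith) hb3 hu₀.le (by positivity)
      linarith
    have hq2' : 2 * (Co * Cq * Q / ‖z₀‖) ≤ 2 * (Co * Cq / Real.sqrt (2 * a)) * Q := by
      rw [mul_assoc 2, div_mul_eq_mul_div]
      gcongr
    have e1 := inv_mul_muScale_sqrt hε hδ huStar
    have e2 := log_inv_muScale hε hδ huStar
    rw [← hu₀def] at e1 e2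
    have e3 : Real.log (τ / 2 / u₀) = Real.log (τ / 2) - Real.log u₀ :=
      Real.log_div hU.ne' hu₀.ne'
    have e4 : 2 * Real.log (Real.exp ((3 * Real.log (τ / 2) + 2 * e) / 2) * ε⁻¹)
        = 3 * Real.log (τ / 2) + 2 * e + 2 * Real.log ε⁻¹ := by
      rw [Real.log_mul (Real.exp_pos _).ne' (inv_pos.2 hε).ne', Real.log_exp]
      ring
    rw [e3] at hp
    have hsum := (abs_sub _ _).trans (add_le_add (hq2.trans hq2') (hp.trans hp'))
    refine (le_of_eq ?_).trans (hsum.trans (by linarith))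
    congr 1
    rw [e4]
    linear_combination 2 * Real.sqrt 2 / 3 * e1 - ϱ₀ * e2

end
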